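/- Let $V$ be a real vector space of finite dimension $n$ with an inner product, and let $\mathcal S\subset\Lambda^2V^*\otimes V$ be the set of all solvable Lie brackets on $V$. Each $\mu\in\mathcal S$ is identified with the left-invariant metric defined by the inner product on the simply connected Lie group with Lie algebra $(V,\mu)$; let $\mathcal S_{flat}$ be the set of those $\mu\in\mathcal S$ for which this metric is flat. For $\mu\in\mathcal S\setminus\mathcal S_{flat}$ put $F(\mu)=\mathrm{scal}_\mu^2/|\mathrm{Ric}_\mu|^2$, where $\mathrm{Ric}_\mu$ is the Ricci operator and $\mathrm{scal}_\mu$ the scalar curvature of the metric; for $\mathcal C\subset\mathcal S$, $F(\mathcal C)$ means $F(\mathcal C\setminus\mathcal S_{flat})$. The group $GL(V)$ acts by $(h\cdot\mu)(x,y)=h\mu(h^{-1}x,h^{-1}y)$. Put $m_\mu=\inf F(GL(V)\cdot\mu)$ and $M_\mu=\sup F(GL(V)\cdot\mu)$. Let $\mathcal S_{\mathbb R}$ be the set of brackets of real type, i.e. of those $\mu\in\mathcal S$ such that, for every $X\in V$, the operator $\mathrm{ad}_\mu X=\mu(X,\cdot)$ is nilpotent or has a complex eigenvalue that is not purely imaginary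 ($0$ counts as purely imaginary). (i) For every nonzero $\mu\in\mathcal S_{\mathbb R}$, $0<m_\mu$ and $F\big(\overline{GL(V)\cdot\mu}\big)=[m_\mu,M_\mu]$. (ii) If $n\ge 4$, then $\inf\{m_\mu : \mu\in\mathcal S_{\mathbb R},\ \mu\neq 0\}=0$ and $F(\mathcal S_{\mathbb R})=(0,n]$. (iii) For every $\mu\in\mathcal S\setminus\mathcal S_{\mathbb R}$, $F(GL(V)\cdot\mu)$ is nonempty and $m_\mu=0$. -/

import Mathlib

namespace RicciPinching

section
variable {V : Type*} [NormedAddCommGroup V] [InnerProductSpace ℝ V]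

/-- `μ` is a Lie bracket on the real vector space `V`. -/
structure IsLieBracket (μ : V →L[ℝ] V →L[ℝ] V) : Prop where
  self : ∀ x, μ x x = 0
  jacobi : ∀ x y z, μ x (μ y z) = μ (μ x y) z + μ y (μ x z)

/-- The Lie ring `(V, μ)`, with the addition of `V` and the bracket `μ`. -/
noncomputable abbrev IsLieBracket.lieRing {μ : V →L[ℝ] V →L[ℝ] V} (h : IsLieBracket μ) : LieRing V where
  bracket x y := μ x y
  add_lie x y z := by simp
  lie_add x y z := by simp
  lie_self x := h.self x
  leibniz_lie x y z := h.jacobi x y z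

variable (V) in
/-- The set of all solvable Lie brackets on `V`. -/
def solvableBrackets : Set (V →L[ℝ] V →L[ℝ] V) :=
  {μ | ∃ h : IsLieBracket μ, @LieAlgebra.IsSolvable V h.lieRing}

/-- The complex spectrum of a real operator, i.e. the spectrum of its complexification. -/
def complexSpectrum (A : V →L[ℝ] V) : Set ℂ :=
  spectrum ℂ ((A : V →ₗ[ℝ] V).baseChange ℂ)

variable (V) in
/-- The set of all solvable Lie brackets of real type: each `ad X = μ X` is either nilpotent or
has an eigenvalue which is not purely imaginary. -/
def realType : Set (V →L[ℝ] V →L[ℝ] V) :=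
  {μ | μ ∈ solvableBrackets V ∧
    ∀ x, IsNilpotent (μ x) ∨ ¬ complexSpectrum (μ x) ⊆ {z : ℂ | z.re = 0}}

/-- The change of basis action `(h · μ)(x, y) = h μ(h⁻¹ x, h⁻¹ y)` of `GL(V)`. -/
noncomputable def glAct (h : V ≃L[ℝ] V) (μ : V →L[ℝ] V →L[ℝ] V) : V →L[ℝ] V →L[ℝ] V :=
  (ContinuousLinearMap.compL ℝ V V V (h : V →L[ℝ] V)).comp
    (μ.bilinearComp (h.symm : V →L[ℝ] V) (h.symm : V →L[ℝ] V))

theorem glAct_apply (h : V ≃L[ℝ] V) (μ : V →L[ℝ] V →L[ℝ] V) (x y : V) :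
    glAct h μ x y = h (μ (h.symm x) (h.symm y)) := rfl

/-- The orbit `GL(V) · μ`. -/
def glOrbit (μ : V →L[ℝ] V →L[ℝ] V) : Set (V →L[ℝ] V →L[ℝ] V) :=
  Set.range fun h : V ≃L[ℝ] V => glAct h μ

variable [FiniteDimensional ℝ V]

/-- The Levi-Civita connection, on left-invariant vector fields, of the left-invariant metric
defined by the inner product of `V` on the Lie group with Lie algebra `(V, μ)`:
`∇_x y = (1/2) ([x, y] - (ad x)ᵗ y - (ad y)ᵗ x)`. -/
noncomputable def leviCivita (μ : V →L[ℝ] V →L[ℝ] V) : V →ₗ[ℝ] V →ₗ[ℝ] V :=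
  LinearMap.mk₂ ℝ
    (fun x y => (1 / 2 : ℝ) • (μ x y - LinearMap.adjoint (μ x : V →ₗ[ℝ] V) y
      - LinearMap.adjoint (μ y : V →ₗ[ℝ] V) x))
    (fun x x' y => by simp; module)
    (fun c x y => by simp; module)
    (fun x y y' => by simp; module)
    (fun c x y => by simp; module)

/-- Koszul's formula, which characterizes the Levi-Civita connection. -/
theorem inner_leviCivita {μ : V →L[ℝ] V →L[ℝ] V} (h : IsLieBracket μ) (x y z : V) :
    2 * inner ℝ (leviCivita μ x y) z =
      inner ℝ (μ x y) z - inner ℝ (μ y z) x + inner ℝ (μ z x) y := by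
  have hs : μ z x = - μ x z := by
    have := h.self (x + z)
    simp only [map_add, add_apply, h.self] at this
    rw [zero_add, add_zero, add_comm] at this
    exact eq_neg_of_add_eq_zero_right this
  simp only [leviCivita, LinearMap.mk₂_apply, inner_smul_left, inner_sub_left,
    LinearMap.adjoint_inner_left, ContinuousLinearMap.coe_coe, hs, inner_neg_left]
  rw [real_inner_comm (μ x z) y, real_inner_comm (μ y z) x]
  simp
  ring

/-- The Riemann curvature operator `R(x, y) = [∇_x, ∇_y] - ∇_[x, y]`. -/
noncomputable def curvature (μ : V →L[ℝ] V →L[ℝ] V) (x y : V) : V →ₗ[ℝ] V :=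
  leviCivita μ x ∘ₗ leviCivita μ y - leviCivita μ y ∘ₗ leviCivita μ x - leviCivita μ (μ x y)

/-- The Ricci operator `Ric x = ∑ R(x, eᵢ) eᵢ`, with `(eᵢ)` an orthonormal basis of `V`. -/
noncomputable def ricci (μ : V →L[ℝ] V →L[ℝ] V) : V →ₗ[ℝ] V where
  toFun x := ∑ i, curvature μ x (stdOrthonormalBasis ℝ V i) (stdOrthonormalBasis ℝ V i)
  map_add' x y := by
    rw [← Finset.sum_add_distrib]
    refine Finset.sum_congr rfl fun i _ => ?_
    simp [curvature]
    abel
  map_smul' c x := by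
    rw [RingHom.id_apply, Finset.smul_sum]
    refine Finset.sum_congr rfl fun i _ => ?_
    simp [curvature, smul_sub]

/-- The scalar curvature. -/
noncomputable def scalarCurvature (μ : V →L[ℝ] V →L[ℝ] V) : ℝ :=
  LinearMap.trace ℝ V (ricci μ)

/-- The squared norm `|Ric|² = tr (Ricᵗ Ric)` of the Ricci operator. -/
noncomputable def ricciNormSq (μ : V →L[ℝ] V →L[ℝ] V) : ℝ :=
  LinearMap.trace ℝ V (LinearMap.adjoint (ricci μ) ∘ₗ ricci μ)

variable (V) in
/-- The solvable Lie brackets whose left-invariant metric is flat. -/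
def flatBrackets : Set (V →L[ℝ] V →L[ℝ] V) :=
  {μ | μ ∈ solvableBrackets V ∧ ∀ x y, curvature μ x y = 0}

/-- The Ricci pinching functional `F = scal² / |Ric|²`; it is meaningful at nonflat brackets. -/
noncomputable def pinching (μ : V →L[ℝ] V →L[ℝ] V) : ℝ :=
  scalarCurvature μ ^ 2 / ricciNormSq μ

/-- The set `F(C)` of the values of `F` at the nonflat elements of `C`. -/
def pinchingValues (C : Set (V →L[ℝ] V →L[ℝ] V)) : Set ℝ :=
  pinching '' (C \ flatBrackets V)

/-- The infimum `m_μ` of `F` over the orbit `GL(V) · μ`. -/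
noncomputable def pinchingInf (μ : V →L[ℝ] V →L[ℝ] V) : ℝ :=
  sInf (pinchingValues (glOrbit μ))

/-- The supremum `M_μ` of `F` over the orbit `GL(V) · μ`. -/
noncomputable def pinchingSup (μ : V →L[ℝ] V →L[ℝ] V) : ℝ :=
  sSup (pinchingValues (glOrbit μ))

end

end RicciPinching

open RicciPinching

/-! For a solvable bracket the Killing form vanishes on the derived algebra $\mathfrak n$. Then
$-\mathrm{scal}$ is a sum of nonnegative terms: the squared mean curvature, the brackets inside
$\mathfrak n$ and inside $\mathfrak n^\perp$, and the symmetric part of the action of $\mathfrak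
n^\perp$ on $\mathfrak n$. So $\mathrm{scal}=0$ forces $\mathfrak n$ and $\mathfrak n^\perp$ abelian
with $\mathfrak n^\perp$ acting by skew operators, which is a flat metric (`exists_isFlatBracket`).
Hence $F$ is positive and continuous off the flat brackets, and $F\le n$ by Cauchy–Schwarz.

Part (i). By Lie's theorem the eigenvalues of $\mathrm{ad}\,x$ are weights, linear in $x$. Real type
says that they are controlled by their real parts, with a constant that is the same along the whole
orbit. A limit in which $\mathrm{ad}\,x$ becomes skew therefore has
$\mathrm{tr}(\mathrm{ad}\,x)^2=0$, so $\mathrm{ad}\,x=0$ there. Thus the only flat bracket in the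
orbit closure is $0$ (`scalarCurvature_ne_zero_of_mem_closure`). Since $F$ is scale invariant, its
values on the closure are its values on a compact slice; the values on the orbit form a connected
set, and a compact interval of positive numbers results.

Part (iii). If $\mathrm{ad}\,x$ is not nilpotent but has imaginary spectrum, it can be conjugated to
be almost skew, and the bracket degenerates to an almost abelian one in which a unit vector $X$ acts
by this operator. A compactness argument gives in the orbit closure an almost abelian flat bracket
with skew $E\ne0$ (`exists_skew_mem_closure`). Stretching $E$ by $s$ in one direction gives
$\mathrm{scal}$ of order $(s-1)^2$ but $\mathrm{Ric}$ at least of order $s-1$, so $F\to0$ as $s\to1$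
(`pinching_stretch`).

Part (ii). The same stretched rotation, with a small real eigenvalue added in a fourth direction, is
of real type and has small $F$. A convex family of operators joins it to real hyperbolic space,
where $F=n$. -/

namespace RicciPinching

/-! ### Spectra of operators and Lie's theorem on weights -/

section Spectra

open Module

variable {k M N : Type*} [Field k] [AddCommGroup M] [Module k M]
  [AddCommGroup N] [Module k N] [Module.Finite k N]

/-- The spectrum of an operator contains the spectra of the operators induced on quotients. -/
theorem spectrum_subset_of_intertwining {q : M →ₗ[k] N} (hq : Function.Surjective q)
    {f : End k M} {g : End k N} (h : ∀ x, q (f x) = g (q x)) : spectrum k g ⊆ spectrum k f := by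
  intro c hc hu
  refine hc ?_
  rw [spectrum.mem_resolventSet_iff, End.isUnit_iff] at hu ⊢
  have hs : Function.Surjective (algebraMap k (End k N) c - g) := by
    intro y
    obtain ⟨x, rfl⟩ := hq y
    obtain ⟨z, hz⟩ := hu.2 x
    refine ⟨q z, ?_⟩
    rw [← hz]
    simp [h]
  exact ⟨LinearMap.injective_iff_surjective.2 hs, hs⟩

theorem mem_spectrum_of_apply_eq_smul {f : End k M} {c : k} {v : M} (hv : v ≠ 0)
    (h : f v = c • v) : c ∈ spectrum k f :=
  End.HasEigenvalue.mem_spectrum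
    (End.hasEigenvalue_of_hasEigenvector ⟨End.mem_eigenspace_iff.2 h, hv⟩)

variable [Module.Finite k M]

theorem exists_apply_eq_smul_of_mem_spectrum {f : End k M} {c : k} (hc : c ∈ spectrum k f) :
    ∃ v, v ≠ 0 ∧ f v = c • v := by
  obtain ⟨v, hv⟩ := (End.HasEigenvalue.of_mem_spectrum hc).exists_hasEigenvector
  exact ⟨v, hv.2, hv.apply_eq_smul⟩

/-- If `v` is an eigenvector with eigenvalue `c`, then the spectrum consists of `c` and the
spectrum of the operator induced on the quotient by `v`. -/
theorem spectrum_eq_insert_of_intertwining {q : M →ₗ[k] N} (hq : Function.Surjective q)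
    {f : End k M} {g : End k N} (h : ∀ x, q (f x) = g (q x)) {v : M} (hv : v ≠ 0) {c : k}
    (hfv : f v = c • v) (hker : LinearMap.ker q = k ∙ v) :
    spectrum k f = insert c (spectrum k g) := by
  refine subset_antisymm (fun a ha => ?_) (Set.insert_subset
    (mem_spectrum_of_apply_eq_smul hv hfv) (spectrum_subset_of_intertwining hq h))
  obtain ⟨w, hw, hfw⟩ := exists_apply_eq_smul_of_mem_spectrum ha
  by_cases hqw : q w = 0
  · left
    have : w ∈ k ∙ v := hker ▸ hqw
    obtain ⟨b, rfl⟩ := Submodule.mem_span_singleton.1 this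
    have h1 : (b * (c - a)) • v = 0 := by
      rw [map_smul, hfv, smul_smul, smul_smul] at hfw
      rw [mul_sub, sub_smul, hfw, mul_comm b a, sub_self]
    have hb : b ≠ 0 := fun hb => hw (by simp [hb])
    have := (smul_eq_zero.1 h1).resolve_right hv
    exact (sub_eq_zero.1 ((mul_eq_zero.1 this).resolve_left hb)).symm
  · right
    exact mem_spectrum_of_apply_eq_smul hqw (by rw [← h, hfw, map_smul])

/-- The weights of a representation of a solvable Lie algebra. -/
theorem exists_weights [CharZero k] [IsAlgClosed k] {L : Type*} [LieRing L] [LieAlgebra k L]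
    [LieAlgebra.IsSolvable L] (n : ℕ) :
    ∀ (M : Type*) [AddCommGroup M] [Module k M] [Module.Finite k M] [LieRingModule L M]
      [LieModule k L M], finrank k M = n →
      ∃ s : Finset (Dual k L), (∀ x, spectrum k (LieModule.toEnd k L M x) = (fun χ : Dual k L => χ x) '' s) ∧
        ∀ χ ∈ s, ∀ x y : L, χ ⁅x, y⁆ = 0 := by
  classical
  induction n with
  | zero =>
    intro M _ _ _ _ _ hM
    have := finrank_zero_iff.1 hM
    refine ⟨∅, fun x => ?_, by simp⟩
    simp [spectrum.of_subsingleton]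
  | succ n ih =>
    intro M _ _ _ _ _ hM
    have : Nontrivial M := nontrivial_of_finrank_pos (R := k) (by omega)
    -- Lie's theorem gives a common eigenvector. Its line is a submodule, and the remaining weights
    -- come from the quotient.
    obtain ⟨χ, hχ⟩ := LieModule.exists_nontrivial_weightSpace_of_isSolvable k L M
    obtain ⟨⟨v, hv⟩, hne⟩ := exists_ne (0 : LieModule.weightSpace M χ)
    have hv0 : v ≠ 0 := fun h => hne (by simpa using h)
    rw [LieModule.mem_weightSpace] at hv
    let P : LieSubmodule k L M :=
      { (k ∙ v) with
        lie_mem := by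
          intro x m hm
          obtain ⟨b, rfl⟩ := Submodule.mem_span_singleton.1 hm
          rw [lie_smul, hv, smul_comm]
          exact Submodule.smul_mem _ _ hm }
    have hP : P.toSubmodule = k ∙ v := rfl
    have hfin : Module.Finite k (M ⧸ P) := inferInstanceAs (Module.Finite k (M ⧸ P.toSubmodule))
    have hrank : finrank k (M ⧸ P) = n := by
      have h1 := Submodule.finrank_quotient_add_finrank P.toSubmodule
      rw [hP, finrank_span_singleton hv0] at h1
      have : finrank k (M ⧸ P) = finrank k (M ⧸ (k ∙ v)) := rfl
      omega
    obtain ⟨s, hs, hs'⟩ := ih (M ⧸ P) hrank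
    refine ⟨insert χ s, fun x => ?_, fun ψ hψ x y => ?_⟩
    · rw [spectrum_eq_insert_of_intertwining (q := (LieSubmodule.Quotient.mk' P : M →ₗ[k] M ⧸ P))
        (g := LieModule.toEnd k L (M ⧸ P) x) (LieSubmodule.Quotient.surjective_mk' P) ?_ hv0 (hv x) ?_,
        hs, Finset.coe_insert, Set.image_insert_eq]
      · intro m
        simp
      · rw [← hP]
        exact Submodule.ker_mkQ _
    · rcases Finset.mem_insert.1 hψ with rfl | hψ
      · have h := lie_lie x y v
        simp only [hv, lie_smul] at h
        rw [smul_comm, sub_self] at h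
        exact (smul_eq_zero.1 h).resolve_right hv0
      · exact hs' ψ hψ x y

theorem isNilpotent_iff_spectrum_subset [IsAlgClosed k] {f : End k M} :
    IsNilpotent f ↔ spectrum k f ⊆ {0} := by
  constructor
  · intro h c hc
    obtain ⟨v, hv, hfv⟩ := exists_apply_eq_smul_of_mem_spectrum hc
    obtain ⟨m, hm⟩ := h
    have : ∀ j, (f ^ j) v = c ^ j • v := by
      intro j
      induction j with
      | zero => simp
      | succ j ih => rw [pow_succ', Module.End.mul_apply, ih, map_smul, hfv, smul_smul, pow_succ]
    have := this m
    rw [hm] at this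
    exact eq_zero_of_pow_eq_zero ((smul_eq_zero.1 this.symm).resolve_right hv)
  · intro h
    rw [LinearMap.isNilpotent_iff_charpoly]
    have hs := IsAlgClosed.splits f.charpoly
    have hr : f.charpoly.roots = Multiset.replicate (finrank k M) 0 := by
      rw [Multiset.eq_replicate]
      refine ⟨by rw [Polynomial.splits_iff_card_roots.1 hs, LinearMap.charpoly_natDegree],
        fun b hb => h ?_⟩
      rw [End.mem_spectrum_iff_isRoot_charpoly]
      exact Polynomial.isRoot_of_mem_roots hb
    rw [hs.eq_prod_roots_of_monic (LinearMap.charpoly_monic f), hr]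
    simp

theorem trace_sq_eq [IsAlgClosed k] (f : End k M) :
    LinearMap.trace k M (f ^ 2) = (f ^ 2).charpoly.roots.sum ∧
      (f ^ 2).charpoly.roots.card = finrank k M ∧
      ∀ a ∈ (f ^ 2).charpoly.roots, ∃ c ∈ spectrum k f, a = c ^ 2 := by
  refine ⟨End.trace_eq_sum_roots_charpoly_of_splits (IsAlgClosed.splits _), ?_, fun a ha => ?_⟩
  · rw [Polynomial.splits_iff_card_roots.1 (IsAlgClosed.splits _), LinearMap.charpoly_natDegree]
  · have := Polynomial.isRoot_of_mem_roots ha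
    rw [← End.mem_spectrum_iff_isRoot_charpoly, spectrum.map_pow_of_pos f two_pos] at this
    obtain ⟨c, hc, rfl⟩ := this
    exact ⟨c, hc, rfl⟩

end Spectra

section ComplexSpectra

open Module

variable {M : Type*} [AddCommGroup M] [Module ℂ M] [Module.Finite ℂ M]

theorem norm_trace_sq_le (f : End ℂ M) {r : ℝ} (h : ∀ c ∈ spectrum ℂ f, ‖c‖ ≤ r) :
    ‖LinearMap.trace ℂ M (f ^ 2)‖ ≤ finrank ℂ M * r ^ 2 := by
  obtain ⟨h1, h2, h3⟩ := trace_sq_eq f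
  rw [h1, ← h2]
  calc _ ≤ ((f ^ 2).charpoly.roots.map (‖·‖)).sum := norm_multiset_sum_le _
    _ ≤ ((f ^ 2).charpoly.roots.map (‖·‖)).card • r ^ 2 := by
      refine Multiset.sum_le_card_nsmul _ _ fun a ha => ?_
      obtain ⟨b, hb, rfl⟩ := Multiset.mem_map.1 ha
      obtain ⟨c, hc, rfl⟩ := h3 b hb
      rw [norm_pow]
      exact pow_le_pow_left₀ (norm_nonneg _) (h c hc) 2
    _ = _ := by simp

/-- Squares of imaginary numbers are nonpositive reals, so the trace is a sum of nonpositive terms.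
It can vanish only if every eigenvalue of `f ^ 2` is zero. -/
theorem re_trace_sq_neg {f : End ℂ M} (h : spectrum ℂ f ⊆ {z : ℂ | z.re = 0})
    (hn : ¬ IsNilpotent f) : (LinearMap.trace ℂ M (f ^ 2)).re < 0 := by
  obtain ⟨h1, h2, h3⟩ := trace_sq_eq f
  have hneg : ∀ a ∈ (f ^ 2).charpoly.roots, a.re ≤ 0 ∧ (a.re = 0 → a = 0) := by
    intro a ha
    obtain ⟨c, hc, rfl⟩ := h3 a ha
    have hc : c.re = 0 := h hc
    have e : (c ^ 2).re = - c.im ^ 2 := by simp [pow_two, hc]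
    rw [e]
    refine ⟨by nlinarith [sq_nonneg c.im], fun h0 => ?_⟩
    have : c.im = 0 := by simpa using h0
    have : c = 0 := Complex.ext hc this
    simp [this]
  have hsum : ((f ^ 2).charpoly.roots.sum).re = ((f ^ 2).charpoly.roots.map Complex.re).sum :=
    map_multiset_sum Complex.reAddGroupHom _
  rw [h1, hsum]
  by_contra hge
  refine hn ?_
  have hall : ∀ a ∈ (f ^ 2).charpoly.roots, a = 0 := by
    by_contra hex
    push Not at hex
    obtain ⟨a, ha, ha0⟩ := hex
    refine hge ?_
    obtain ⟨t, ht⟩ := Multiset.exists_cons_of_mem ha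
    have h4 : a.re < 0 := lt_of_le_of_ne (hneg a ha).1 fun h => ha0 ((hneg a ha).2 h)
    have h5 : (t.map Complex.re).sum ≤ 0 := by
      refine (Multiset.sum_le_card_nsmul _ 0 fun x hx => ?_).trans (by simp)
      obtain ⟨b, hb, rfl⟩ := Multiset.mem_map.1 hx
      exact (hneg b (ht ▸ Multiset.mem_cons_of_mem hb)).1
    rw [ht, Multiset.map_cons, Multiset.sum_cons]
    linarith
  have hnil : IsNilpotent (f ^ 2) := by
    rw [isNilpotent_iff_spectrum_subset]
    intro c hc
    rw [End.mem_spectrum_iff_isRoot_charpoly] at hc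
    exact hall c ((Polynomial.mem_roots (LinearMap.charpoly_monic _).ne_zero).2 hc)
  obtain ⟨m, hm⟩ := hnil
  exact ⟨2 * m, by rw [pow_mul, hm]⟩

end ComplexSpectra

end RicciPinching

/-! ### Complexification, and weights of a real solvable bracket -/

namespace RicciPinching

open scoped TensorProduct

section Complexification

variable {V : Type*} [AddCommGroup V] [Module ℝ V]

/-- The real part of a vector of the complexification. -/
noncomputable def tensorRe : ℂ ⊗[ℝ] V →ₗ[ℝ] V :=
  (TensorProduct.lid ℝ V).toLinearMap ∘ₗ LinearMap.rTensor V Complex.reLm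

/-- The imaginary part of a vector of the complexification. -/
noncomputable def tensorIm : ℂ ⊗[ℝ] V →ₗ[ℝ] V :=
  (TensorProduct.lid ℝ V).toLinearMap ∘ₗ LinearMap.rTensor V Complex.imLm

@[simp] theorem tensorRe_tmul (z : ℂ) (v : V) : tensorRe (z ⊗ₜ v) = z.re • v := by
  simp [tensorRe]

@[simp] theorem tensorIm_tmul (z : ℂ) (v : V) : tensorIm (z ⊗ₜ v) = z.im • v := by
  simp [tensorIm]

theorem tmul_tensorRe_add_tmul_tensorIm (w : ℂ ⊗[ℝ] V) :
    (1 : ℂ) ⊗ₜ tensorRe w + Complex.I ⊗ₜ tensorIm w = w := by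
  induction w with
  | zero => simp
  | tmul z v =>
    rw [tensorRe_tmul, tensorIm_tmul, ← TensorProduct.smul_tmul, ← TensorProduct.smul_tmul,
      ← TensorProduct.add_tmul]
    congr 1
    apply Complex.ext <;> simp
  | add x y hx hy =>
    rw [map_add, map_add, TensorProduct.tmul_add, TensorProduct.tmul_add]
    nth_rewrite 3 [← hx]
    nth_rewrite 3 [← hy]
    abel

theorem tensorRe_smul (z : ℂ) (w : ℂ ⊗[ℝ] V) :
    tensorRe (z • w) = z.re • tensorRe w - z.im • tensorIm w := by
  induction w with
  | zero => simp
  | tmul y v => simp [TensorProduct.smul_tmul', sub_smul, mul_smul]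
  | add x y hx hy => rw [smul_add, map_add, map_add, map_add, hx, hy]; module

theorem tensorIm_smul (z : ℂ) (w : ℂ ⊗[ℝ] V) :
    tensorIm (z • w) = z.re • tensorIm w + z.im • tensorRe w := by
  induction w with
  | zero => simp
  | tmul y v => simp [TensorProduct.smul_tmul', add_smul, mul_smul]
  | add x y hx hy => rw [smul_add, map_add, map_add, map_add, hx, hy]; module

theorem tensorRe_baseChange (A : V →ₗ[ℝ] V) (w : ℂ ⊗[ℝ] V) :
    tensorRe (A.baseChange ℂ w) = A (tensorRe w) := by
  induction w with
  | zero => simp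
  | tmul z v => simp
  | add x y hx hy => rw [map_add, map_add, map_add, map_add, hx, hy]

theorem tensorIm_baseChange (A : V →ₗ[ℝ] V) (w : ℂ ⊗[ℝ] V) :
    tensorIm (A.baseChange ℂ w) = A (tensorIm w) := by
  induction w with
  | zero => simp
  | tmul z v => simp
  | add x y hx hy => rw [map_add, map_add, map_add, map_add, hx, hy]

theorem isNilpotent_baseChange_iff [FiniteDimensional ℝ V] (A : V →ₗ[ℝ] V) :
    IsNilpotent (A.baseChange ℂ) ↔ IsNilpotent A := by
  rw [LinearMap.isNilpotent_iff_charpoly, LinearMap.isNilpotent_iff_charpoly,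
    LinearMap.charpoly_baseChange, Module.finrank_baseChange]
  refine ⟨fun h => Polynomial.map_injective _ (algebraMap ℝ ℂ).injective ?_, fun h => ?_⟩
  · rw [h]; simp
  · rw [h]; simp

theorem trace_baseChange_sq [FiniteDimensional ℝ V] (A : V →ₗ[ℝ] V) :
    LinearMap.trace ℂ _ (A.baseChange ℂ ^ 2) = (LinearMap.trace ℝ V (A * A) : ℂ) := by
  rw [pow_two, ← LinearMap.baseChange_mul, LinearMap.trace_baseChange]
  rfl

end Complexification

variable {V : Type*} [NormedAddCommGroup V] [InnerProductSpace ℝ V]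

theorem isNilpotent_coe_iff (A : V →L[ℝ] V) : IsNilpotent (A : V →ₗ[ℝ] V) ↔ IsNilpotent A := by
  have : ∀ m : ℕ, ((A ^ m : V →L[ℝ] V) : V →ₗ[ℝ] V) = (A : V →ₗ[ℝ] V) ^ m := fun m => by
    induction m with
    | zero => rfl
    | succ m ih => rw [pow_succ, pow_succ, ← ih]; rfl
  refine exists_congr fun m => ?_
  rw [← this]
  exact ⟨fun h => ContinuousLinearMap.coe_injective h, fun h => by rw [h]; rfl⟩

/-- The trace of the square of an operator. -/
noncomputable def traceSq (A : V →L[ℝ] V) : ℝ :=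
  LinearMap.trace ℝ V ((A : V →ₗ[ℝ] V) * (A : V →ₗ[ℝ] V))

theorem traceSq_eq_zero_of_isNilpotent {A : V →L[ℝ] V} (h : IsNilpotent A) : traceSq A = 0 := by
  have h1 := (isNilpotent_coe_iff A).2 h
  exact (LinearMap.isNilpotent_trace_of_isNilpotent ((Commute.refl _).isNilpotent_mul_right h1)).eq_zero

variable [FiniteDimensional ℝ V]

theorem isNilpotent_iff_complexSpectrum_subset (A : V →L[ℝ] V) :
    IsNilpotent A ↔ complexSpectrum A ⊆ {0} := by
  rw [← isNilpotent_coe_iff, ← isNilpotent_baseChange_iff, isNilpotent_iff_spectrum_subset]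
  rfl

theorem traceSq_neg {A : V →L[ℝ] V} (h : complexSpectrum A ⊆ {z : ℂ | z.re = 0})
    (hn : ¬ IsNilpotent A) : traceSq A < 0 := by
  rw [← isNilpotent_coe_iff, ← isNilpotent_baseChange_iff] at hn
  have := re_trace_sq_neg h hn
  rwa [trace_baseChange_sq, Complex.ofReal_re] at this

theorem abs_traceSq_le (A : V →L[ℝ] V) {r : ℝ} (h : ∀ c ∈ complexSpectrum A, ‖c‖ ≤ r) :
    |traceSq A| ≤ Module.finrank ℝ V * r ^ 2 := by
  have := norm_trace_sq_le _ h
  rwa [trace_baseChange_sq, Complex.norm_real, Real.norm_eq_abs, Module.finrank_baseChange] at this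

/-- The real parts of the eigenvalues are bounded by the symmetric part of the operator. -/
theorem abs_re_le_of_mem_complexSpectrum {A : V →L[ℝ] V} {r : ℝ}
    (h : ∀ v, |inner ℝ (A v) v| ≤ r * ‖v‖ ^ 2) {c : ℂ} (hc : c ∈ complexSpectrum A) :
    |c.re| ≤ r := by
  obtain ⟨w, hw, hAw⟩ := exists_apply_eq_smul_of_mem_spectrum hc
  set x := tensorRe w with hx
  set y := tensorIm w with hy
  have h1 : A x = c.re • x - c.im • y := by
    rw [hx, hy, ← tensorRe_smul, ← hAw, tensorRe_baseChange]; rfl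
  have h2 : A y = c.re • y + c.im • x := by
    rw [hx, hy, ← tensorIm_smul, ← hAw, tensorIm_baseChange]; rfl
  have hpos : 0 < ‖x‖ ^ 2 + ‖y‖ ^ 2 := by
    by_contra hle
    have hx0 : ‖x‖ ^ 2 = 0 := by nlinarith [sq_nonneg ‖x‖, sq_nonneg ‖y‖]
    have hy0 : ‖y‖ ^ 2 = 0 := by nlinarith [sq_nonneg ‖x‖, sq_nonneg ‖y‖]
    refine hw ?_
    rw [← tmul_tensorRe_add_tmul_tensorIm w, ← hx, ← hy]
    simp at hx0 hy0
    simp [hx0, hy0]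
  -- The left side is the real part of the Hermitian form of `A` at the eigenvector $x+iy$; the
  -- contributions of `c.im` cancel.
  have h3 : inner ℝ (A x) x + inner ℝ (A y) y = c.re * (‖x‖ ^ 2 + ‖y‖ ^ 2) := by
    rw [h1, h2, inner_sub_left, inner_add_left, real_inner_smul_left, real_inner_smul_left,
      real_inner_smul_left, real_inner_smul_left, real_inner_self_eq_norm_sq,
      real_inner_self_eq_norm_sq, real_inner_comm x y]
    ring
  have h4 : |c.re| * (‖x‖ ^ 2 + ‖y‖ ^ 2) ≤ r * (‖x‖ ^ 2 + ‖y‖ ^ 2) := by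
    rw [← abs_of_pos hpos, ← abs_mul, ← h3, abs_of_pos hpos, mul_add]
    exact (abs_add_le _ _).trans (add_le_add (h x) (h y))
  exact le_of_mul_le_mul_right h4 hpos

/-- The weights of a solvable bracket. -/
theorem exists_weights_of_mem_solvableBrackets {μ : V →L[ℝ] V →L[ℝ] V}
    (hμ : μ ∈ solvableBrackets V) :
    ∃ s : Finset (V →ₗ[ℝ] ℂ), (∀ x, complexSpectrum (μ x) = (fun χ : V →ₗ[ℝ] ℂ => χ x) '' s) ∧
      ∀ χ ∈ s, ∀ x y, χ (μ x y) = 0 := by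
  classical
  obtain ⟨h, hs⟩ := hμ
  let _ : LieRing V := h.lieRing
  let _ : LieAlgebra ℝ V := { lie_smul := fun c x y => (μ x).map_smul c y }
  have _ : LieAlgebra.IsSolvable V := hs
  obtain ⟨s, hs1, hs2⟩ := exists_weights (k := ℂ) (L := ℂ ⊗[ℝ] V) _ (ℂ ⊗[ℝ] V) rfl
  refine ⟨s.image fun χ => (χ.restrictScalars ℝ).comp (TensorProduct.mk ℝ ℂ V 1), fun x => ?_,
    fun χ hχ x y => ?_⟩
  · have h1 : (LieModule.toEnd ℂ (ℂ ⊗[ℝ] V) (ℂ ⊗[ℝ] V) ((1 : ℂ) ⊗ₜ x)) =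
        ((μ x : V →ₗ[ℝ] V).baseChange ℂ) := by
      ext v
      simp
      rfl
    rw [complexSpectrum, ← h1, hs1, Finset.coe_image, Set.image_image]
    rfl
  · obtain ⟨ψ, hψ, rfl⟩ := Finset.mem_image.1 hχ
    have := hs2 ψ hψ (1 ⊗ₜ x) (1 ⊗ₜ y)
    rw [LieAlgebra.ExtendScalars.bracket_tmul, one_mul] at this
    exact this

/-- The polarized form of Cartan's condition: the Killing form vanishes on the derived algebra. -/
def KillingVanishes (μ : V →L[ℝ] V →L[ℝ] V) : Prop :=
  ∀ x y z w, LinearMap.trace ℝ V ((μ (μ x y) : V →ₗ[ℝ] V) * (μ (μ z w) : V →ₗ[ℝ] V)) = 0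

/-- The weights are linear and vanish on brackets, so sums of brackets act nilpotently and have zero
trace of the square. Polarization then gives the bilinear statement. -/
theorem killingVanishes_of_mem_solvableBrackets {μ : V →L[ℝ] V →L[ℝ] V}
    (hμ : μ ∈ solvableBrackets V) : KillingVanishes μ := by
  obtain ⟨s, hs1, hs2⟩ := exists_weights_of_mem_solvableBrackets hμ
  have key : ∀ a, (∀ χ ∈ s, χ a = 0) → traceSq (μ a) = 0 := by
    intro a ha
    refine traceSq_eq_zero_of_isNilpotent ((isNilpotent_iff_complexSpectrum_subset _).2 ?_)
    rw [hs1]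
    rintro _ ⟨χ, hχ, rfl⟩
    exact ha χ hχ
  intro x y z w
  have h1 := key (μ x y) fun χ hχ => hs2 χ hχ x y
  have h2 := key (μ z w) fun χ hχ => hs2 χ hχ z w
  have h3 := key (μ x y + μ z w) fun χ hχ => by rw [map_add, hs2 χ hχ, hs2 χ hχ, add_zero]
  unfold traceSq at h1 h2 h3
  rw [map_add, ContinuousLinearMap.toLinearMap_add, add_mul, mul_add, mul_add, map_add, map_add,
    map_add, h1, h2, LinearMap.trace_mul_comm ℝ (μ (μ z w) : V →ₗ[ℝ] V)] at h3
  linarith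

/-- For a bracket of real type, the imaginary parts of the weights are controlled by their
real parts. -/
theorem exists_abs_traceSq_le_of_mem_realType {μ : V →L[ℝ] V →L[ℝ] V} (hμ : μ ∈ realType V) :
    ∃ C : ℝ, 0 ≤ C ∧ ∀ (x : V) (r : ℝ), 0 ≤ r → (∀ c ∈ complexSpectrum (μ x), |c.re| ≤ r) →
      |traceSq (μ x)| ≤ C * r ^ 2 := by
  obtain ⟨s, hs1, -⟩ := exists_weights_of_mem_solvableBrackets hμ.1
  let f : V →ₗ[ℝ] (s → ℂ) := LinearMap.pi fun χ => χ.1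
  let g : V →ₗ[ℝ] (s → ℝ) := LinearMap.pi fun χ => Complex.reLm ∘ₗ χ.1
  -- Real type enters here: where all real parts of the weights vanish, $\mathrm{ad}\,x$ must be
  -- nilpotent, so the weights vanish altogether.
  have hker : LinearMap.ker g ≤ LinearMap.ker f := by
    intro x hx
    have hx : ∀ χ ∈ s, (χ x).re = 0 := fun χ hχ => congrFun (LinearMap.mem_ker.1 hx) ⟨χ, hχ⟩
    have h0 : complexSpectrum (μ x) ⊆ {0} := by
      rw [← isNilpotent_iff_complexSpectrum_subset]
      refine (hμ.2 x).resolve_right (not_not.2 ?_)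
      rw [hs1]
      rintro _ ⟨χ, hχ, rfl⟩
      exact hx χ hχ
    rw [LinearMap.mem_ker]
    ext χ
    rw [hs1] at h0
    exact (h0 ⟨χ.1, χ.2, rfl⟩ : χ.1 x = 0)
  -- Hence the weights are a linear function of their real parts. The operator norm of this function
  -- yields the constant.
  obtain ⟨L, hL⟩ : ∃ L : (s → ℝ) →ₗ[ℝ] (s → ℂ), L ∘ₗ g = f := by
    obtain ⟨g', hg'⟩ := LinearMap.exists_rightInverse_of_surjective g.rangeRestrict
      (LinearMap.range_rangeRestrict g)
    obtain ⟨L, hL⟩ := LinearMap.exists_extend (f ∘ₗ g')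
    refine ⟨L, LinearMap.ext fun x => ?_⟩
    have h1 : L (g x) = f (g' (g.rangeRestrict x)) := LinearMap.congr_fun hL (g.rangeRestrict x)
    have h2 : g (g' (g.rangeRestrict x)) = g x :=
      congrArg Subtype.val (LinearMap.congr_fun hg' (g.rangeRestrict x))
    rw [LinearMap.comp_apply, h1, ← sub_eq_zero, ← map_sub]
    exact hker (by rw [LinearMap.mem_ker, map_sub, h2, sub_self])
  let L' : (s → ℝ) →L[ℝ] (s → ℂ) := LinearMap.toContinuousLinearMap L
  refine ⟨Module.finrank ℝ V * ‖L'‖ ^ 2, by positivity, fun x r hr h => ?_⟩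
  rw [mul_assoc, ← mul_pow]
  refine abs_traceSq_le _ fun c hc => ?_
  rw [hs1] at hc h
  obtain ⟨χ, hχ, rfl⟩ := hc
  have h1 : ‖g x‖ ≤ r := (pi_norm_le_iff_of_nonneg hr).2 fun χ => h _ ⟨χ.1, χ.2, rfl⟩
  calc ‖χ x‖ = ‖f x ⟨χ, hχ⟩‖ := rfl
    _ ≤ ‖f x‖ := norm_le_pi_norm _ _
    _ = ‖L' (g x)‖ := by rw [← hL]; rfl
    _ ≤ ‖L'‖ * ‖g x‖ := L'.le_opNorm _
    _ ≤ ‖L'‖ * r := by gcongr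

end RicciPinching

/-! ### Operators with imaginary spectrum are almost skew in a suitable metric -/

namespace RicciPinching

open scoped TensorProduct

section

open Module

/-- An operator with imaginary spectrum is almost skew-Hermitian with respect to some
Hermitian inner product. -/
theorem exists_injective_abs_re_inner_le (n : ℕ) :
    ∀ (M : Type*) [AddCommGroup M] [Module ℂ M] [Module.Finite ℂ M], finrank ℂ M = n →
      ∀ f : End ℂ M, spectrum ℂ f ⊆ {z : ℂ | z.re = 0} → ∀ ε : ℝ, 0 < ε →
      ∃ ψ : M →ₗ[ℂ] EuclideanSpace ℂ (Fin n), Function.Injective ψ ∧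
        ∀ v, |(inner ℂ (ψ v) (ψ (f v))).re| ≤ ε * ‖ψ v‖ ^ 2 := by
  induction n with
  | zero =>
    intro M _ _ _ hM f _ ε hε
    have := finrank_zero_iff.1 hM
    exact ⟨0, Function.injective_of_subsingleton _, fun v => by simp⟩
  | succ n ih =>
    intro M _ _ _ hM f hf ε hε
    have : Nontrivial M := nontrivial_of_finrank_pos (R := ℂ) (by omega)
    obtain ⟨c, hc⟩ := spectrum.nonempty_of_isAlgClosed_of_finiteDimensional ℂ f
    obtain ⟨v₀, hv₀, hfv⟩ := exists_apply_eq_smul_of_mem_spectrum hc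
    have hc : c.re = 0 := hf hc
    let P := ℂ ∙ v₀
    have hP : P ≤ P.comap f := by
      rw [Submodule.span_singleton_le_iff_mem, Submodule.mem_comap, hfv]
      exact P.smul_mem _ (Submodule.mem_span_singleton_self _)
    have hrank : finrank ℂ (M ⧸ P) = n := by
      have h1 := Submodule.finrank_quotient_add_finrank P
      rw [finrank_span_singleton hv₀] at h1
      omega
    -- Half of `ε` is spent on the quotient; the other half absorbs the coupling between the
    -- quotient and the eigenvector.
    obtain ⟨ψ, hψ, hψ'⟩ := ih (M ⧸ P) hrank (P.mapQ P f hP)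
      ((spectrum_subset_of_intertwining P.mkQ_surjective (fun x => by simp)).trans hf)
      (ε / 2) (half_pos hε)
    obtain ⟨l, hl⟩ := Projective.exists_dual_eq_one ℂ hv₀
    -- `g` is the off-diagonal entry of the triangular form: the part of the `v₀`-coordinate of `f
    -- v` that comes from the quotient.
    let g : (M ⧸ P) →ₗ[ℂ] ℂ := P.liftQ (l ∘ₗ f - c • l) (by
      rw [Submodule.span_singleton_le_iff_mem, LinearMap.mem_ker]
      simp [hfv])
    obtain ⟨χ, hχ⟩ := LinearMap.exists_leftInverse_of_injective ψ (LinearMap.ker_eq_bot.2 hψ)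
    let G : EuclideanSpace ℂ (Fin n) →L[ℂ] ℂ := LinearMap.toContinuousLinearMap (g ∘ₗ χ)
    have hG : ∀ v, l (f v) = c * l v + G (ψ (P.mkQ v)) := by
      intro v
      have h1 : χ (ψ (P.mkQ v)) = P.mkQ v := LinearMap.congr_fun hχ _
      have h2 : G (ψ (P.mkQ v)) = g (P.mkQ v) := congrArg g h1
      rw [h2]
      simp [g]
    set K := ‖G‖ with hK
    have hK0 : 0 ≤ K := norm_nonneg _
    -- Giving the `v₀`-coordinate a small weight `t` scales the off-diagonal entry by `t`, making
    -- its norm at most `ε`.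
    let t : ℝ := ε / (K + 1)
    have ht : 0 < t := by positivity
    have htK : t * K ≤ ε := by
      rw [div_mul_eq_mul_div, div_le_iff₀ (by positivity)]
      nlinarith
    let Ψ : M →ₗ[ℂ] EuclideanSpace ℂ (Fin (n + 1)) :=
      (WithLp.linearEquiv 2 ℂ (Fin (n + 1) → ℂ)).symm.toLinearMap ∘ₗ
        LinearMap.pi (Fin.cons ((t : ℂ) • l)
          fun i => LinearMap.proj i ∘ₗ (WithLp.linearEquiv 2 ℂ (Fin n → ℂ)).toLinearMap ∘ₗ
            ψ ∘ₗ P.mkQ)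
    have hΨ0 : ∀ v, Ψ v 0 = t * l v := fun v => rfl
    have hΨs : ∀ v i, Ψ v (Fin.succ i) = ψ (P.mkQ v) i := fun v i => rfl
    have hinner : ∀ v w, inner ℂ (Ψ v) (Ψ w) =
        (starRingEnd ℂ (t * l v)) * (t * l w) + inner ℂ (ψ (P.mkQ v)) (ψ (P.mkQ w)) := by
      intro v w
      rw [PiLp.inner_apply, PiLp.inner_apply, Fin.sum_univ_succ]
      simp only [hΨ0, hΨs]
      congr 1
      rw [RCLike.inner_apply, mul_comm]
    have hnorm : ∀ v, ‖Ψ v‖ ^ 2 = t ^ 2 * ‖l v‖ ^ 2 + ‖ψ (P.mkQ v)‖ ^ 2 := by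
      intro v
      rw [EuclideanSpace.norm_sq_eq, EuclideanSpace.norm_sq_eq, Fin.sum_univ_succ]
      simp only [hΨ0, hΨs]
      rw [norm_mul, mul_pow, Complex.norm_real, Real.norm_eq_abs, sq_abs]
    refine ⟨Ψ, (injective_iff_map_eq_zero _).2 fun v hv => ?_, fun v => ?_⟩
    · have h1 := hnorm v
      rw [hv, norm_zero] at h1
      have h2 : ‖ψ (P.mkQ v)‖ ^ 2 = 0 := by
        nlinarith [sq_nonneg (t * ‖l v‖), sq_nonneg ‖ψ (P.mkQ v)‖]
      have h3 : t ^ 2 * ‖l v‖ ^ 2 = 0 := by linarith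
      have h4 : P.mkQ v = 0 := (map_eq_zero_iff ψ hψ).1 (by simpa using h2)
      have h5 : l v = 0 := by simpa [ht.ne'] using h3
      obtain ⟨a, rfl⟩ := Submodule.mem_span_singleton.1 ((Submodule.Quotient.mk_eq_zero P).1 h4)
      rw [map_smul, hl, smul_eq_mul, mul_one] at h5
      rw [h5, zero_smul]
    · have h1 := hψ' (P.mkQ v)
      set p := ψ (P.mkQ v) with hp
      have h2 : (P.mapQ P f hP) (P.mkQ v) = P.mkQ (f v) := by simp
      rw [h2] at h1
      rw [hinner, hnorm, hG, ← hp]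
      have h3 : ((starRingEnd ℂ (t * l v)) * (t * (c * l v + G p))).re =
          t ^ 2 * ((starRingEnd ℂ (l v)) * G p).re := by
        simp [hc]
        ring
      rw [Complex.add_re, h3]
      have h4 : |((starRingEnd ℂ (l v)) * G p).re| ≤ ‖l v‖ * (K * ‖p‖) := by
        refine (Complex.abs_re_le_norm _).trans ?_
        rw [norm_mul, RCLike.norm_conj]
        gcongr
        exact G.le_opNorm p
      have h5 : |t ^ 2 * ((starRingEnd ℂ (l v)) * G p).re| ≤ t ^ 2 * (‖l v‖ * (K * ‖p‖)) := by
        rw [abs_mul, abs_of_nonneg (sq_nonneg t)]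
        gcongr
      have h6 : t ^ 2 * (‖l v‖ * (K * ‖p‖)) ≤ ε / 2 * (t ^ 2 * ‖l v‖ ^ 2 + ‖p‖ ^ 2) := by
        have h7 : (t * K) * ((t * ‖l v‖) * ‖p‖) ≤ ε * ((t * ‖l v‖) * ‖p‖) := by gcongr
        nlinarith [sq_nonneg (t * ‖l v‖ - ‖p‖)]
      calc _ ≤ _ := abs_add_le _ _
        _ ≤ ε / 2 * (t ^ 2 * ‖l v‖ ^ 2 + ‖p‖ ^ 2) + ε / 2 * ‖p‖ ^ 2 := add_le_add (h5.trans h6) h1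
        _ ≤ _ := by nlinarith [sq_nonneg (t * ‖l v‖)]

end

variable {V : Type*} [NormedAddCommGroup V] [InnerProductSpace ℝ V] [FiniteDimensional ℝ V]

/-- A linear isomorphism with prescribed pullback of the inner product. -/
theorem exists_equiv_inner_eq {E : Type*} [NormedAddCommGroup E] [InnerProductSpace ℝ E]
    (φ : V →ₗ[ℝ] E) (hφ : Function.Injective φ) :
    ∃ h : V ≃L[ℝ] V, ∀ v w, inner ℝ (h v) (h w) = inner ℝ (φ v) (φ w) := by
  let e := LinearEquiv.ofInjective φ hφ
  let i : LinearMap.range φ ≃ₗᵢ[ℝ] V :=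
    (stdOrthonormalBasis ℝ (LinearMap.range φ)).equiv (stdOrthonormalBasis ℝ V)
      (finCongr e.symm.finrank_eq)
  refine ⟨(e.trans i.toLinearEquiv).toContinuousLinearEquiv, fun v w => ?_⟩
  exact i.inner_map_map (e v) (e w)

/-- An operator with imaginary spectrum is conjugate to an almost skew-symmetric one. -/
theorem exists_conj_abs_inner_le {A : V →L[ℝ] V} (hA : complexSpectrum A ⊆ {z : ℂ | z.re = 0})
    {ε : ℝ} (hε : 0 < ε) :
    ∃ h : V ≃L[ℝ] V, ∀ v, |inner ℝ (h (A (h.symm v))) v| ≤ ε * ‖v‖ ^ 2 := by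
  obtain ⟨ψ, hψ, hψ'⟩ := exists_injective_abs_re_inner_le _ (ℂ ⊗[ℝ] V) rfl _ hA ε hε
  let φ : V →ₗ[ℝ] _ := (ψ.restrictScalars ℝ) ∘ₗ TensorProduct.mk ℝ ℂ V 1
  have hφ : Function.Injective φ := by
    refine hψ.comp fun v w hvw => ?_
    simpa using congrArg tensorRe hvw
  obtain ⟨h, hh⟩ := exists_equiv_inner_eq φ hφ
  refine ⟨h, fun v => ?_⟩
  have h1 := hψ' (1 ⊗ₜ h.symm v)
  have h2 : inner ℝ (h (A (h.symm v))) (h (h.symm v)) = _ := hh _ _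
  have h3 : inner ℝ (h (h.symm v)) (h (h.symm v)) = _ := hh _ _
  rw [h.apply_symm_apply] at h2 h3
  have h4 : ∀ x y : EuclideanSpace ℂ (Fin (Module.finrank ℂ (ℂ ⊗[ℝ] V))),
      inner ℝ x y = (inner ℂ x y).re := by
    intro x y
    rw [PiLp.inner_apply, PiLp.inner_apply, Complex.re_sum]
    rfl
  rw [h2, ← real_inner_self_eq_norm_sq, h3, real_inner_comm, h4, real_inner_self_eq_norm_sq]
  exact h1

end RicciPinching

/-! ### Ricci and scalar curvature in terms of the bracket -/

namespace RicciPinching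

section Sums

variable {ι : Type*} [Fintype ι]

/-- A double sum depends only on the symmetrization of its summand. Several curvature identities
below hold termwise only after symmetrizing. -/
theorem sum_sum_eq_of_symm {T U : ι → ι → ℝ} (h : ∀ i j, T i j + T j i = U i j + U j i) :
    ∑ i, ∑ j, T i j = ∑ i, ∑ j, U i j := by
  have h1 : ∑ i, ∑ j, (T i j + T j i) = ∑ i, ∑ j, (U i j + U j i) := by simp only [h]
  simp only [Finset.sum_add_distrib] at h1
  rw [Finset.sum_comm (f := fun i j => T j i), Finset.sum_comm (f := fun i j => U j i)] at h1
  linarith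

variable {V W : Type*} [NormedAddCommGroup V] [InnerProductSpace ℝ V] [AddCommGroup W] [Module ℝ W]
  {κ : Type*} [Fintype κ]

/-- The trace of a bilinear map with respect to the inner product. -/
theorem sum_apply_self_eq (B : V →ₗ[ℝ] V →ₗ[ℝ] W) (b : OrthonormalBasis ι ℝ V)
    (b' : OrthonormalBasis κ ℝ V) : ∑ i, B (b i) (b i) = ∑ j, B (b' j) (b' j) := by
  calc ∑ i, B (b i) (b i) = ∑ i, ∑ j, (inner ℝ (b' j) (b i) : ℝ) • B (b' j) (b i) := by
        refine Finset.sum_congr rfl fun i _ => ?_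
        nth_rewrite 1 [← b'.sum_repr' (b i)]
        simp
    _ = ∑ j, ∑ i, (inner ℝ (b i) (b' j) : ℝ) • B (b' j) (b i) := by
        rw [Finset.sum_comm]
        simp only [real_inner_comm]
    _ = _ := by
        refine Finset.sum_congr rfl fun j _ => ?_
        nth_rewrite 4 [← b.sum_repr' (b' j)]
        simp

end Sums

variable {V : Type*} [NormedAddCommGroup V] [InnerProductSpace ℝ V]

theorem IsLieBracket.skew {μ : V →L[ℝ] V →L[ℝ] V} (h : IsLieBracket μ) (x y : V) :
    μ x y = - μ y x := by
  have := h.self (x + y)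
  simp only [map_add, add_apply, h.self] at this
  rw [zero_add, add_zero] at this
  exact eq_neg_of_add_eq_zero_right this

variable [FiniteDimensional ℝ V]

theorem leviCivita_skew {μ : V →L[ℝ] V →L[ℝ] V} (h : IsLieBracket μ) (x y z : V) :
    inner ℝ (leviCivita μ x y) z = - inner ℝ y (leviCivita μ x z) := by
  have h1 := inner_leviCivita h x y z
  have h2 := inner_leviCivita h x z y
  rw [real_inner_comm] at h2
  rw [h.skew z x, inner_neg_left] at h1
  rw [h.skew z y, h.skew y x, inner_neg_left, inner_neg_left] at h2
  linarith

/-- The Ricci operator can be computed with any orthonormal basis. -/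
theorem ricci_apply {ι : Type*} [Fintype ι] (b : OrthonormalBasis ι ℝ V)
    (μ : V →L[ℝ] V →L[ℝ] V) (x : V) : ricci μ x = ∑ i, curvature μ x (b i) (b i) := by
  let B : V →ₗ[ℝ] V →ₗ[ℝ] V := LinearMap.mk₂ ℝ (fun y z => curvature μ x y z)
    (fun y y' z => by simp [curvature]; abel) (fun c y z => by simp [curvature, smul_sub])
    (fun y z z' => by simp) (fun c y z => by simp)
  exact sum_apply_self_eq B (stdOrthonormalBasis ℝ V) b

/-- The mean curvature vector. -/
noncomputable def meanCurvature {ι : Type*} [Fintype ι] (b : OrthonormalBasis ι ℝ V)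
    (μ : V →L[ℝ] V →L[ℝ] V) : V := ∑ i, leviCivita μ (b i) (b i)

section

variable {ι : Type*} [Fintype ι] (b : OrthonormalBasis ι ℝ V)

theorem inner_meanCurvature {μ : V →L[ℝ] V →L[ℝ] V} (h : IsLieBracket μ) (z : V) :
    inner ℝ (meanCurvature b μ) z = ∑ i, inner ℝ (μ z (b i)) (b i) := by
  rw [meanCurvature, sum_inner]
  refine Finset.sum_congr rfl fun i _ => ?_
  have := inner_leviCivita h (b i) (b i) z
  rw [h.self, h.skew (b i) z, inner_neg_left, inner_zero_left] at this
  linarith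

/-- The usual terms $-\frac12|\mathrm{ad}\,x|^2-\frac12\mathrm{tr}(\mathrm{ad}\,x)^2$ are grouped
into one square, that of the symmetric part of $\mathrm{ad}\,x$. The proof expands the curvature in
the basis and applies Koszul's formula. -/
theorem inner_ricci_self {μ : V →L[ℝ] V →L[ℝ] V} (h : IsLieBracket μ) (x : V) :
    inner ℝ (ricci μ x) x =
      - (1 / 4) * ∑ i, ∑ j, (inner ℝ (μ x (b i)) (b j) + inner ℝ (μ x (b j)) (b i)) ^ 2
      + (1 / 4) * ∑ i, ∑ j, (inner ℝ (μ (b i) (b j)) x) ^ 2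
      - inner ℝ (μ (meanCurvature b μ) x) x := by
  have h1 : ∑ i, inner ℝ (leviCivita μ x (leviCivita μ (b i) (b i))) x =
      - inner ℝ (μ (meanCurvature b μ) x) x := by
    rw [← sum_inner, ← map_sum, ← meanCurvature, leviCivita_skew h, neg_inj, real_inner_comm]
    have := inner_leviCivita h x x (meanCurvature b μ)
    rw [h.self, h.skew x (meanCurvature b μ), inner_neg_left, inner_zero_left] at this
    linarith
  have h2 : ∀ i, inner ℝ (curvature μ x (b i) (b i)) x =
      inner ℝ (leviCivita μ x (leviCivita μ (b i) (b i))) x +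
      ∑ j, (inner ℝ (leviCivita μ x (b i)) (b j) * inner ℝ (leviCivita μ (b i) x) (b j) +
        inner ℝ (μ x (b i)) (b j) * inner ℝ (leviCivita μ (b j) x) (b i)) := by
    intro i
    have e1 : inner ℝ (leviCivita μ (b i) (leviCivita μ x (b i))) x =
        - ∑ j, inner ℝ (leviCivita μ x (b i)) (b j) * inner ℝ (leviCivita μ (b i) x) (b j) := by
      rw [leviCivita_skew h, ← b.sum_inner_mul_inner]
      simp only [real_inner_comm]
    have e2 : inner ℝ (leviCivita μ (μ x (b i)) (b i)) x =
        - ∑ j, inner ℝ (μ x (b i)) (b j) * inner ℝ (leviCivita μ (b j) x) (b i) := by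
      rw [leviCivita_skew h]
      nth_rewrite 1 [← b.sum_repr' (μ x (b i))]
      rw [map_sum, LinearMap.sum_apply, inner_sum]
      congr 1
      refine Finset.sum_congr rfl fun j _ => ?_
      rw [map_smul, LinearMap.smul_apply, inner_smul_right, real_inner_comm (μ x (b i)),
        real_inner_comm (b i)]
    rw [Finset.sum_add_distrib]
    simp only [curvature, LinearMap.sub_apply, LinearMap.comp_apply, inner_sub_left]
    rw [e1, e2]
    ring
  rw [ricci_apply b, sum_inner]
  simp only [h2]
  rw [Finset.sum_add_distrib, h1]
  have h3 : ∑ i, ∑ j, (inner ℝ (leviCivita μ x (b i)) (b j) * inner ℝ (leviCivita μ (b i) x) (b j) +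
        inner ℝ (μ x (b i)) (b j) * inner ℝ (leviCivita μ (b j) x) (b i)) =
      ∑ i, ∑ j, (- (1 / 4) * (inner ℝ (μ x (b i)) (b j) + inner ℝ (μ x (b j)) (b i)) ^ 2 +
        (1 / 4) * (inner ℝ (μ (b i) (b j)) x) ^ 2) := by
    refine sum_sum_eq_of_symm fun i j => ?_
    have k1 := inner_leviCivita h x (b i) (b j)
    have k2 := inner_leviCivita h (b i) x (b j)
    have k3 := inner_leviCivita h x (b j) (b i)
    have k4 := inner_leviCivita h (b j) x (b i)
    rw [h.skew (b j) x, inner_neg_left] at k1 k4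
    rw [h.skew (b i) x, inner_neg_left] at k2 k3
    rw [h.skew (b j) (b i), inner_neg_left] at k2 k3
    rw [h.skew (b j) (b i), inner_neg_left]
    set a := inner ℝ (μ x (b i)) (b j)
    set a' := inner ℝ (μ x (b j)) (b i)
    set c := inner ℝ (μ (b i) (b j)) x
    have k1' : inner ℝ (leviCivita μ x (b i)) (b j) = (a - c - a') / 2 := by linarith
    have k2' : inner ℝ (leviCivita μ (b i) x) (b j) = (-a - a' - c) / 2 := by linarith
    have k3' : inner ℝ (leviCivita μ x (b j)) (b i) = (a' + c - a) / 2 := by linarith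
    have k4' : inner ℝ (leviCivita μ (b j) x) (b i) = (-a' - a + c) / 2 := by linarith
    rw [k1', k2', k3', k4']
    ring
  rw [h3]
  simp only [Finset.sum_add_distrib, ← Finset.mul_sum]
  ring

theorem scalarCurvature_eq {μ : V →L[ℝ] V →L[ℝ] V} (h : IsLieBracket μ) :
    scalarCurvature μ =
      - (1 / 4) * ∑ k, ∑ i, ∑ j,
        (inner ℝ (μ (b k) (b i)) (b j) + inner ℝ (μ (b k) (b j)) (b i)) ^ 2
      + (1 / 4) * ∑ k, ∑ i, ∑ j, (inner ℝ (μ (b k) (b i)) (b j)) ^ 2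
      - ‖meanCurvature b μ‖ ^ 2 := by
  rw [scalarCurvature, LinearMap.trace_eq_sum_inner _ b]
  simp only [real_inner_comm (ricci μ _), inner_ricci_self b h]
  rw [Finset.sum_sub_distrib, Finset.sum_add_distrib, ← Finset.mul_sum, ← Finset.mul_sum,
    ← inner_meanCurvature b h, real_inner_self_eq_norm_sq]
  congr 3
  rw [Finset.sum_comm]
  exact Finset.sum_congr rfl fun i _ => Finset.sum_comm

end

/-- The algebraic structure of the brackets of flat metrics. -/
structure IsFlatBracket (μ : V →L[ℝ] V →L[ℝ] V) (n : Submodule ℝ V) : Prop where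
  mem : ∀ x y, μ x y ∈ n
  abelian : ∀ x ∈ n, ∀ y ∈ n, μ x y = 0
  abelian_orthogonal : ∀ x ∈ nᗮ, ∀ y ∈ nᗮ, μ x y = 0
  skew : ∀ x ∈ nᗮ, ∀ y z, inner ℝ (μ x y) z = - inner ℝ (μ x z) y

/-- The connection factors through the projection to `nᗮ`, where it is the adjoint action. Curvature
then vanishes by the Jacobi identity, since brackets lie in `n` and elements of `nᗮ` commute. -/
theorem IsFlatBracket.leviCivita_eq {μ : V →L[ℝ] V →L[ℝ] V} {n : Submodule ℝ V}
    (hn : IsFlatBracket μ n) (h : IsLieBracket μ) {x₁ x₂ : V} (h₁ : x₁ ∈ n) (h₂ : x₂ ∈ nᗮ) (y : V) :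
    leviCivita μ (x₁ + x₂) y = μ x₂ y := by
  refine ext_inner_right ℝ fun z => ?_
  have hk := inner_leviCivita h (x₁ + x₂) y z
  obtain ⟨y₁, hy₁, y₂, hy₂, rfl⟩ := n.exists_add_mem_mem_orthogonal y
  obtain ⟨z₁, hz₁, z₂, hz₂, rfl⟩ := n.exists_add_mem_mem_orthogonal z
  have o : ∀ u v, ∀ w ∈ nᗮ, inner ℝ (μ u v) w = 0 := fun u v w hw => hw _ (hn.mem u v)
  have s1 := hn.skew x₂ h₂ y₁ z₁
  have s2 := hn.skew y₂ hy₂ x₁ z₁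
  have s3 := hn.skew z₂ hz₂ y₁ x₁
  simp only [map_add, add_apply, inner_add_left, inner_add_right,
    o _ _ _ h₂, o _ _ _ hy₂, o _ _ _ hz₂, hn.abelian _ h₁ _ hy₁,
    hn.abelian _ hy₁ _ hz₁, hn.abelian _ hz₁ _ h₁, hn.abelian_orthogonal _ h₂ _ hy₂,
    hn.abelian_orthogonal _ hy₂ _ hz₂, hn.abelian_orthogonal _ hz₂ _ h₂, inner_zero_left,
    h.skew x₁ y₂, h.skew y₁ z₂, h.skew z₁ x₂, inner_neg_left] at hk ⊢
  linarith

theorem IsFlatBracket.curvature_eq_zero {μ : V →L[ℝ] V →L[ℝ] V} {n : Submodule ℝ V}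
    (hn : IsFlatBracket μ n) (h : IsLieBracket μ) (x y : V) : curvature μ x y = 0 := by
  obtain ⟨x₁, hx₁, x₂, hx₂, rfl⟩ := n.exists_add_mem_mem_orthogonal x
  obtain ⟨y₁, hy₁, y₂, hy₂, rfl⟩ := n.exists_add_mem_mem_orthogonal y
  ext z
  have h0 : ∀ u v w, leviCivita μ (μ u v) w = 0 := by
    intro u v w
    have := hn.leviCivita_eq h (hn.mem u v) (Submodule.zero_mem _) w
    simpa using this
  simp only [curvature, LinearMap.sub_apply, LinearMap.comp_apply, h0,
    hn.leviCivita_eq h hx₁ hx₂, hn.leviCivita_eq h hy₁ hy₂]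
  rw [h.jacobi, hn.abelian_orthogonal _ hx₂ _ hy₂]
  simp

theorem scalarCurvature_eq_zero_of_flat {μ : V →L[ℝ] V →L[ℝ] V} (h : ∀ x y, curvature μ x y = 0) :
    scalarCurvature μ = 0 := by
  have : ricci μ = 0 := by
    ext x
    simp [ricci, h]
  rw [scalarCurvature, this, map_zero]

end RicciPinching

/-! ### Vanishing scalar curvature forces a flat bracket -/

namespace RicciPinching

variable {V : Type*} [NormedAddCommGroup V] [InnerProductSpace ℝ V]

theorem trace_mul_self_eq_sum {ι : Type*} [Fintype ι] (b : OrthonormalBasis ι ℝ V) (A : V →ₗ[ℝ] V) :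
    LinearMap.trace ℝ V (A * A) = ∑ i, ∑ j, inner ℝ (A (b i)) (b j) * inner ℝ (A (b j)) (b i) := by
  rw [LinearMap.trace_eq_sum_inner _ b]
  refine Finset.sum_congr rfl fun i _ => ?_
  rw [Module.End.mul_apply]
  nth_rewrite 1 [← b.sum_repr' (A (b i))]
  rw [map_sum, inner_sum]
  refine Finset.sum_congr rfl fun j _ => ?_
  rw [map_smul, inner_smul_right, real_inner_comm (A (b i)), real_inner_comm (b i)]

variable [FiniteDimensional ℝ V]

/-- An orthonormal basis adapted to a subspace. -/
theorem exists_adapted_orthonormalBasis (n : Submodule ℝ V) :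
    ∃ (u : Finset V) (b : OrthonormalBasis u ℝ V), ∀ i, b i ∈ n ∨ b i ∈ nᗮ := by
  classical
  let w := stdOrthonormalBasis ℝ n
  let s : Set V := Set.range fun i => (w i : V)
  have hs : Orthonormal ℝ ((↑) : s → V) := by
    have h1 : Orthonormal ℝ fun i => (w i : V) := w.orthonormal.comp_linearIsometry n.subtypeₗᵢ
    exact h1.toSubtypeRange
  obtain ⟨u, b, hsu, hb⟩ := hs.exists_orthonormalBasis_extension
  refine ⟨u, b, fun i => ?_⟩
  by_cases hi : (i : V) ∈ s
  · left
    obtain ⟨j, hj⟩ := hi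
    rw [hb, ← hj]
    exact (w j).2
  · right
    rw [Submodule.mem_orthogonal]
    intro x hx
    have h1 : x = ∑ j, (inner ℝ (w j) (⟨x, hx⟩ : n) : ℝ) • (w j : V) := by
      have := congrArg Subtype.val (w.sum_repr' ⟨x, hx⟩)
      simpa using this.symm
    rw [h1, sum_inner]
    refine Finset.sum_eq_zero fun j _ => ?_
    rw [inner_smul_left]
    have hj : (w j : V) ∈ u := hsu ⟨j, rfl⟩
    have h2 := b.orthonormal.2 (i := ⟨w j, hj⟩) (j := i) (fun h => hi ⟨j, congrArg Subtype.val h⟩)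
    rw [hb] at h2
    rw [hb, h2, mul_zero]

/-- A bracket whose Killing form vanishes on the derived algebra, with zero scalar curvature,
is the bracket of a flat metric. -/
theorem exists_isFlatBracket {μ : V →L[ℝ] V →L[ℝ] V} (h : IsLieBracket μ) (hK : KillingVanishes μ)
    (h0 : scalarCurvature μ = 0) : ∃ n, IsFlatBracket μ n := by
  classical
  let n : Submodule ℝ V := Submodule.span ℝ (Set.range fun p : V × V => μ p.1 p.2)
  have hmem : ∀ x y, μ x y ∈ n := fun x y => Submodule.subset_span ⟨(x, y), rfl⟩
  have hK1 : ∀ x ∈ n, ∀ y ∈ n, LinearMap.trace ℝ V ((μ x : V →ₗ[ℝ] V) * (μ y : V →ₗ[ℝ] V)) = 0 := by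
    intro x hx y hy
    induction hx using Submodule.span_induction with
    | mem x hx =>
      obtain ⟨p, rfl⟩ := hx
      induction hy using Submodule.span_induction with
      | mem y hy => obtain ⟨q, rfl⟩ := hy; exact hK _ _ _ _
      | zero => simp
      | add y z _ _ hy hz =>
        rw [map_add, ContinuousLinearMap.toLinearMap_add, mul_add, map_add, hy, hz, add_zero]
      | smul c y _ hy =>
        rw [map_smul, ContinuousLinearMap.toLinearMap_smul, mul_smul_comm, map_smul, hy, smul_zero]
    | zero => simp
    | add x z _ _ hx hz =>
      rw [map_add, ContinuousLinearMap.toLinearMap_add, add_mul, map_add, hx, hz, add_zero]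
    | smul c x _ hx =>
      rw [map_smul, ContinuousLinearMap.toLinearMap_smul, smul_mul_assoc, map_smul, hx, smul_zero]
  obtain ⟨u, b, hb⟩ := exists_adapted_orthonormalBasis n
  set c : u → u → u → ℝ := fun i j k => inner ℝ (μ (b i) (b j)) (b k) with hc
  -- The indicator of the basis vectors in the derived algebra lets sums over the blocks of `n` and
  -- `nᗮ` be written as sums over all indices.
  let p : u → ℝ := fun i => if b i ∈ n then 1 else 0
  have hp : ∀ i, p i = 0 ∨ p i = 1 := fun i => by by_cases hi : b i ∈ n <;> simp [p, hi]
  have hcs : ∀ i j k, c i j k = - c j i k := fun i j k => by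
    simp only [hc]
    rw [h.skew, inner_neg_left]
  have hcp : ∀ i j k, p k * c i j k = c i j k := by
    intro i j k
    by_cases hk : b k ∈ n
    · simp [p, hk]
    · have := ((hb k).resolve_left hk) _ (hmem (b i) (b j))
      simp only [hc, this, mul_zero]
  have hkill : ∀ i, p i * ∑ j, ∑ k, c i j k * c i k j = 0 := by
    intro i
    by_cases hi : b i ∈ n
    · have := hK1 _ hi _ hi
      rw [trace_mul_self_eq_sum b] at this
      exact mul_eq_zero_of_right _ this
    · simp [p, hi]
  set G : u → u → ℝ := fun i j => ∑ k, c i j k ^ 2 with hG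
  have hG0 : ∀ i j, 0 ≤ G i j := fun i j => Finset.sum_nonneg fun k _ => sq_nonneg _
  have hGs : ∀ i j, G i j = G j i := fun i j =>
    Finset.sum_congr rfl fun k _ => by rw [hcs i j k, neg_sq]
  -- `D i` measures how far the action of `b i` on `n` is from being skew.
  set D : u → ℝ := fun i => ∑ j, ∑ k, p j * p k * (c i j k + c i k j) ^ 2 with hD
  have hp0 : ∀ i, 0 ≤ p i ∧ 0 ≤ 1 - p i := fun i => by rcases hp i with h | h <;> simp [h]
  have hD0 : ∀ i, 0 ≤ D i := fun i => Finset.sum_nonneg fun j _ => Finset.sum_nonneg fun k _ =>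
    mul_nonneg (mul_nonneg (hp0 j).1 (hp0 k).1) (sq_nonneg _)
  have hDeq : ∀ i, D i = 2 * (∑ j, ∑ k, c i j k * c i k j) + 2 * ∑ j, p j * G i j := by
    intro i
    simp only [hG, Finset.mul_sum, ← Finset.sum_add_distrib]
    refine sum_sum_eq_of_symm fun j k => ?_
    have e1 := hcp i j k
    have e2 := hcp i k j
    set a := c i j k
    set a' := c i k j
    linear_combination (2 * p j * a + 4 * p j * a' ) * e1 + (2 * p k * a' + 4 * a) * e2
  have hsq : ∀ i, ∑ j, ∑ k, (c i j k + c i k j) ^ 2 =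
      2 * (∑ j, ∑ k, c i j k * c i k j) + 2 * ∑ j, G i j := by
    intro i
    simp only [hG, Finset.mul_sum, ← Finset.sum_add_distrib]
    refine sum_sum_eq_of_symm fun j k => ?_
    ring
  have hterm : ∀ i, (1 - p i) * D i - 2 * ∑ j, (1 - p i) * p j * G i j =
      2 * ∑ j, ∑ k, c i j k * c i k j := by
    intro i
    have e1 := hkill i
    have e2 : ∑ j, (1 - p i) * p j * G i j = (1 - p i) * ∑ j, p j * G i j := by
      rw [Finset.mul_sum]
      exact Finset.sum_congr rfl fun j _ => by ring
    rw [hDeq, e2]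
    linear_combination (-2) * e1
  -- The left side is $-\mathrm{scal}$. The Killing terms with `b i` in `n` vanish, and the others
  -- are absorbed in `D i` and the mixed part of `G`; what remains is nonnegative, so each term is
  -- zero.
  have hsum : (1 / 4) * ∑ i, (1 - p i) * D i +
      (1 / 4) * ∑ i, ∑ j, (p i * p j + (1 - p i) * (1 - p j)) * G i j + ‖meanCurvature b μ‖ ^ 2
      = 0 := by
    rw [scalarCurvature_eq b h] at h0
    have e1 : ∑ k, ∑ i, ∑ j, (inner ℝ (μ (b k) (b i)) (b j) + inner ℝ (μ (b k) (b j)) (b i)) ^ 2 =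
        ∑ i, (1 - p i) * D i - 2 * ∑ i, ∑ j, (1 - p i) * p j * G i j + 2 * ∑ i, ∑ j, G i j := by
      rw [Finset.mul_sum, Finset.mul_sum, ← Finset.sum_sub_distrib, ← Finset.sum_add_distrib]
      refine Finset.sum_congr rfl fun i _ => ?_
      rw [hterm]
      exact hsq i
    have e2 : ∑ k, ∑ i, ∑ j, (inner ℝ (μ (b k) (b i)) (b j)) ^ 2 = ∑ i, ∑ j, G i j := rfl
    have e3 : ∑ i, ∑ j, (p i * p j + (1 - p i) * (1 - p j)) * G i j =
        ∑ i, ∑ j, (G i j - 2 * ((1 - p i) * p j * G i j)) := by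
      refine sum_sum_eq_of_symm fun i j => ?_
      rw [hGs j i]
      ring
    rw [e1, e2] at h0
    rw [e3]
    simp only [Finset.sum_sub_distrib, ← Finset.mul_sum]
    linarith
  have hw : ∀ i j, 0 ≤ (p i * p j + (1 - p i) * (1 - p j)) * G i j := fun i j =>
    mul_nonneg (add_nonneg (mul_nonneg (hp0 i).1 (hp0 j).1) (mul_nonneg (hp0 i).2 (hp0 j).2))
      (hG0 i j)
  have hv : ∀ i, 0 ≤ (1 - p i) * D i := fun i => mul_nonneg (hp0 i).2 (hD0 i)
  have s1 : ∑ i, (1 - p i) * D i = 0 := by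
    have := Finset.sum_nonneg fun i (_ : i ∈ Finset.univ) => hv i
    have := Finset.sum_nonneg fun i (_ : i ∈ Finset.univ) =>
      Finset.sum_nonneg fun j (_ : j ∈ Finset.univ) => hw i j
    have := sq_nonneg ‖meanCurvature b μ‖
    linarith
  have s2 : ∑ i, ∑ j, (p i * p j + (1 - p i) * (1 - p j)) * G i j = 0 := by
    have := Finset.sum_nonneg fun i (_ : i ∈ Finset.univ) =>
      Finset.sum_nonneg fun j (_ : j ∈ Finset.univ) => hw i j
    have := sq_nonneg ‖meanCurvature b μ‖
    linarith
  have hGz : ∀ i j, (p i = p j) → μ (b i) (b j) = 0 := by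
    intro i j hij
    have e1 := (Finset.sum_eq_zero_iff_of_nonneg fun i _ =>
      Finset.sum_nonneg fun j (_ : j ∈ Finset.univ) => hw i j).1 s2 i (Finset.mem_univ _)
    have e2 := (Finset.sum_eq_zero_iff_of_nonneg fun j _ => hw i j).1 e1 j (Finset.mem_univ _)
    have e3 : G i j = 0 := by
      rw [← hij] at e2
      rcases hp i with h | h <;> simpa [h] using e2
    have e4 := (Finset.sum_eq_zero_iff_of_nonneg fun k _ => sq_nonneg _).1 e3
    rw [← b.sum_repr' (μ (b i) (b j))]
    refine Finset.sum_eq_zero fun k hk => ?_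
    have : c i j k = 0 := by simpa using e4 k hk
    rw [real_inner_comm, show inner ℝ (μ (b i) (b j)) (b k) = 0 from this, zero_smul]
  -- The vanishing of `D i` gives skewness only on `n`. On the other entries both structure
  -- constants are zero, by `hGz` or because brackets lie in `n`.
  have hskew : ∀ i, p i = 0 → ∀ j k, c i j k = - c i k j := by
    intro i hi j k
    have e1 := (Finset.sum_eq_zero_iff_of_nonneg fun i _ => hv i).1 s1 i (Finset.mem_univ _)
    rw [hi, sub_zero, one_mul] at e1
    have e2 := (Finset.sum_eq_zero_iff_of_nonneg fun j _ => Finset.sum_nonneg fun k _ =>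
      mul_nonneg (mul_nonneg (hp0 j).1 (hp0 k).1) (sq_nonneg _)).1 e1 j (Finset.mem_univ _)
    have e3 := (Finset.sum_eq_zero_iff_of_nonneg fun k _ =>
      mul_nonneg (mul_nonneg (hp0 j).1 (hp0 k).1) (sq_nonneg _)).1 e2 k (Finset.mem_univ _)
    rcases hp j with hj | hj
    · have f1 : c i j k = 0 := by simp [hc, hGz i j (hi.trans hj.symm)]
      have f2 : c i k j = 0 := by rw [← hcp, hj, zero_mul]
      rw [f1, f2, neg_zero]
    · rcases hp k with hk | hk
      · have f1 : c i k j = 0 := by simp [hc, hGz i k (hi.trans hk.symm)]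
        have f2 : c i j k = 0 := by rw [← hcp, hk, zero_mul]
        rw [f1, f2, neg_zero]
      · rw [hj, hk, one_mul, one_mul, sq_eq_zero_iff] at e3
        linarith
  have hexp : ∀ x, x = ∑ i, (inner ℝ (b i) x : ℝ) • b i := fun x => (b.sum_repr' x).symm
  have hin : ∀ x ∈ n, ∀ i, p i = 0 → inner ℝ (b i) x = 0 := by
    intro x hx i hi
    have hi' : b i ∉ n := fun hi' => by simp [p, hi'] at hi
    rw [real_inner_comm]
    exact ((hb i).resolve_left hi') x hx
  have hout : ∀ x ∈ nᗮ, ∀ i, p i = 1 → inner ℝ (b i) x = 0 := by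
    intro x hx i hi
    have hi' : b i ∈ n := by
      by_contra hi'
      simp [p, hi'] at hi
    exact hx _ hi'
  have hbil : ∀ x y, (∀ i j, inner ℝ (b i) x = 0 ∨ inner ℝ (b j) y = 0 ∨ p i = p j) →
      μ x y = 0 := by
    intro x y hxy
    rw [hexp x, hexp y]
    simp only [map_sum, sum_apply, map_smul, smul_apply]
    refine Finset.sum_eq_zero fun j _ => ?_
    rw [Finset.smul_sum]
    refine Finset.sum_eq_zero fun i _ => ?_
    rcases hxy i j with h | h | h
    · simp [h]
    · simp [h]
    · simp [hGz i j h]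
  refine ⟨n, hmem, fun x hx y hy => hbil x y fun i j => ?_, fun x hx y hy => hbil x y fun i j => ?_,
    fun x hx y z => ?_⟩
  · rcases hp i with hi | hi
    · exact Or.inl (hin x hx i hi)
    · rcases hp j with hj | hj
      · exact Or.inr (Or.inl (hin y hy j hj))
      · exact Or.inr (Or.inr (hi.trans hj.symm))
  · rcases hp i with hi | hi
    · rcases hp j with hj | hj
      · exact Or.inr (Or.inr (hi.trans hj.symm))
      · exact Or.inr (Or.inl (hout y hy j hj))
    · exact Or.inl (hout x hx i hi)
  · have hx1 : ∀ j k, inner ℝ (μ x (b j)) (b k) = - inner ℝ (μ x (b k)) (b j) := by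
      intro j k
      rw [hexp x]
      simp only [map_sum, sum_apply, sum_inner, map_smul, smul_apply, inner_smul_left]
      rw [← Finset.sum_neg_distrib]
      refine Finset.sum_congr rfl fun i _ => ?_
      rcases hp i with hi | hi
      · have := hskew i hi j k
        simp only [hc] at this
        rw [this, mul_neg]
      · rw [hout x hx i hi]
        simp
    have hA : LinearMap.adjoint (μ x : V →ₗ[ℝ] V) = - (μ x : V →ₗ[ℝ] V) := by
      symm
      rw [LinearMap.eq_adjoint_iff_basis b.toBasis b.toBasis]
      intro j k
      simp only [OrthonormalBasis.coe_toBasis, LinearMap.neg_apply, ContinuousLinearMap.coe_coe,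
        inner_neg_left]
      rw [hx1, neg_neg, real_inner_comm]
    have := LinearMap.adjoint_inner_left (μ x : V →ₗ[ℝ] V) z y
    rw [hA] at this
    simp only [LinearMap.neg_apply, ContinuousLinearMap.coe_coe, inner_neg_left] at this
    rw [real_inner_comm y, ← this, neg_neg]

end RicciPinching

/-! ### The pinching functional: bounds, continuity and invariance -/

namespace RicciPinching

open Filter Topology

variable {V : Type*} [NormedAddCommGroup V] [InnerProductSpace ℝ V]

theorem glAct_trans (h h' : V ≃L[ℝ] V) (μ : V →L[ℝ] V →L[ℝ] V) :
    glAct (h.trans h') μ = glAct h' (glAct h μ) := by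
  ext x y
  simp [glAct_apply]

theorem glAct_mem_glOrbit (h : V ≃L[ℝ] V) {μ ν : V →L[ℝ] V →L[ℝ] V} (hν : ν ∈ glOrbit μ) :
    glAct h ν ∈ glOrbit μ := by
  obtain ⟨g, rfl⟩ := hν
  exact ⟨g.trans h, glAct_trans g h μ⟩

theorem self_mem_glOrbit (μ : V →L[ℝ] V →L[ℝ] V) : μ ∈ glOrbit μ :=
  ⟨ContinuousLinearEquiv.refl ℝ V, by ext x y; simp [glAct_apply]⟩

/-- The homothety with ratio `c`. -/
noncomputable def homothety {c : ℝ} (hc : c ≠ 0) : V ≃L[ℝ] V :=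
  ContinuousLinearEquiv.smulLeft (Units.mk0 c hc)

theorem glAct_homothety {c : ℝ} (hc : c ≠ 0) (μ : V →L[ℝ] V →L[ℝ] V) :
    glAct (homothety hc) μ = c⁻¹ • μ := by
  ext x y
  have h1 : ∀ x : V, homothety hc x = c • x := fun x => rfl
  have h2 : ∀ x : V, (homothety hc).symm x = c⁻¹ • x := fun x => by
    rw [ContinuousLinearEquiv.symm_apply_eq, h1, smul_smul, mul_inv_cancel₀ hc, one_smul]
  rw [glAct_apply, h1, h2, h2]
  simp only [map_smul, smul_apply, smul_smul]
  rw [mul_inv_cancel_left₀ hc]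

variable [FiniteDimensional ℝ V]

theorem scalarCurvature_ne_zero {μ : V →L[ℝ] V →L[ℝ] V} (hμ : μ ∈ solvableBrackets V)
    (hf : μ ∉ flatBrackets V) : scalarCurvature μ ≠ 0 := by
  intro h0
  obtain ⟨h, -⟩ := id hμ
  obtain ⟨n, hn⟩ := exists_isFlatBracket h (killingVanishes_of_mem_solvableBrackets hμ) h0
  exact hf ⟨hμ, hn.curvature_eq_zero h⟩

theorem not_mem_flatBrackets {μ : V →L[ℝ] V →L[ℝ] V} (h : scalarCurvature μ ≠ 0) :
    μ ∉ flatBrackets V := fun hf => h (scalarCurvature_eq_zero_of_flat hf.2)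

section

variable {ι : Type*} [Fintype ι] (b : OrthonormalBasis ι ℝ V)

theorem scalarCurvature_eq_sum (μ : V →L[ℝ] V →L[ℝ] V) :
    scalarCurvature μ = ∑ i, inner ℝ (b i) (ricci μ (b i)) :=
  LinearMap.trace_eq_sum_inner _ b

theorem ricciNormSq_eq_sum (μ : V →L[ℝ] V →L[ℝ] V) :
    ricciNormSq μ = ∑ i, ‖ricci μ (b i)‖ ^ 2 := by
  rw [ricciNormSq, LinearMap.trace_eq_sum_inner _ b]
  refine Finset.sum_congr rfl fun i _ => ?_
  rw [LinearMap.comp_apply, LinearMap.adjoint_inner_right, real_inner_self_eq_norm_sq]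

end

theorem ricciNormSq_nonneg (μ : V →L[ℝ] V →L[ℝ] V) : 0 ≤ ricciNormSq μ := by
  rw [ricciNormSq_eq_sum (stdOrthonormalBasis ℝ V)]
  positivity

theorem scalarCurvature_sq_le (μ : V →L[ℝ] V →L[ℝ] V) :
    scalarCurvature μ ^ 2 ≤ Module.finrank ℝ V * ricciNormSq μ := by
  set b := stdOrthonormalBasis ℝ V
  rw [scalarCurvature_eq_sum b, ricciNormSq_eq_sum b]
  refine (sq_sum_le_card_mul_sum_sq).trans ?_
  rw [Finset.card_univ, Fintype.card_fin]
  gcongr ?_ * ?_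
  refine Finset.sum_le_sum fun i _ => ?_
  have h1 := abs_real_inner_le_norm (b i) (ricci μ (b i))
  rw [b.norm_eq_one, one_mul] at h1
  rw [← sq_abs]
  gcongr

/-- A single Ricci curvature bounds the Ricci norm from below, so $F$ can be bounded from above
without computing the whole Ricci operator. -/
theorem inner_ricci_sq_le (μ : V →L[ℝ] V →L[ℝ] V) {y : V} (hy : ‖y‖ = 1) :
    (inner ℝ (ricci μ y) y) ^ 2 ≤ ricciNormSq μ := by
  set b := stdOrthonormalBasis ℝ V
  rw [ricciNormSq_eq_sum b]
  have h1 : inner ℝ (ricci μ y) y = ∑ i, inner ℝ (b i) y * inner ℝ (ricci μ (b i)) y := by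
    nth_rewrite 1 [← b.sum_repr' y]
    rw [map_sum, sum_inner]
    refine Finset.sum_congr rfl fun i _ => ?_
    rw [map_smul, real_inner_smul_left]
  have h2 : ∑ i, (inner ℝ (b i) y) ^ 2 = 1 := by
    have := b.sum_sq_norm_inner_right y
    simp only [Real.norm_eq_abs, sq_abs] at this
    rw [this, hy, one_pow]
  rw [h1]
  refine (Finset.sum_mul_sq_le_sq_mul_sq _ _ _).trans ?_
  rw [h2, one_mul]
  refine Finset.sum_le_sum fun i _ => ?_
  have h3 := abs_real_inner_le_norm (ricci μ (b i)) y
  rw [hy, mul_one] at h3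
  rw [← sq_abs]
  gcongr

theorem ricciNormSq_pos {μ : V →L[ℝ] V →L[ℝ] V} (h : scalarCurvature μ ≠ 0) :
    0 < ricciNormSq μ := by
  have h1 := scalarCurvature_sq_le μ
  have h2 : 0 < scalarCurvature μ ^ 2 := by positivity
  refine (ricciNormSq_nonneg μ).lt_of_ne fun h0 => ?_
  rw [← h0, mul_zero] at h1
  linarith

theorem pinching_nonneg (μ : V →L[ℝ] V →L[ℝ] V) : 0 ≤ pinching μ :=
  div_nonneg (sq_nonneg _) (ricciNormSq_nonneg μ)

theorem pinching_pos {μ : V →L[ℝ] V →L[ℝ] V} (h : scalarCurvature μ ≠ 0) : 0 < pinching μ :=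
  div_pos (by positivity) (ricciNormSq_pos h)

theorem pinching_le (μ : V →L[ℝ] V →L[ℝ] V) : pinching μ ≤ Module.finrank ℝ V :=
  div_le_of_le_mul₀ (ricciNormSq_nonneg μ) (Nat.cast_nonneg _) (scalarCurvature_sq_le μ)

/-! ### Continuity -/

theorem continuous_leviCivita {f g : (V →L[ℝ] V →L[ℝ] V) → V} (hf : Continuous f)
    (hg : Continuous g) : Continuous fun μ => leviCivita μ (f μ) (g μ) := by
  have : CompleteSpace V := FiniteDimensional.complete ℝ V
  have h1 : ∀ μ, leviCivita μ (f μ) (g μ) =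
      (1 / 2 : ℝ) • (μ (f μ) (g μ) - ContinuousLinearMap.adjoint (μ (f μ)) (g μ)
        - ContinuousLinearMap.adjoint (μ (g μ)) (f μ)) := fun μ => rfl
  have h2 : Continuous (ContinuousLinearMap.adjoint : (V →L[ℝ] V) → (V →L[ℝ] V)) :=
    ContinuousLinearMap.adjoint.continuous
  have h3 : Continuous fun μ : V →L[ℝ] V →L[ℝ] V => ContinuousLinearMap.adjoint (μ (f μ)) :=
    h2.comp (continuous_id.clm_apply hf)
  have h4 : Continuous fun μ : V →L[ℝ] V →L[ℝ] V => ContinuousLinearMap.adjoint (μ (g μ)) :=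
    h2.comp (continuous_id.clm_apply hg)
  have h5 : Continuous fun μ : V →L[ℝ] V →L[ℝ] V => μ (f μ) (g μ) :=
    (continuous_id.clm_apply hf).clm_apply hg
  simp only [h1]
  exact ((h5.sub (h3.clm_apply hg)).sub (h4.clm_apply hf)).const_smul _

theorem continuous_curvature (x y z : V) :
    Continuous fun μ : V →L[ℝ] V →L[ℝ] V => curvature μ x y z := by
  have h1 : ∀ x y z, Continuous fun μ : V →L[ℝ] V →L[ℝ] V =>
      leviCivita μ x (leviCivita μ y z) := fun x y z =>
    continuous_leviCivita continuous_const (continuous_leviCivita continuous_const continuous_const)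
  have h2 : Continuous fun μ : V →L[ℝ] V →L[ℝ] V => leviCivita μ (μ x y) z :=
    continuous_leviCivita ((continuous_id.clm_apply continuous_const).clm_apply continuous_const)
      continuous_const
  exact ((h1 x y z).sub (h1 y x z)).sub h2

theorem continuous_ricci (x : V) : Continuous fun μ : V →L[ℝ] V →L[ℝ] V => ricci μ x := by
  simp only [ricci_apply (stdOrthonormalBasis ℝ V)]
  exact continuous_finsetSum _ fun _ _ => continuous_curvature _ _ _

theorem continuous_scalarCurvature :
    Continuous (scalarCurvature : (V →L[ℝ] V →L[ℝ] V) → ℝ) := by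
  have : (scalarCurvature : (V →L[ℝ] V →L[ℝ] V) → ℝ) = _ :=
    funext (scalarCurvature_eq_sum (stdOrthonormalBasis ℝ V))
  rw [this]
  exact continuous_finsetSum _ fun _ _ => continuous_const.inner (continuous_ricci _)

theorem continuous_ricciNormSq :
    Continuous (ricciNormSq : (V →L[ℝ] V →L[ℝ] V) → ℝ) := by
  have : (ricciNormSq : (V →L[ℝ] V →L[ℝ] V) → ℝ) = _ :=
    funext (ricciNormSq_eq_sum (stdOrthonormalBasis ℝ V))
  rw [this]
  exact continuous_finsetSum _ fun _ _ => (continuous_ricci _).norm.pow 2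

theorem continuousAt_pinching {μ : V →L[ℝ] V →L[ℝ] V} (h : scalarCurvature μ ≠ 0) :
    ContinuousAt pinching μ :=
  (continuous_scalarCurvature.pow 2).continuousAt.div continuous_ricciNormSq.continuousAt
    (ricciNormSq_pos h).ne'

/-! ### Invariance -/

theorem ricci_smul (c : ℝ) (μ : V →L[ℝ] V →L[ℝ] V) (x : V) :
    ricci (c • μ) x = c ^ 2 • ricci μ x := by
  have h1 : ∀ x y, leviCivita (c • μ) x y = c • leviCivita μ x y := by
    intro x y
    simp [leviCivita]
    module
  have h2 : ∀ x y z, curvature (c • μ) x y z = c ^ 2 • curvature μ x y z := by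
    intro x y z
    simp [curvature, h1]
    module
  simp [ricci, h2, Finset.smul_sum]

theorem scalarCurvature_smul (c : ℝ) (μ : V →L[ℝ] V →L[ℝ] V) :
    scalarCurvature (c • μ) = c ^ 2 * scalarCurvature μ := by
  simp only [scalarCurvature_eq_sum (stdOrthonormalBasis ℝ V), ricci_smul, inner_smul_right,
    Finset.mul_sum]

theorem pinching_smul {c : ℝ} (hc : c ≠ 0) (μ : V →L[ℝ] V →L[ℝ] V) :
    pinching (c • μ) = pinching μ := by
  have h1 : ricciNormSq (c • μ) = (c ^ 2) ^ 2 * ricciNormSq μ := by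
    simp only [ricciNormSq_eq_sum (stdOrthonormalBasis ℝ V), ricci_smul, norm_smul,
      Finset.mul_sum, mul_pow, Real.norm_eq_abs, sq_abs, abs_pow]
  rw [pinching, pinching, scalarCurvature_smul, h1, mul_pow]
  exact mul_div_mul_left _ _ (by positivity)

theorem ricci_glAct (O : V ≃ₗᵢ[ℝ] V) (μ : V →L[ℝ] V →L[ℝ] V) (x : V) :
    ricci (glAct O.toContinuousLinearEquiv μ) (O x) = O (ricci μ x) := by
  set ν := glAct O.toContinuousLinearEquiv μ with hν
  have h0 : ∀ x y, ν (O x) (O y) = O (μ x y) := by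
    intro x y
    rw [hν, glAct_apply]
    simp
  have ha : ∀ x y, LinearMap.adjoint (ν (O x) : V →ₗ[ℝ] V) (O y) =
      O (LinearMap.adjoint (μ x : V →ₗ[ℝ] V) y) := by
    intro x y
    refine ext_inner_right ℝ fun z => ?_
    obtain ⟨z, rfl⟩ := O.surjective z
    rw [LinearMap.adjoint_inner_left, ContinuousLinearMap.coe_coe, h0, O.inner_map_map,
      O.inner_map_map, LinearMap.adjoint_inner_left, ContinuousLinearMap.coe_coe]
  have h1 : ∀ x y, leviCivita ν (O x) (O y) = O (leviCivita μ x y) := by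
    intro x y
    simp only [leviCivita, LinearMap.mk₂_apply, h0, ha, map_smul, map_sub]
  have h2 : ∀ x y z, curvature ν (O x) (O y) (O z) = O (curvature μ x y z) := by
    intro x y z
    simp only [curvature, LinearMap.sub_apply, LinearMap.comp_apply, h0, h1, map_sub]
  rw [ricci_apply ((stdOrthonormalBasis ℝ V).map O), ricci_apply (stdOrthonormalBasis ℝ V), map_sum]
  simp [h2]

theorem scalarCurvature_glAct_isometry (O : V ≃ₗᵢ[ℝ] V) (μ : V →L[ℝ] V →L[ℝ] V) :
    scalarCurvature (glAct O.toContinuousLinearEquiv μ) = scalarCurvature μ := by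
  rw [scalarCurvature_eq_sum ((stdOrthonormalBasis ℝ V).map O),
    scalarCurvature_eq_sum (stdOrthonormalBasis ℝ V)]
  simp [ricci_glAct]

theorem pinching_glAct_isometry (O : V ≃ₗᵢ[ℝ] V) (μ : V →L[ℝ] V →L[ℝ] V) :
    pinching (glAct O.toContinuousLinearEquiv μ) = pinching μ := by
  have : ricciNormSq (glAct O.toContinuousLinearEquiv μ) = ricciNormSq μ := by
    rw [ricciNormSq_eq_sum ((stdOrthonormalBasis ℝ V).map O),
      ricciNormSq_eq_sum (stdOrthonormalBasis ℝ V)]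
    simp [ricci_glAct]
  rw [pinching, pinching, scalarCurvature_glAct_isometry, this]

theorem continuous_bracket_iff {X : Type*} [TopologicalSpace X] {f : X → V →L[ℝ] V →L[ℝ] V} :
    Continuous f ↔ ∀ x y, Continuous fun t => f t x y := by
  rw [continuous_clm_apply]
  exact forall_congr' fun x => continuous_clm_apply

theorem continuous_glAct (h : V ≃L[ℝ] V) :
    Continuous (glAct h : (V →L[ℝ] V →L[ℝ] V) → (V →L[ℝ] V →L[ℝ] V)) := by
  refine continuous_bracket_iff.2 fun x y => ?_
  simp only [glAct_apply]
  fun_prop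

theorem glAct_mem_closure_glOrbit (h : V ≃L[ℝ] V) {μ ν : V →L[ℝ] V →L[ℝ] V}
    (hν : ν ∈ closure (glOrbit μ)) : glAct h ν ∈ closure (glOrbit μ) :=
  map_mem_closure (continuous_glAct h) hν fun _ => glAct_mem_glOrbit h

end RicciPinching

/-! ### Orbits and their closures; the interval of values for real type -/

namespace RicciPinching

open Filter Topology

section

variable {V : Type*} [NormedAddCommGroup V] [InnerProductSpace ℝ V]

theorem exists_smul_mem_sphere {E : Type*} [NormedAddCommGroup E] [NormedSpace ℝ E] {x : E}
    (hx : x ≠ 0) : ∃ c : ℝ, c ≠ 0 ∧ c • x ∈ Metric.sphere (0 : E) 1 := by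
  have h1 : ‖x‖ ≠ 0 := norm_ne_zero_iff.2 hx
  refine ⟨‖x‖⁻¹, inv_ne_zero h1, ?_⟩
  rw [mem_sphere_zero_iff_norm, norm_smul, norm_inv, norm_norm, inv_mul_cancel₀ h1]

theorem bracket_eq_zero_of_mem_span {μ : V →L[ℝ] V →L[ℝ] V} {s : Set V}
    (h : ∀ x ∈ s, ∀ y ∈ s, μ x y = 0) {x y : V} (hx : x ∈ Submodule.span ℝ s)
    (hy : y ∈ Submodule.span ℝ s) : μ x y = 0 := by
  induction hx using Submodule.span_induction with
  | mem x hx =>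
    induction hy using Submodule.span_induction with
    | mem y hy => exact h x hx y hy
    | zero => simp
    | add y z _ _ hy hz => rw [map_add, hy, hz, add_zero]
    | smul c y _ hy => rw [map_smul, hy, smul_zero]
  | zero => simp
  | add x z _ _ hx hz => rw [map_add, add_apply, hx, hz, add_zero]
  | smul c x _ hx => rw [map_smul, smul_apply, hx, smul_zero]

theorem mem_solvableBrackets_of_metabelian {μ : V →L[ℝ] V →L[ℝ] V} (h : IsLieBracket μ)
    (h2 : ∀ x y z w, μ (μ x y) (μ z w) = 0) : μ ∈ solvableBrackets V := by
  refine ⟨h, ?_⟩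
  let _ : LieRing V := h.lieRing
  let _ : LieAlgebra ℝ V := { lie_smul := fun c x y => (μ x).map_smul c y }
  refine LieAlgebra.IsSolvable.mk (R := ℝ) (k := 2) ?_
  have h1 : LieAlgebra.derivedSeries ℝ V 2 = ⁅⁅(⊤ : LieIdeal ℝ V), (⊤ : LieIdeal ℝ V)⁆,
      ⁅(⊤ : LieIdeal ℝ V), (⊤ : LieIdeal ℝ V)⁆⁆ := rfl
  rw [h1, LieSubmodule.lie_eq_bot_iff]
  have hspan : ∀ x ∈ ⁅(⊤ : LieIdeal ℝ V), (⊤ : LieIdeal ℝ V)⁆,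
      x ∈ Submodule.span ℝ (Set.range fun p : V × V => μ p.1 p.2) := by
    intro x hx
    rw [← LieSubmodule.mem_toSubmodule, LieSubmodule.lieIdeal_oper_eq_linear_span'] at hx
    refine Submodule.span_mono ?_ hx
    rintro _ ⟨y, -, z, -, rfl⟩
    exact ⟨(y, z), rfl⟩
  exact fun x hx y hy => bracket_eq_zero_of_mem_span (by
    rintro _ ⟨p, rfl⟩ _ ⟨q, rfl⟩
    exact h2 _ _ _ _) (hspan x hx) (hspan y hy)

theorem trace_glAct_mul (h : V ≃L[ℝ] V) (μ : V →L[ℝ] V →L[ℝ] V) (x y : V) :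
    LinearMap.trace ℝ V ((glAct h μ x : V →ₗ[ℝ] V) * (glAct h μ y : V →ₗ[ℝ] V)) =
      LinearMap.trace ℝ V ((μ (h.symm x) : V →ₗ[ℝ] V) * (μ (h.symm y) : V →ₗ[ℝ] V)) := by
  rw [← LinearMap.trace_conj' ((μ (h.symm x) : V →ₗ[ℝ] V) * (μ (h.symm y) : V →ₗ[ℝ] V))
    h.toLinearEquiv]
  congr 1
  ext v
  simp [glAct_apply, LinearEquiv.conj_apply]

theorem IsLieBracket.glAct {μ : V →L[ℝ] V →L[ℝ] V} (hμ : IsLieBracket μ) (h : V ≃L[ℝ] V) :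
    IsLieBracket (glAct h μ) := by
  refine ⟨fun x => ?_, fun x y z => ?_⟩
  · rw [glAct_apply, hμ.self, map_zero]
  · simp only [glAct_apply, h.symm_apply_apply]
    rw [hμ.jacobi, map_add]

theorem isClosed_isLieBracket : IsClosed {μ : V →L[ℝ] V →L[ℝ] V | IsLieBracket μ} := by
  have : {μ : V →L[ℝ] V →L[ℝ] V | IsLieBracket μ} = {μ | ∀ x, μ x x = 0} ∩
      {μ | ∀ x y z, μ x (μ y z) = μ (μ x y) z + μ y (μ x z)} := by
    ext μ
    exact ⟨fun h => ⟨h.self, h.jacobi⟩, fun h => ⟨h.1, h.2⟩⟩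
  rw [this]
  refine IsClosed.inter ?_ ?_
  · simp only [Set.ofPred_forall]
    exact isClosed_iInter fun x => isClosed_eq (by fun_prop) continuous_const
  · simp only [Set.ofPred_forall]
    refine isClosed_iInter fun x => isClosed_iInter fun y => isClosed_iInter fun z =>
      isClosed_eq ?_ ?_
    · fun_prop
    · fun_prop

theorem KillingVanishes.glAct {μ : V →L[ℝ] V →L[ℝ] V} (hμ : KillingVanishes μ) (h : V ≃L[ℝ] V) :
    KillingVanishes (glAct h μ) := fun x y z w => by
  rw [trace_glAct_mul]
  simp only [glAct_apply, h.symm_apply_apply]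
  exact hμ _ _ _ _

theorem isLieBracket_of_mem_closure {μ ν : V →L[ℝ] V →L[ℝ] V} (hμ : IsLieBracket μ)
    (hν : ν ∈ closure (glOrbit μ)) : IsLieBracket ν := by
  refine closure_minimal ?_ isClosed_isLieBracket hν
  rintro _ ⟨h, rfl⟩
  exact hμ.glAct h

theorem traceSq_of_skew {ι : Type*} [Fintype ι] (b : OrthonormalBasis ι ℝ V) {A : V →L[ℝ] V}
    (hA : ∀ v w, inner ℝ (A v) w = - inner ℝ (A w) v) : traceSq A = - ∑ i, ‖A (b i)‖ ^ 2 := by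
  rw [traceSq, trace_mul_self_eq_sum b, ← Finset.sum_neg_distrib]
  refine Finset.sum_congr rfl fun i _ => ?_
  rw [← b.sum_sq_norm_inner_right, ← Finset.sum_neg_distrib]
  refine Finset.sum_congr rfl fun j _ => ?_
  rw [Real.norm_eq_abs, sq_abs, ContinuousLinearMap.coe_coe, hA (b j), real_inner_comm]
  ring

/-- The bracket `A μ(B x, B y)`. -/
noncomputable def conjBracket (A B : V →L[ℝ] V) (μ : V →L[ℝ] V →L[ℝ] V) : V →L[ℝ] V →L[ℝ] V :=
  (ContinuousLinearMap.compL ℝ V V V A).comp (μ.bilinearComp B B)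

theorem conjBracket_apply (A B : V →L[ℝ] V) (μ : V →L[ℝ] V →L[ℝ] V) (x y : V) :
    conjBracket A B μ x y = A (μ (B x) (B y)) := rfl

/-- The operator which is diagonal with respect to an orthonormal basis. -/
noncomputable def diagOp {ι : Type*} [Fintype ι] (b : OrthonormalBasis ι ℝ V) (τ : ι → ℝ) :
    V →L[ℝ] V := ∑ i, τ i • (innerSL ℝ (b i)).smulRight (b i)

section

variable {ι : Type*} [Fintype ι] (b : OrthonormalBasis ι ℝ V)

theorem diagOp_apply (τ : ι → ℝ) (x : V) :
    diagOp b τ x = ∑ i, (τ i * inner ℝ (b i) x) • b i := by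
  simp [diagOp, smul_smul]

theorem inner_diagOp (τ : ι → ℝ) (x : V) (i : ι) :
    inner ℝ (b i) (diagOp b τ x) = τ i * inner ℝ (b i) x := by
  classical
  rw [diagOp_apply, inner_sum, Finset.sum_eq_single i]
  · simp [inner_smul_right]
  · intro j _ hj
    rw [inner_smul_right, b.orthonormal.2 hj.symm, mul_zero]
  · simp

theorem ext_inner_basis {x y : V} (h : ∀ i, inner ℝ (b i) x = inner ℝ (b i) y) : x = y := by
  rw [← b.sum_repr' x, ← b.sum_repr' y]
  exact Finset.sum_congr rfl fun i _ => by rw [h]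

/-- The invertible operator which is diagonal with respect to an orthonormal basis. -/
noncomputable def diagEquiv {τ : ι → ℝ} (hτ : ∀ i, τ i ≠ 0) : V ≃L[ℝ] V :=
  ContinuousLinearEquiv.equivOfInverse (diagOp b τ) (diagOp b τ⁻¹)
    (fun x => ext_inner_basis b fun i => by simp [inner_diagOp, hτ i])
    (fun x => ext_inner_basis b fun i => by simp [inner_diagOp, hτ i])

theorem glAct_diagEquiv {τ : ι → ℝ} (hτ : ∀ i, τ i ≠ 0) (μ : V →L[ℝ] V →L[ℝ] V) :
    glAct (diagEquiv b hτ) μ = conjBracket (diagOp b τ) (diagOp b τ⁻¹) μ := rfl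

theorem continuous_diagOp : Continuous (diagOp b) := by
  unfold diagOp
  fun_prop

end

end

variable {V : Type*} [NormedAddCommGroup V] [InnerProductSpace ℝ V] [FiniteDimensional ℝ V]

theorem zero_mem_flatBrackets : (0 : V →L[ℝ] V →L[ℝ] V) ∈ flatBrackets V := by
  have h : IsLieBracket (0 : V →L[ℝ] V →L[ℝ] V) := ⟨by simp, by simp⟩
  refine ⟨mem_solvableBrackets_of_metabelian h (by simp), ?_⟩
  have hn : IsFlatBracket (0 : V →L[ℝ] V →L[ℝ] V) ⊥ := ⟨by simp, by simp, by simp, by simp⟩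
  exact hn.curvature_eq_zero h

theorem continuous_conjBracket (μ : V →L[ℝ] V →L[ℝ] V) :
    Continuous fun p : (V →L[ℝ] V) × (V →L[ℝ] V) => conjBracket p.1 p.2 μ := by
  refine continuous_bracket_iff.2 fun x y => ?_
  simp only [conjBracket_apply]
  fun_prop

theorem tendsto_conjBracket (μ : V →L[ℝ] V →L[ℝ] V) {X : Type*} {l : Filter X}
    {A B : X → V →L[ℝ] V} {A₀ B₀ : V →L[ℝ] V} (hA : Tendsto A l (𝓝 A₀)) (hB : Tendsto B l (𝓝 B₀)) :
    Tendsto (fun t => conjBracket (A t) (B t) μ) l (𝓝 (conjBracket A₀ B₀ μ)) :=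
  ((continuous_conjBracket μ).tendsto (A₀, B₀)).comp (hA.prodMk_nhds hB)

/-- The positive part of the polar decomposition, diagonalized. -/
theorem exists_diagOp_norm_eq (h : V ≃L[ℝ] V) :
    ∃ (b : OrthonormalBasis (Fin (Module.finrank ℝ V)) ℝ V) (τ : Fin (Module.finrank ℝ V) → ℝ),
      (∀ i, 0 < τ i) ∧ ∀ v, ‖diagOp b τ v‖ = ‖h v‖ := by
  let H : V →ₗ[ℝ] V := (h : V →L[ℝ] V)
  let T : V →ₗ[ℝ] V := LinearMap.adjoint H ∘ₗ H
  have hT : T.IsSymmetric := fun x y => by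
    simp only [T, LinearMap.comp_apply, LinearMap.adjoint_inner_left, LinearMap.adjoint_inner_right]
  let b := hT.eigenvectorBasis rfl
  have hTv : ∀ v, inner ℝ v (T v) = ‖h v‖ ^ 2 := fun v => by
    simp only [T, LinearMap.comp_apply, LinearMap.adjoint_inner_right, H,
      ContinuousLinearMap.coe_coe, real_inner_self_eq_norm_sq]
    rfl
  have hev : ∀ i, T (b i) = hT.eigenvalues rfl i • b i := fun i => hT.apply_eigenvectorBasis rfl i
  have hpos : ∀ i, 0 < hT.eigenvalues rfl i := by
    intro i
    have h1 := hTv (b i)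
    rw [hev, inner_smul_right, real_inner_self_eq_norm_sq, b.norm_eq_one, one_pow, mul_one] at h1
    rw [h1]
    have : h (b i) ≠ 0 := (map_ne_zero_iff h h.injective).2 (b.orthonormal.ne_zero i)
    positivity
  refine ⟨b, fun i => √(hT.eigenvalues rfl i), fun i => Real.sqrt_pos.2 (hpos i), fun v => ?_⟩
  have h2 : ‖diagOp b (fun i => √(hT.eigenvalues rfl i)) v‖ ^ 2 = ‖h v‖ ^ 2 := by
    rw [← b.sum_sq_norm_inner_right, ← hTv, ← b.sum_inner_mul_inner]
    refine Finset.sum_congr rfl fun i _ => ?_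
    rw [inner_diagOp, ← hT, hev, Real.norm_eq_abs, sq_abs, mul_pow, Real.sq_sqrt (hpos i).le,
      inner_smul_left, real_inner_comm]
    simp
    ring
  exact (sq_eq_sq₀ (norm_nonneg _) (norm_nonneg _)).1 h2

/-- Here $h\circ g^{-1}$ is an isometry, under which $F$ is invariant. Only the positive factor of
the polar decomposition matters. -/
theorem pinching_glAct_eq_of_norm_eq {h g : V ≃L[ℝ] V} (hg : ∀ v, ‖g v‖ = ‖h v‖)
    (μ : V →L[ℝ] V →L[ℝ] V) : pinching (glAct h μ) = pinching (glAct g μ) := by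
  let O : V ≃ₗᵢ[ℝ] V := ⟨(g.symm.trans h).toLinearEquiv, fun v => by
    have := hg (g.symm v)
    rw [g.apply_symm_apply] at this
    exact this.symm⟩
  rw [← pinching_glAct_isometry O (glAct g μ), ← glAct_trans]
  congr 2
  ext v
  change h v = h (g.symm (g v))
  rw [g.symm_apply_apply]

/-- The values of the pinching functional on an orbit of nonflat brackets form a connected set. -/
theorem isPreconnected_pinching_glOrbit {μ : V →L[ℝ] V →L[ℝ] V}
    (h0 : ∀ ν ∈ glOrbit μ, scalarCurvature ν ≠ 0) : IsPreconnected (pinching '' glOrbit μ) := by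
  refine isPreconnected_of_forall (pinching μ) ?_
  rintro _ ⟨_, ⟨h, rfl⟩, rfl⟩
  obtain ⟨b, τ, hτ, hbτ⟩ := exists_diagOp_norm_eq h
  -- In the eigenbasis, positive diagonal operators form a convex set joining the identity to the
  -- positive part of `h`. This avoids the disconnectedness of $GL(V)$.
  let S : Set (Fin (Module.finrank ℝ V) → ℝ) := {σ | ∀ i, 0 < σ i}
  have hS : Convex ℝ S := by
    have : S = Set.pi Set.univ fun _ => Set.Ioi 0 := by ext; simp [S]
    rw [this]
    exact convex_pi fun _ _ => convex_Ioi 0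
  let f := fun σ : Fin (Module.finrank ℝ V) → ℝ => conjBracket (diagOp b σ) (diagOp b σ⁻¹) μ
  have hfS : ∀ σ (hσ : σ ∈ S), f σ = glAct (diagEquiv b fun i => (hσ i).ne') μ :=
    fun σ hσ => (glAct_diagEquiv b _ μ).symm
  have hf : ContinuousOn f S := by
    have h1 : ContinuousOn (fun σ : Fin (Module.finrank ℝ V) → ℝ => σ⁻¹) S :=
      continuousOn_pi.2 fun i => (continuous_apply i).continuousOn.inv₀ fun σ hσ => (hσ i).ne'
    exact fun σ hσ => tendsto_conjBracket μ ((continuous_diagOp b).continuousWithinAt)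
      ((continuous_diagOp b).continuousAt.comp_continuousWithinAt (h1 σ hσ))
  refine ⟨(fun σ => pinching (f σ)) '' S, ?_, ⟨1, fun i => one_pos, ?_⟩, ⟨τ, hτ, ?_⟩, ?_⟩
  · rintro _ ⟨σ, hσ, rfl⟩
    exact ⟨f σ, hfS σ hσ ▸ ⟨_, rfl⟩, rfl⟩
  · have : f 1 = μ := by
      ext x y
      have h1 : ∀ x, diagOp b 1 x = x := fun x => ext_inner_basis b fun i => by simp [inner_diagOp]
      simp only [f, conjBracket_apply, inv_one, h1]
    simp only [this]
  · simp only [hfS τ hτ]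
    exact (pinching_glAct_eq_of_norm_eq hbτ μ).symm
  · refine hS.isPreconnected.image _ fun σ hσ => ?_
    exact (continuousAt_pinching (h0 _ (hfS σ hσ ▸ ⟨_, rfl⟩))).comp_continuousWithinAt (hf σ hσ)

/-! ### Closures of orbits -/

theorem complexSpectrum_glAct_subset (h : V ≃L[ℝ] V) (μ : V →L[ℝ] V →L[ℝ] V) (x : V) :
    complexSpectrum (glAct h μ x) ⊆ complexSpectrum (μ (h.symm x)) := by
  refine spectrum_subset_of_intertwining
    (q := ((h : V →L[ℝ] V) : V →ₗ[ℝ] V).baseChange ℂ) ?_ fun w => ?_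
  · exact LinearMap.lTensor_surjective _ h.surjective
  · rw [← LinearMap.comp_apply, ← LinearMap.comp_apply, ← LinearMap.baseChange_comp,
      ← LinearMap.baseChange_comp]
    congr 2
    ext y
    simp [glAct_apply]

theorem continuous_trace_mul : Continuous fun p : (V →L[ℝ] V) × (V →L[ℝ] V) =>
    LinearMap.trace ℝ V ((p.1 : V →ₗ[ℝ] V) * (p.2 : V →ₗ[ℝ] V)) := by
  simp only [LinearMap.trace_eq_sum_inner _ (stdOrthonormalBasis ℝ V), Module.End.mul_apply,
    ContinuousLinearMap.coe_coe]
  fun_prop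

theorem continuous_traceSq : Continuous (traceSq : (V →L[ℝ] V) → ℝ) :=
  continuous_trace_mul.comp (continuous_id.prodMk continuous_id)

/-- The trace condition is visibly closed and invariant under $GL(V)$. It replaces solvability for
limits of an orbit, since it is all that the scalar curvature argument needs. -/
theorem isClosed_killingVanishes : IsClosed {μ : V →L[ℝ] V →L[ℝ] V | KillingVanishes μ} := by
  simp only [KillingVanishes, Set.ofPred_forall]
  refine isClosed_iInter fun x => isClosed_iInter fun y => isClosed_iInter fun z =>
    isClosed_iInter fun w => isClosed_eq ?_ continuous_const
  exact continuous_trace_mul.comp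
    (f := fun μ : V →L[ℝ] V →L[ℝ] V => (μ (μ x y), μ (μ z w))) (by fun_prop)

theorem killingVanishes_of_mem_closure {μ ν : V →L[ℝ] V →L[ℝ] V} (hμ : KillingVanishes μ)
    (hν : ν ∈ closure (glOrbit μ)) : KillingVanishes ν := by
  refine closure_minimal ?_ isClosed_killingVanishes hν
  rintro _ ⟨h, rfl⟩
  exact hμ.glAct h

/-- Let `u k` in the orbit tend to `ν`. Since `ν x` has no symmetric part, the real parts of the
eigenvalues of `u k x` are at most `‖u k x - ν x‖`. Real type bounds the trace of the square by a
fixed multiple of the square of this distance, which tends to zero. -/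
theorem traceSq_eq_zero_of_skew_of_mem_closure {μ ν : V →L[ℝ] V →L[ℝ] V} (hμ : μ ∈ realType V)
    (hν : ν ∈ closure (glOrbit μ)) {x : V} (hx : ∀ v, inner ℝ (ν x v) v = 0) :
    traceSq (ν x) = 0 := by
  obtain ⟨C, hC, hbound⟩ := exists_abs_traceSq_le_of_mem_realType hμ
  obtain ⟨u, hu, hlim⟩ := mem_closure_iff_seq_limit.1 hν
  have h1 : ∀ k, |traceSq (u k x)| ≤ C * ‖u k x - ν x‖ ^ 2 := by
    intro k
    obtain ⟨h, hh⟩ := hu k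
    have e : traceSq (u k x) = traceSq (μ (h.symm x)) := by
      rw [← hh]
      exact trace_glAct_mul h μ x x
    rw [e]
    refine hbound _ _ (norm_nonneg _) fun c hc => ?_
    refine abs_re_le_of_mem_complexSpectrum (A := u k x) (fun v => ?_) ?_
    · have h1 : inner ℝ (u k x v) v = inner ℝ ((u k x - ν x) v) v := by
        rw [sub_apply, inner_sub_left, hx, sub_zero]
      rw [h1]
      calc _ ≤ ‖(u k x - ν x) v‖ * ‖v‖ := abs_real_inner_le_norm _ _
        _ ≤ ‖u k x - ν x‖ * ‖v‖ * ‖v‖ := by gcongr; exact (u k x - ν x).le_opNorm v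
        _ = _ := by ring
    · rw [← hh]
      -- The inclusion of spectra is applied to the inverse of `h` to obtain the opposite inclusion.
      have := complexSpectrum_glAct_subset h.symm (glAct h μ) (h.symm x)
      rw [← glAct_trans, h.symm_symm, h.apply_symm_apply] at this
      refine this ?_
      convert! hc using 2
      ext v
      simp [glAct_apply]
  have h2 : Tendsto (fun k => u k x) atTop (𝓝 (ν x)) :=
    ((ContinuousLinearMap.apply ℝ (V →L[ℝ] V) x).continuous.tendsto ν).comp hlim
  have h3 : Tendsto (fun k => |traceSq (u k x)|) atTop (𝓝 |traceSq (ν x)|) :=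
    ((continuous_traceSq.tendsto _).comp h2).abs
  have h4 : Tendsto (fun k => C * ‖u k x - ν x‖ ^ 2) atTop (𝓝 0) := by
    have := (((h2.sub_const (ν x)).norm).pow 2).const_mul C
    simpa using this
  exact abs_nonpos_iff.1 (le_of_tendsto_of_tendsto' h3 h4 h1)

theorem eq_zero_of_skew_of_traceSq_eq_zero {A : V →L[ℝ] V}
    (hA : ∀ v w, inner ℝ (A v) w = - inner ℝ (A w) v) (h : traceSq A = 0) : A = 0 := by
  set b := stdOrthonormalBasis ℝ V
  rw [traceSq_of_skew b hA, neg_eq_zero] at h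
  have h2 := (Finset.sum_eq_zero_iff_of_nonneg fun i _ => sq_nonneg _).1 h
  ext v
  rw [← b.sum_repr' v, map_sum]
  refine Finset.sum_eq_zero fun i hi => ?_
  have : A (b i) = 0 := by simpa using h2 i hi
  rw [map_smul, this, smul_zero]

/-- Otherwise `ν` would have the flat structure, with `nᗮ` acting by skew operators. These have zero
trace of the square by the preceding limit argument, hence vanish; as `n` is abelian, nothing of `ν`
remains. -/
theorem scalarCurvature_ne_zero_of_mem_closure {μ ν : V →L[ℝ] V →L[ℝ] V} (hμ : μ ∈ realType V)
    (hν : ν ∈ closure (glOrbit μ)) (h0 : ν ≠ 0) : scalarCurvature ν ≠ 0 := by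
  intro hs
  obtain ⟨hL, -⟩ := id hμ.1
  have hL := isLieBracket_of_mem_closure hL hν
  obtain ⟨n, hn⟩ := exists_isFlatBracket hL (killingVanishes_of_mem_closure
    (killingVanishes_of_mem_solvableBrackets hμ.1) hν) hs
  have h1 : ∀ x ∈ nᗮ, ν x = 0 := by
    intro x hx
    refine eq_zero_of_skew_of_traceSq_eq_zero (hn.skew x hx)
      (traceSq_eq_zero_of_skew_of_mem_closure hμ hν fun v => ?_)
    have := hn.skew x hx v v
    linarith
  refine h0 ?_
  ext x y
  obtain ⟨x₁, hx₁, x₂, hx₂, rfl⟩ := n.exists_add_mem_mem_orthogonal x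
  obtain ⟨y₁, hy₁, y₂, hy₂, rfl⟩ := n.exists_add_mem_mem_orthogonal y
  simp [h1 x₂ hx₂, hn.abelian _ hx₁ _ hy₁, hL.skew x₁ y₂, h1 y₂ hy₂]

theorem smul_mem_closure_glOrbit {μ ν : V →L[ℝ] V →L[ℝ] V} (hν : ν ∈ closure (glOrbit μ))
    {c : ℝ} (hc : c ≠ 0) : c • ν ∈ closure (glOrbit μ) := by
  have := glAct_mem_closure_glOrbit (homothety (inv_ne_zero hc)) hν
  rwa [glAct_homothety, inv_inv] at this

/-- By scale invariance the values on the closure are those on its compact intersection with the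
unit sphere, where $F$ is continuous and positive. They are also the closure of the connected set of
values on the orbit, with the same infimum and supremum. -/
theorem pinchingInf_pos_and_pinchingValues_closure_eq {μ : V →L[ℝ] V →L[ℝ] V}
    (hμ : μ ∈ realType V) (h0 : μ ≠ 0) :
    0 < pinchingInf μ ∧
      pinchingValues (closure (glOrbit μ)) = Set.Icc (pinchingInf μ) (pinchingSup μ) := by
  have horbit : ∀ ν ∈ glOrbit μ, ν ≠ 0 := by
    rintro _ ⟨h, rfl⟩ hz
    refine h0 ?_
    ext x y
    have := congrArg (fun ν : V →L[ℝ] V →L[ℝ] V => h.symm (ν (h x) (h y))) hz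
    simpa [glAct_apply] using this
  have hs : ∀ ν ∈ closure (glOrbit μ), ν ≠ 0 → scalarCurvature ν ≠ 0 := fun ν hν h0 =>
    scalarCurvature_ne_zero_of_mem_closure hμ hν h0
  have hT : pinchingValues (glOrbit μ) = pinching '' glOrbit μ := by
    rw [pinchingValues, Disjoint.sdiff_eq_left]
    exact Set.disjoint_left.2 fun ν hν hf =>
      not_mem_flatBrackets (hs ν (subset_closure hν) (horbit ν hν)) hf
  have hne : ∀ ν, ν ∉ flatBrackets V → ν ≠ 0 := by
    rintro ν hν rfl
    exact hν zero_mem_flatBrackets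
  have : ProperSpace (V →L[ℝ] V →L[ℝ] V) := 
    FiniteDimensional.proper ℝ (V →L[ℝ] V →L[ℝ] V)
  let K := closure (glOrbit μ) ∩ Metric.sphere 0 1
  have hK : IsCompact K := (isCompact_sphere _ _).inter_left isClosed_closure
  have hKne : ∀ ν ∈ K, ν ≠ 0 := by
    rintro ν ⟨-, hν⟩ rfl
    simp at hν
  have hS : pinchingValues (closure (glOrbit μ)) = pinching '' K := by
    refine subset_antisymm ?_ ?_
    · rintro _ ⟨ν, ⟨hν, hνf⟩, rfl⟩
      obtain ⟨c, hc, h1⟩ := exists_smul_mem_sphere (E := V →L[ℝ] V →L[ℝ] V) (hne ν hνf)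
      exact ⟨c • ν, ⟨smul_mem_closure_glOrbit hν hc, h1⟩, pinching_smul hc ν⟩
    · rintro _ ⟨ν, hν, rfl⟩
      exact ⟨ν, ⟨hν.1, not_mem_flatBrackets (hs ν hν.1 (hKne ν hν))⟩, rfl⟩
  have hScomp : IsCompact (pinchingValues (closure (glOrbit μ))) := by
    rw [hS]
    exact hK.image_of_continuousOn fun ν hν =>
      (continuousAt_pinching (hs ν hν.1 (hKne ν hν))).continuousWithinAt
  have hcl : pinchingValues (closure (glOrbit μ)) = closure (pinchingValues (glOrbit μ)) := by
    refine subset_antisymm ?_ (closure_minimal ?_ hScomp.isClosed)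
    · rintro _ ⟨ν, ⟨hν, hνf⟩, rfl⟩
      rw [hT]
      exact mem_closure_image (continuousAt_pinching (hs ν hν (hne ν hνf))) hν
    · exact Set.image_mono (Set.sdiff_subset_sdiff_left subset_closure)
  have hTne : (pinchingValues (glOrbit μ)).Nonempty := by
    rw [hT]
    exact ⟨_, μ, self_mem_glOrbit μ, rfl⟩
  have hconn : IsConnected (pinchingValues (closure (glOrbit μ))) := by
    rw [hcl]
    refine IsConnected.closure ⟨hTne, ?_⟩
    rw [hT]
    exact isPreconnected_pinching_glOrbit fun ν hν => hs ν (subset_closure hν) (horbit ν hν)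
  have hbelow : BddBelow (pinchingValues (glOrbit μ)) :=
    ⟨0, by rintro _ ⟨ν, -, rfl⟩; exact pinching_nonneg ν⟩
  have habove : BddAbove (pinchingValues (glOrbit μ)) :=
    ⟨Module.finrank ℝ V, by rintro _ ⟨ν, -, rfl⟩; exact pinching_le ν⟩
  have hinf : sInf (pinchingValues (closure (glOrbit μ))) = pinchingInf μ := by
    rw [hcl]
    refine le_antisymm (csInf_le_csInf hbelow.closure hTne subset_closure) (le_csInf hTne.closure ?_)
    exact fun x hx => closure_minimal (fun y hy => csInf_le hbelow hy) isClosed_Ici hx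
  have hsup : sSup (pinchingValues (closure (glOrbit μ))) = pinchingSup μ := by
    rw [hcl]
    refine le_antisymm (csSup_le hTne.closure ?_) (csSup_le_csSup habove.closure hTne subset_closure)
    exact fun x hx => closure_minimal (fun y hy => le_csSup habove hy) isClosed_Iic hx
  refine ⟨?_, ?_⟩
  · rw [← hinf]
    obtain ⟨ν, ⟨hν, hνf⟩, h1⟩ := hScomp.sInf_mem hconn.nonempty
    rw [← h1]
    exact pinching_pos (hs ν hν (hne ν hνf))
  · rw [← hinf, ← hsup]
    exact eq_Icc_of_connected_compact hconn hScomp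

end RicciPinching

/-! ### Almost abelian brackets and stretched skew operators -/

namespace RicciPinching

open Filter Topology

section

variable {V : Type*} [NormedAddCommGroup V] [InnerProductSpace ℝ V]

/-- The bracket of the almost abelian Lie algebra in which `X` acts as `D`. -/
noncomputable def almostAbelian (X : V) (D : V →L[ℝ] V) : V →L[ℝ] V →L[ℝ] V :=
  (innerSL ℝ X).smulRight D - ((innerSL ℝ X).smulRight D).flip

theorem almostAbelian_apply (X : V) (D : V →L[ℝ] V) (v w : V) :
    almostAbelian X D v w = (inner ℝ X v : ℝ) • D w - (inner ℝ X w : ℝ) • D v := by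
  simp [almostAbelian]

/-- `D` vanishes on `X` and has values in the orthogonal complement of `X`. -/
structure IsTransverse (X : V) (D : V →L[ℝ] V) : Prop where
  apply_eq_zero : D X = 0
  inner_eq_zero : ∀ v, inner ℝ X (D v) = 0

theorem IsTransverse.isLieBracket {X : V} {D : V →L[ℝ] V} (h : IsTransverse X D) :
    IsLieBracket (almostAbelian X D) := by
  refine ⟨fun x => by rw [almostAbelian_apply, sub_self], fun x y z => ?_⟩
  simp only [almostAbelian_apply, map_sub, map_smul, sub_apply, smul_apply, h.inner_eq_zero]
  module

theorem IsTransverse.mem_solvableBrackets {X : V} {D : V →L[ℝ] V} (h : IsTransverse X D) :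
    almostAbelian X D ∈ solvableBrackets V := by
  refine mem_solvableBrackets_of_metabelian h.isLieBracket fun x y z w => ?_
  simp [almostAbelian_apply, inner_sub_right, inner_smul_right, h.inner_eq_zero]

/-- The conjugate of a skew-symmetric operator `E` by the operator which scales `y` by `s`. -/
noncomputable def stretch (E : V →L[ℝ] V) (y : V) (s : ℝ) : V →L[ℝ] V :=
  E + (s⁻¹ - 1) • (innerSL ℝ y).smulRight (E y) + (1 - s) • (innerSL ℝ (E y)).smulRight y

theorem stretch_apply (E : V →L[ℝ] V) (y : V) (s : ℝ) (v : V) :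
    stretch E y s v = E v + ((s⁻¹ - 1) * inner ℝ y v) • E y + ((1 - s) * inner ℝ (E y) v) • y := by
  simp [stretch, smul_smul]

theorem scaling_leftInverse {y : V} (hy : ‖y‖ = 1) {a b : ℝ} (hab : a * b = 1) (v : V) :
    (v + ((b - 1) * inner ℝ y v) • y) +
      ((a - 1) * inner ℝ y (v + ((b - 1) * inner ℝ y v) • y)) • y = v := by
  rw [inner_add_right, real_inner_smul_right, real_inner_self_eq_norm_sq, hy]
  have : (b - 1) * inner ℝ y v + (a - 1) * (inner ℝ y v + (b - 1) * inner ℝ y v * 1 ^ 2) = 0 := by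
    linear_combination inner ℝ y v * hab
  rw [add_assoc, ← add_smul, this, zero_smul, add_zero]

/-- The operator which scales the unit vector `y` by `s`. -/
noncomputable def scaling {y : V} (hy : ‖y‖ = 1) {s : ℝ} (hs : s ≠ 0) : V ≃L[ℝ] V :=
  ContinuousLinearEquiv.equivOfInverse
    (ContinuousLinearMap.id ℝ V + (s - 1) • (innerSL ℝ y).smulRight y)
    (ContinuousLinearMap.id ℝ V + (s⁻¹ - 1) • (innerSL ℝ y).smulRight y)
    (fun v => by simpa [smul_smul] using scaling_leftInverse hy (inv_mul_cancel₀ hs) v)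
    (fun v => by simpa [smul_smul] using scaling_leftInverse hy (mul_inv_cancel₀ hs) v)

theorem scaling_apply {y : V} (hy : ‖y‖ = 1) {s : ℝ} (hs : s ≠ 0) (v : V) :
    scaling hy hs v = v + ((s - 1) * inner ℝ y v) • y := by
  simp [scaling, smul_smul]

theorem scaling_symm_apply {y : V} (hy : ‖y‖ = 1) {s : ℝ} (hs : s ≠ 0) (v : V) :
    (scaling hy hs).symm v = v + ((s⁻¹ - 1) * inner ℝ y v) • y := by
  simp [scaling, smul_smul]

variable {X y : V} {E : V →L[ℝ] V}

theorem inner_self_apply_of_skew (hE : ∀ v w, inner ℝ (E v) w = - inner ℝ (E w) v) (v : V) : inner ℝ v (E v) = 0 := by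
  have := hE v v
  rw [real_inner_comm]
  linarith

theorem isTransverse_of_skew (hE : ∀ v w, inner ℝ (E v) w = - inner ℝ (E w) v)
    (hEX : E X = 0) : IsTransverse X E :=
  ⟨hEX, fun v => by rw [real_inner_comm, hE, hEX, inner_zero_left, neg_zero]⟩

theorem isTransverse_stretch (hE : ∀ v w, inner ℝ (E v) w = - inner ℝ (E w) v)
    (hEX : E X = 0) (hXy : inner ℝ X y = 0) (s : ℝ) : IsTransverse X (stretch E y s) := by
  have h := isTransverse_of_skew hE hEX
  refine ⟨?_, fun v => ?_⟩
  · rw [stretch_apply, hEX, real_inner_comm, hXy, hE, hEX]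
    simp
  · rw [stretch_apply, inner_add_right, inner_add_right, h.inner_eq_zero, inner_smul_right,
      inner_smul_right, h.inner_eq_zero, hXy]
    simp

theorem glAct_scaling_almostAbelian (hE : ∀ v w, inner ℝ (E v) w = - inner ℝ (E w) v)
    (hy : ‖y‖ = 1) (hXy : inner ℝ X y = 0) {s : ℝ} (hs : s ≠ 0) :
    glAct (scaling hy hs) (almostAbelian X E) = almostAbelian X (stretch E y s) := by
  have h0 := inner_self_apply_of_skew hE y
  have h1 : ∀ v, inner ℝ X ((scaling hy hs).symm v) = inner ℝ X v := fun v => by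
    rw [scaling_symm_apply, inner_add_right, inner_smul_right, hXy, mul_zero, add_zero]
  have h2 : ∀ v, scaling hy hs (E ((scaling hy hs).symm v)) = stretch E y s v := fun v => by
    have e : inner ℝ y (E v) = - inner ℝ (E y) v := by rw [real_inner_comm, hE]
    rw [scaling_apply, scaling_symm_apply, stretch_apply, map_add, map_smul, inner_add_right,
      inner_smul_right, h0, e]
    module
  ext v w
  rw [glAct_apply, almostAbelian_apply, almostAbelian_apply, map_sub, map_smul, map_smul, h1, h1,
    h2, h2]

variable {ι : Type*} [Fintype ι] (b : OrthonormalBasis ι ℝ V)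

theorem sum_inner_smul_apply {W : Type*} [AddCommGroup W] [Module ℝ W] (D : V →ₗ[ℝ] W) (x : V) :
    ∑ i, (inner ℝ x (b i) : ℝ) • D (b i) = D x := by
  nth_rewrite 2 [← b.sum_repr' x]
  simp [real_inner_comm]

theorem sum_inner_mul_inner_apply (D : V →L[ℝ] V) (x y : V) :
    ∑ i, inner ℝ x (b i) * inner ℝ (D (b i)) y = inner ℝ (D x) y := by
  have := congrArg (fun v => inner ℝ v y) (sum_inner_smul_apply b (D : V →ₗ[ℝ] V) x)
  simpa [sum_inner, real_inner_smul_left] using this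

theorem sum_inner_sq (x : V) : ∑ i, inner ℝ x (b i) ^ 2 = ‖x‖ ^ 2 := by
  rw [← b.sum_sq_norm_inner_left x]
  simp

end

variable {V : Type*} [NormedAddCommGroup V] [InnerProductSpace ℝ V] [FiniteDimensional ℝ V]

theorem continuous_almostAbelian :
    Continuous fun p : V × (V →L[ℝ] V) => almostAbelian p.1 p.2 := by
  refine continuous_bracket_iff.2 fun v w => ?_
  simp only [almostAbelian_apply]
  fun_prop

section

variable {ι : Type*} [Fintype ι] (b : OrthonormalBasis ι ℝ V)

variable {X : V} {D : V →L[ℝ] V}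

theorem meanCurvature_almostAbelian (h : IsTransverse X D) :
    meanCurvature b (almostAbelian X D) = LinearMap.trace ℝ V (D : V →ₗ[ℝ] V) • X := by
  refine ext_inner_right ℝ fun z => ?_
  rw [inner_meanCurvature b h.isLieBracket, real_inner_smul_left,
    LinearMap.trace_eq_sum_inner _ b, Finset.sum_mul]
  have h1 : ∑ i, inner ℝ X (b i) * inner ℝ (D z) (b i) = 0 := by
    have := b.sum_inner_mul_inner X (D z)
    rw [h.inner_eq_zero] at this
    rw [← this]
    exact Finset.sum_congr rfl fun i _ => by rw [real_inner_comm (b i) (D z)]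
  simp only [almostAbelian_apply, inner_sub_left, real_inner_smul_left]
  rw [Finset.sum_sub_distrib, h1, sub_zero]
  exact Finset.sum_congr rfl fun i _ => by
    rw [ContinuousLinearMap.coe_coe, real_inner_comm (D (b i))]; ring

/-- The first term is minus the squared norm of the symmetric part of `D`, so that the value is
quadratic in the deviation of `D` from skewness. -/
theorem scalarCurvature_almostAbelian (hX : ‖X‖ = 1) (h : IsTransverse X D) :
    scalarCurvature (almostAbelian X D) = - (1 / 2) * (∑ i, ‖D (b i)‖ ^ 2 + traceSq D)
      - (LinearMap.trace ℝ V (D : V →ₗ[ℝ] V)) ^ 2 := by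
  have hXs := sum_inner_sq b X
  rw [hX, one_pow] at hXs
  have h1 : ∑ k, ∑ i, ∑ j, inner ℝ (almostAbelian X D (b k) (b i)) (b j) ^ 2 =
      2 * ∑ i, ‖D (b i)‖ ^ 2 := by
    have e1 : ∀ k i, ∑ j, inner ℝ (almostAbelian X D (b k) (b i)) (b j) ^ 2 =
        inner ℝ X (b k) ^ 2 * ‖D (b i)‖ ^ 2 + inner ℝ X (b i) ^ 2 * ‖D (b k)‖ ^ 2 -
        2 * inner ℝ X (b k) * (inner ℝ X (b i) * inner ℝ (D (b i)) (D (b k))) := by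
      intro k i
      rw [sum_inner_sq, almostAbelian_apply, ← real_inner_self_eq_norm_sq,
        ← real_inner_self_eq_norm_sq, ← real_inner_self_eq_norm_sq, inner_sub_left,
        inner_sub_right, inner_sub_right]
      simp only [real_inner_smul_left, real_inner_smul_right]
      rw [real_inner_comm (D (b i)) (D (b k))]
      ring
    have e2 : ∀ k, ∑ i, ∑ j, inner ℝ (almostAbelian X D (b k) (b i)) (b j) ^ 2 =
        inner ℝ X (b k) ^ 2 * (∑ i, ‖D (b i)‖ ^ 2) + ‖D (b k)‖ ^ 2 := by
      intro k
      simp only [e1]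
      rw [Finset.sum_sub_distrib, Finset.sum_add_distrib, ← Finset.mul_sum, ← Finset.sum_mul,
        ← Finset.mul_sum, hXs, sum_inner_mul_inner_apply, h.apply_eq_zero, inner_zero_left]
      ring
    simp only [e2]
    rw [Finset.sum_add_distrib, ← Finset.sum_mul, hXs]
    ring
  have h2 : ∑ k, ∑ i, ∑ j, inner ℝ (almostAbelian X D (b k) (b i)) (b j) *
      inner ℝ (almostAbelian X D (b k) (b j)) (b i) = traceSq D := by
    have e1 : ∀ k, ∑ i, ∑ j, inner ℝ (almostAbelian X D (b k) (b i)) (b j) *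
        inner ℝ (almostAbelian X D (b k) (b j)) (b i) = inner ℝ X (b k) ^ 2 * traceSq D := by
      intro k
      have e2 := trace_mul_self_eq_sum b (almostAbelian X D (b k) : V →ₗ[ℝ] V)
      simp only [ContinuousLinearMap.coe_coe] at e2
      rw [← e2, LinearMap.trace_eq_sum_inner _ b, traceSq, LinearMap.trace_eq_sum_inner _ b,
        Finset.mul_sum]
      have e3 : ∀ i, inner ℝ (b i) (((almostAbelian X D (b k) : V →ₗ[ℝ] V) *
          (almostAbelian X D (b k) : V →ₗ[ℝ] V)) (b i)) =
          inner ℝ X (b k) ^ 2 * inner ℝ (b i) (((D : V →ₗ[ℝ] V) * (D : V →ₗ[ℝ] V)) (b i)) -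
          inner ℝ X (b k) * (inner ℝ X (b i) * inner ℝ (b i) (D (D (b k)))) := by
        intro i
        simp only [Module.End.mul_apply, ContinuousLinearMap.coe_coe, almostAbelian_apply,
          map_sub, map_smul, inner_sub_right, real_inner_smul_right, h.inner_eq_zero]
        ring
      simp only [e3]
      rw [Finset.sum_sub_distrib, ← Finset.mul_sum (f := fun i => inner ℝ X (b i) *
        inner ℝ (b i) (D (D (b k)))), b.sum_inner_mul_inner, h.inner_eq_zero, mul_zero, sub_zero]
    simp only [e1]
    rw [← Finset.sum_mul, hXs, one_mul]
  rw [scalarCurvature_eq b h.isLieBracket, meanCurvature_almostAbelian b h, norm_smul, hX, mul_one,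
    Real.norm_eq_abs, sq_abs, h1]
  have h3 : ∑ k, ∑ i, ∑ j, (inner ℝ (almostAbelian X D (b k) (b i)) (b j) +
      inner ℝ (almostAbelian X D (b k) (b j)) (b i)) ^ 2 =
      2 * (2 * ∑ i, ‖D (b i)‖ ^ 2) + 2 * traceSq D := by
    rw [← h1, ← h2]
    simp only [Finset.mul_sum, ← Finset.sum_add_distrib]
    refine Finset.sum_congr rfl fun k _ => ?_
    refine sum_sum_eq_of_symm fun i j => ?_
    ring
  rw [h3]
  ring

theorem inner_ricci_almostAbelian (hX : ‖X‖ = 1) (h : IsTransverse X D)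
    (ht : LinearMap.trace ℝ V (D : V →ₗ[ℝ] V) = 0) {y : V} (hy : inner ℝ X y = 0) :
    inner ℝ (ricci (almostAbelian X D) y) y =
      (1 / 2) * (∑ i, inner ℝ (D (b i)) y ^ 2 - ‖D y‖ ^ 2) := by
  have hXs := sum_inner_sq b X
  rw [hX, one_pow] at hXs
  rw [inner_ricci_self b h.isLieBracket, meanCurvature_almostAbelian b h, ht, zero_smul, map_zero,
    zero_apply, inner_zero_left, sub_zero]
  have h1 : ∑ i, inner ℝ X (b i) * inner ℝ (D y) (b i) = 0 := by
    have := b.sum_inner_mul_inner X (D y)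
    rw [h.inner_eq_zero] at this
    rw [← this]
    exact Finset.sum_congr rfl fun i _ => by rw [real_inner_comm (b i) (D y)]
  have h2 : ∑ i, ∑ j, (inner ℝ (almostAbelian X D y (b i)) (b j) +
      inner ℝ (almostAbelian X D y (b j)) (b i)) ^ 2 = 2 * ‖D y‖ ^ 2 := by
    have e1 : ∀ i, ∑ j, (inner ℝ (almostAbelian X D y (b i)) (b j) +
        inner ℝ (almostAbelian X D y (b j)) (b i)) ^ 2 =
        inner ℝ X (b i) ^ 2 * ‖D y‖ ^ 2 + inner ℝ (D y) (b i) ^ 2 := by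
      intro i
      have e2 : ∀ j, (inner ℝ (almostAbelian X D y (b i)) (b j) +
        inner ℝ (almostAbelian X D y (b j)) (b i)) ^ 2 =
        inner ℝ X (b i) ^ 2 * inner ℝ (D y) (b j) ^ 2 +
        inner ℝ X (b j) ^ 2 * inner ℝ (D y) (b i) ^ 2 +
        2 * inner ℝ X (b i) * inner ℝ (D y) (b i) * (inner ℝ X (b j) * inner ℝ (D y) (b j)) := by
        intro j
        simp only [almostAbelian_apply, hy, zero_smul, zero_sub, inner_neg_left,
          real_inner_smul_left]
        ring
      simp only [e2]
      rw [Finset.sum_add_distrib, Finset.sum_add_distrib, ← Finset.mul_sum, ← Finset.sum_mul,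
        ← Finset.mul_sum, h1, hXs, sum_inner_sq]
      ring
    simp only [e1]
    rw [Finset.sum_add_distrib, ← Finset.sum_mul, hXs, sum_inner_sq]
    ring
  have h3 : ∑ i, ∑ j, inner ℝ (almostAbelian X D (b i) (b j)) y ^ 2 =
      2 * ∑ i, inner ℝ (D (b i)) y ^ 2 := by
    have e1 : ∀ i, ∑ j, inner ℝ (almostAbelian X D (b i) (b j)) y ^ 2 =
        inner ℝ X (b i) ^ 2 * (∑ j, inner ℝ (D (b j)) y ^ 2) + inner ℝ (D (b i)) y ^ 2 := by
      intro i
      have e2 : ∀ j, inner ℝ (almostAbelian X D (b i) (b j)) y ^ 2 =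
        inner ℝ X (b i) ^ 2 * inner ℝ (D (b j)) y ^ 2 +
        inner ℝ X (b j) ^ 2 * inner ℝ (D (b i)) y ^ 2 -
        2 * inner ℝ X (b i) * inner ℝ (D (b i)) y * (inner ℝ X (b j) * inner ℝ (D (b j)) y) := by
        intro j
        simp only [almostAbelian_apply, inner_sub_left, real_inner_smul_left]
        ring
      simp only [e2]
      rw [Finset.sum_sub_distrib, Finset.sum_add_distrib, ← Finset.mul_sum, ← Finset.sum_mul,
        ← Finset.mul_sum, hXs, sum_inner_mul_inner_apply, h.apply_eq_zero, inner_zero_left]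
      ring
    simp only [e1]
    rw [Finset.sum_add_distrib, ← Finset.sum_mul, hXs]
    ring
  rw [h2, h3]
  ring

end

section

variable {X y : V} {E : V →L[ℝ] V}

theorem trace_eq_zero_of_skew (hE : ∀ v w, inner ℝ (E v) w = - inner ℝ (E w) v) :
    LinearMap.trace ℝ V (E : V →ₗ[ℝ] V) = 0 := by
  rw [LinearMap.trace_eq_sum_inner _ (stdOrthonormalBasis ℝ V)]
  exact Finset.sum_eq_zero fun i _ => inner_self_apply_of_skew hE _

/-- `stretch E y s` is conjugate to `E`, so the trace and the trace of the square are unchanged.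
Only the norms must be computed from the explicit formula. -/
theorem stretch_invariants {ι : Type*} [Fintype ι] (b : OrthonormalBasis ι ℝ V)
    (hE : ∀ v w, inner ℝ (E v) w = - inner ℝ (E w) v)
    (hy : ‖y‖ = 1) {s : ℝ} (hs : s ≠ 0) :
    LinearMap.trace ℝ V (stretch E y s : V →ₗ[ℝ] V) = 0 ∧
    ∑ i, ‖stretch E y s (b i)‖ ^ 2 + traceSq (stretch E y s) = (s - s⁻¹) ^ 2 * ‖E y‖ ^ 2 ∧
    ‖stretch E y s y‖ ^ 2 = s⁻¹ ^ 2 * ‖E y‖ ^ 2 ∧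
    ∑ i, inner ℝ (stretch E y s (b i)) y ^ 2 = s ^ 2 * ‖E y‖ ^ 2 := by
  have h0 := inner_self_apply_of_skew hE y
  have hconj : (stretch E y s : V →ₗ[ℝ] V) =
      (scaling hy hs).toLinearEquiv.conj (E : V →ₗ[ℝ] V) := by
    ext v
    have e : inner ℝ y (E v) = - inner ℝ (E y) v := by rw [real_inner_comm, hE]
    change stretch E y s v = scaling hy hs (E ((scaling hy hs).symm v))
    rw [scaling_apply, scaling_symm_apply, stretch_apply, map_add, map_smul, inner_add_right,
      inner_smul_right, h0, e]
    module
  have hyE : ∀ v, inner ℝ (E v) y = - inner ℝ (E y) v := fun v => hE v y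
  refine ⟨?_, ?_, ?_, ?_⟩
  · rw [hconj, LinearMap.trace_conj', trace_eq_zero_of_skew hE]
  · have h1 : traceSq (stretch E y s) = - ∑ i, ‖E (b i)‖ ^ 2 := by
      rw [← traceSq_of_skew b hE, traceSq, hconj, traceSq, Module.End.mul_eq_comp,
        ← LinearEquiv.conj_comp, LinearMap.trace_conj']
      rfl
    rw [h1, ← sub_eq_add_neg, ← Finset.sum_sub_distrib]
    have h2 : ∀ i, ‖stretch E y s (b i)‖ ^ 2 - ‖E (b i)‖ ^ 2 =
        ((s⁻¹ - 1) ^ 2 * ‖E y‖ ^ 2) * inner ℝ y (b i) ^ 2 + (1 - s) ^ 2 * inner ℝ (E y) (b i) ^ 2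
        + 2 * (s⁻¹ - 1) * (inner ℝ y (b i) * inner ℝ (E (b i)) (E y))
        - 2 * (1 - s) * inner ℝ (E y) (b i) ^ 2 := by
      intro i
      rw [stretch_apply, ← real_inner_self_eq_norm_sq]
      simp only [inner_add_left, inner_add_right, real_inner_smul_left, real_inner_smul_right]
      rw [real_inner_comm (E (b i)) (E y), real_inner_comm y (E y), h0,
        real_inner_comm (E (b i)) y, hyE]
      simp only [real_inner_self_eq_norm_sq, hy]
      ring
    simp only [h2]
    rw [Finset.sum_sub_distrib, Finset.sum_add_distrib, Finset.sum_add_distrib, ← Finset.mul_sum,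
      ← Finset.mul_sum, ← Finset.mul_sum, ← Finset.mul_sum, sum_inner_sq, sum_inner_sq,
      sum_inner_mul_inner_apply, hy, real_inner_self_eq_norm_sq]
    field_simp
    ring
  · rw [stretch_apply, real_inner_self_eq_norm_sq, hy, real_inner_comm, h0]
    have : E y + ((s⁻¹ - 1) * 1 ^ 2) • E y + ((1 - s) * 0) • y = s⁻¹ • E y := by module
    rw [this, norm_smul, mul_pow, Real.norm_eq_abs, sq_abs]
  · have h1 : ∀ i, inner ℝ (stretch E y s (b i)) y ^ 2 = s ^ 2 * inner ℝ (E y) (b i) ^ 2 := by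
      intro i
      rw [stretch_apply, inner_add_left, inner_add_left, real_inner_smul_left, real_inner_smul_left,
        real_inner_self_eq_norm_sq, hy, hyE, real_inner_comm y, h0]
      ring
    simp only [h1]
    rw [← Finset.mul_sum, sum_inner_sq]

/-- The scalar curvature is $-\frac12(s-s^{-1})^2|Ey|^2$, of second order at $s=1$, while the Ricci
curvature at $y$ is $\frac12(s^2-s^{-2})|Ey|^2$, of first order. The bound therefore tends to zero
as $s\to1$. -/
theorem pinching_stretch (hE : ∀ v w, inner ℝ (E v) w = - inner ℝ (E w) v)
    (hX : ‖X‖ = 1) (hEX : E X = 0) (hy : ‖y‖ = 1) (hXy : inner ℝ X y = 0) {s : ℝ} (hs : 1 < s) (hEy : E y ≠ 0) :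
    scalarCurvature (almostAbelian X (stretch E y s)) ≠ 0 ∧
    pinching (almostAbelian X (stretch E y s)) ≤ (s - s⁻¹) ^ 2 / (s + s⁻¹) ^ 2 := by
  have hs0 : 0 < s := by linarith
  have hsi : s⁻¹ < 1 := inv_lt_one_of_one_lt₀ hs
  have hsi0 : 0 < s⁻¹ := inv_pos.2 hs0
  obtain ⟨h1, h2, h3, h4⟩ := stretch_invariants (stdOrthonormalBasis ℝ V) hE hy hs0.ne'
  have hT := isTransverse_stretch hE hEX hXy s
  have hscal := scalarCurvature_almostAbelian (stdOrthonormalBasis ℝ V) hX hT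
  have hric := inner_ricci_almostAbelian (stdOrthonormalBasis ℝ V) hX hT h1 hXy
  rw [h1, h2] at hscal
  rw [h3, h4] at hric
  have hle := inner_ricci_sq_le (almostAbelian X (stretch E y s)) hy
  have hu : 0 < ‖E y‖ ^ 2 := by positivity
  set u := ‖E y‖ ^ 2 with hu'
  have hd : 0 < s - s⁻¹ := by linarith
  have hp : 0 < s + s⁻¹ := by linarith
  refine ⟨?_, ?_⟩
  · rw [hscal]
    have : 0 < (s - s⁻¹) ^ 2 * u := by positivity
    intro h
    linarith
  · have e1 : scalarCurvature (almostAbelian X (stretch E y s)) ^ 2 =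
        (1 / 4) * (s - s⁻¹) ^ 4 * u ^ 2 := by rw [hscal]; ring
    have e2 : inner ℝ (ricci (almostAbelian X (stretch E y s)) y) y ^ 2 =
        (1 / 4) * (s - s⁻¹) ^ 2 * (s + s⁻¹) ^ 2 * u ^ 2 := by rw [hric]; ring
    rw [e2] at hle
    have hpos : 0 < (1 / 4) * (s - s⁻¹) ^ 2 * (s + s⁻¹) ^ 2 * u ^ 2 := by positivity
    rw [pinching, e1]
    refine (div_le_div_of_nonneg_left (by positivity) hpos hle).trans (le_of_eq ?_)
    field_simp

end

theorem exists_stretch_factor {ε : ℝ} (hε : 0 < ε) :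
    ∃ s : ℝ, 1 < s ∧ (s - s⁻¹) ^ 2 / (s + s⁻¹) ^ 2 < ε := by
  have h1 : ContinuousAt (fun s : ℝ => (s - s⁻¹) ^ 2 / (s + s⁻¹) ^ 2) 1 := by
    have : ContinuousAt (fun s : ℝ => s⁻¹) 1 := continuousAt_inv₀ one_ne_zero
    exact ((continuousAt_id.sub this).pow 2).div ((continuousAt_id.add this).pow 2) (by norm_num)
  have h2 : ∀ᶠ s : ℝ in 𝓝 1, (s - s⁻¹) ^ 2 / (s + s⁻¹) ^ 2 < ε :=
    h1.eventually_lt continuousAt_const (by simpa using hε)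
  have h3 : ∀ᶠ s : ℝ in 𝓝[>] 1, (s - s⁻¹) ^ 2 / (s + s⁻¹) ^ 2 < ε := nhdsWithin_le_nhds h2
  obtain ⟨s, hs, hs1⟩ := (h3.and self_mem_nhdsWithin).exists
  exact ⟨s, hs1, hs⟩

end RicciPinching

/-! ### All values in $(0,n]$ occur for real type -/

namespace RicciPinching

open Filter Topology

variable {V : Type*} [NormedAddCommGroup V] [InnerProductSpace ℝ V]

theorem almostAbelian_ne_zero {X z : V} {D : V →L[ℝ] V} (hX : ‖X‖ = 1)
    (hXz : inner ℝ X z = 0) (hDz : D z ≠ 0) : almostAbelian X D ≠ 0 := by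
  intro h
  have h1 : almostAbelian X D X z = 0 := by rw [h]; rfl
  rw [almostAbelian_apply, hXz, real_inner_self_eq_norm_sq, hX, one_pow, one_smul, zero_smul,
    sub_zero] at h1
  exact hDz h1

/-- The orthogonal projection with kernel spanned by the unit vector `X`. -/
noncomputable def projPerp (X : V) : V →L[ℝ] V :=
  ContinuousLinearMap.id ℝ V - (innerSL ℝ X).smulRight X

theorem projPerp_apply (X v : V) : projPerp X v = v - (inner ℝ X v : ℝ) • X := by
  simp [projPerp]

theorem inner_projPerp {X : V} (hX : ‖X‖ = 1) (v : V) : inner ℝ X (projPerp X v) = 0 := by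
  rw [projPerp_apply, inner_sub_right, real_inner_smul_right, real_inner_self_eq_norm_sq, hX]
  ring

theorem isTransverse_projPerp {X : V} (hX : ‖X‖ = 1) : IsTransverse X (projPerp X) :=
  ⟨by rw [projPerp_apply, real_inner_self_eq_norm_sq, hX]; simp, inner_projPerp hX⟩

/-- The operators transverse to `X` for which `z` is an eigenvector with positive eigenvalue. -/
def expandingOps (X z : V) : Set (V →L[ℝ] V) :=
  {D | IsTransverse X D ∧ ∃ c : ℝ, 0 < c ∧ D z = c • z}

theorem convex_expandingOps (X z : V) : Convex ℝ (expandingOps X z) := by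
  rintro D ⟨hD, c, hc, hDz⟩ D' ⟨hD', c', hc', hDz'⟩ a b ha hb hab
  refine ⟨⟨?_, fun v => ?_⟩, a * c + b * c', ?_, ?_⟩
  · simp [hD.apply_eq_zero, hD'.apply_eq_zero]
  · simp [inner_add_right, inner_smul_right, hD.inner_eq_zero, hD'.inner_eq_zero]
  · rcases ha.eq_or_lt with rfl | ha
    · rw [zero_add] at hab
      rw [hab]
      linarith
    · have := mul_pos ha hc
      have := mul_nonneg hb hc'.le
      linarith
  · simp [hDz, hDz', add_smul, mul_smul]

/-! ### Real type almost abelian brackets -/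

/-- If $x\perp X$, then $\mathrm{ad}\,x$ has square zero, because `D` takes values in $X^\perp$.
Otherwise `z` is an eigenvector with the nonzero real eigenvalue $\langle X,x\rangle c$. -/
theorem IsTransverse.mem_realType {X z : V} {D : V →L[ℝ] V} (h : IsTransverse X D)
    (hXz : inner ℝ X z = 0) (hz : z ≠ 0) {c : ℝ} (hc : c ≠ 0) (hDz : D z = c • z) :
    almostAbelian X D ∈ realType V := by
  refine ⟨h.mem_solvableBrackets, fun x => ?_⟩
  by_cases hx : inner ℝ X x = 0
  · left
    refine ⟨2, ?_⟩
    have e : ∀ v, almostAbelian X D x v = -((inner ℝ X v : ℝ) • D x) := fun v => by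
      rw [almostAbelian_apply, hx, zero_smul, zero_sub]
    ext v
    rw [pow_two, mul_apply_eq_comp, e, e, inner_neg_right,
      inner_smul_right, h.inner_eq_zero]
    simp
  · right
    intro hs
    have h1 : ((inner ℝ X x * c : ℝ) : ℂ) ∈ complexSpectrum (almostAbelian X D x) := by
      refine mem_spectrum_of_apply_eq_smul (v := (1 : ℂ) ⊗ₜ[ℝ] z) (fun h0 => hz ?_) ?_
      · simpa using congrArg tensorRe h0
      · rw [LinearMap.baseChange_tmul, ContinuousLinearMap.coe_coe, almostAbelian_apply, hXz, hDz,
          zero_smul, sub_zero, smul_smul, TensorProduct.tmul_smul]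
        rfl
    have h2 : inner ℝ X x * c = 0 := by simpa using hs h1
    exact (mul_ne_zero hx hc) h2

theorem almostAbelian_mem_of_mem_expandingOps {X z : V} (hX : ‖X‖ = 1) (hXz : inner ℝ X z = 0)
    (hz : z ≠ 0) {D : V →L[ℝ] V} (hD : D ∈ expandingOps X z) :
    almostAbelian X D ∈ realType V ∧ almostAbelian X D ≠ 0 := by
  obtain ⟨hT, c, hc, hDz⟩ := hD
  refine ⟨hT.mem_realType hXz hz hc.ne' hDz, almostAbelian_ne_zero hX hXz (z := z) ?_⟩
  rw [hDz]
  exact smul_ne_zero hc.ne' hz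

variable [FiniteDimensional ℝ V]

theorem scalarCurvature_ne_zero_of_mem_realType {μ : V →L[ℝ] V →L[ℝ] V} (hμ : μ ∈ realType V)
    (h0 : μ ≠ 0) : scalarCurvature μ ≠ 0 :=
  scalarCurvature_ne_zero_of_mem_closure hμ (subset_closure (self_mem_glOrbit μ)) h0

/-- The metric of real hyperbolic space. -/
theorem ricci_almostAbelian_projPerp {X : V} (hX : ‖X‖ = 1) (v : V) :
    ricci (almostAbelian X (projPerp X)) v = (1 - Module.finrank ℝ V : ℝ) • v := by
  have hT := isTransverse_projPerp hX
  have hXX : inner ℝ X X = (1 : ℝ) := by rw [real_inner_self_eq_norm_sq, hX, one_pow]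
  have h0 : ∀ v w, almostAbelian X (projPerp X) v w =
      (inner ℝ X v : ℝ) • w - (inner ℝ X w : ℝ) • v := by
    intro v w
    rw [almostAbelian_apply, projPerp_apply, projPerp_apply]
    module
  have h1 : ∀ v w, leviCivita (almostAbelian X (projPerp X)) v w =
      (inner ℝ v w : ℝ) • X - (inner ℝ X w : ℝ) • v := by
    intro v w
    refine ext_inner_right ℝ fun z => ?_
    have h2 := inner_leviCivita hT.isLieBracket v w z
    simp only [h0, inner_sub_left, real_inner_smul_left] at h2 ⊢
    rw [real_inner_comm v w] at h2
    rw [real_inner_comm v z, real_inner_comm w z] at h2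
    linarith
  have h2 : ∀ v w, curvature (almostAbelian X (projPerp X)) v w w =
      (inner ℝ w v : ℝ) • w - (inner ℝ w w : ℝ) • v := by
    intro v w
    simp only [curvature, LinearMap.sub_apply, LinearMap.comp_apply, h0, h1, map_sub, map_smul,
      LinearMap.smul_apply, inner_sub_right, real_inner_smul_right, hXX]
    rw [real_inner_comm w v, real_inner_comm X v, real_inner_comm X w]
    module
  rw [ricci_apply (stdOrthonormalBasis ℝ V)]
  simp only [h2, Finset.sum_sub_distrib]
  rw [OrthonormalBasis.sum_repr']
  simp only [real_inner_self_eq_norm_sq, OrthonormalBasis.norm_eq_one]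
  simp [sub_smul, Nat.cast_smul_eq_nsmul]

theorem pinching_almostAbelian_projPerp {X : V} (hX : ‖X‖ = 1) (hn : 2 ≤ Module.finrank ℝ V) :
    pinching (almostAbelian X (projPerp X)) = Module.finrank ℝ V := by
  have hn' : (2 : ℝ) ≤ Module.finrank ℝ V := by exact_mod_cast hn
  have h1 : (1 - Module.finrank ℝ V : ℝ) ≠ 0 := by linarith
  have h2 : (Module.finrank ℝ V : ℝ) ≠ 0 := by linarith
  rw [pinching, scalarCurvature_eq_sum (stdOrthonormalBasis ℝ V),
    ricciNormSq_eq_sum (stdOrthonormalBasis ℝ V)]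
  simp only [ricci_almostAbelian_projPerp hX, real_inner_smul_right, norm_smul,
    real_inner_self_eq_norm_sq, OrthonormalBasis.norm_eq_one, one_pow, mul_one, Real.norm_eq_abs,
    sq_abs, Finset.sum_const, Finset.card_univ, Fintype.card_fin, nsmul_eq_mul]
  field_simp

/-- Four directions are used: `X`, a plane `y`, `u` carrying a stretched rotation, and `z` carrying
a real eigenvalue `δ` that makes the bracket of real type. As `δ` tends to zero, $F$ tends to its
small value for the stretched rotation alone. -/
theorem exists_pinching_lt (hn : 4 ≤ Module.finrank ℝ V) :
    ∃ X z : V, ‖X‖ = 1 ∧ z ≠ 0 ∧ inner ℝ X z = 0 ∧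
      ∀ ε : ℝ, 0 < ε → ∃ D ∈ expandingOps X z, pinching (almostAbelian X D) < ε := by
  set b := stdOrthonormalBasis ℝ V
  let i : Fin 4 → Fin (Module.finrank ℝ V) := Fin.castLE hn
  have hi : Function.Injective i := Fin.castLE_injective hn
  have ho : ∀ j k, j ≠ k → inner ℝ (b (i j)) (b (i k)) = 0 := fun j k hjk =>
    b.orthonormal.2 fun h => hjk (hi h)
  have h1 : ∀ j, ‖b j‖ = 1 := b.norm_eq_one
  set X := b (i 0)
  set y := b (i 1)
  set u := b (i 2)
  set z := b (i 3)
  have hXy : inner ℝ X y = 0 := ho 0 1 (by decide)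
  have hXu : inner ℝ X u = 0 := ho 0 2 (by decide)
  have hXz : inner ℝ X z = 0 := ho 0 3 (by decide)
  have hyX : inner ℝ y X = 0 := ho 1 0 (by decide)
  have hyu : inner ℝ y u = 0 := ho 1 2 (by decide)
  have hyz : inner ℝ y z = 0 := ho 1 3 (by decide)
  have huX : inner ℝ u X = 0 := ho 2 0 (by decide)
  have huy : inner ℝ u y = 0 := ho 2 1 (by decide)
  have huz : inner ℝ u z = 0 := ho 2 3 (by decide)
  have hzX : inner ℝ z X = 0 := ho 3 0 (by decide)
  have hX : ‖X‖ = 1 := h1 _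
  have hy : ‖y‖ = 1 := h1 _
  have hz : ‖z‖ = 1 := h1 _
  have hu : ‖u‖ = 1 := h1 _
  have hz0 : z ≠ 0 := fun h => by rw [h, norm_zero] at hz; exact zero_ne_one hz
  have hu0 : u ≠ 0 := fun h => by rw [h, norm_zero] at hu; exact zero_ne_one hu
  let E : V →L[ℝ] V := (innerSL ℝ y).smulRight u - (innerSL ℝ u).smulRight y
  have hEv : ∀ v, E v = (inner ℝ y v : ℝ) • u - (inner ℝ u v : ℝ) • y := fun v => by simp [E]
  have hE : ∀ v w, inner ℝ (E v) w = - inner ℝ (E w) v := by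
    intro v w
    simp only [hEv, inner_sub_left, real_inner_smul_left]
    ring
  have hEX : E X = 0 := by rw [hEv, hyX, huX]; simp
  have hEz : E z = 0 := by rw [hEv, hyz, huz]; simp
  have hEy : E y = u := by rw [hEv, huy, real_inner_self_eq_norm_sq, hy]; simp
  refine ⟨X, z, hX, hz0, hXz, fun ε hε => ?_⟩
  obtain ⟨s, hs, hsε⟩ := exists_stretch_factor hε
  obtain ⟨hs1, hs2⟩ := pinching_stretch hE hX hEX hy hXy hs (by rw [hEy]; exact hu0)
  have hT := isTransverse_stretch hE hEX hXy s
  have hSz : stretch E y s z = 0 := by rw [stretch_apply, hEz, hEy, hyz, huz]; simp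
  let D : ℝ → V →L[ℝ] V := fun δ => stretch E y s + δ • (innerSL ℝ z).smulRight z
  have hDv : ∀ δ v, D δ v = stretch E y s v + (δ * inner ℝ z v) • z := fun δ v => by
    simp [D, smul_smul]
  have hD : ∀ δ, 0 < δ → D δ ∈ expandingOps X z := by
    intro δ hδ
    refine ⟨⟨?_, fun v => ?_⟩, δ, hδ, ?_⟩
    · rw [hDv, hT.apply_eq_zero, hzX]; simp
    · rw [hDv, inner_add_right, hT.inner_eq_zero, real_inner_smul_right, hXz]; simp
    · rw [hDv, hSz, real_inner_self_eq_norm_sq, hz]; simp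
  have hcont : Tendsto (fun δ => pinching (almostAbelian X (D δ))) (𝓝[>] 0)
      (𝓝 (pinching (almostAbelian X (stretch E y s)))) := by
    have h2 : Continuous fun δ => almostAbelian X (D δ) :=
      continuous_almostAbelian.comp (f := fun δ => (X, D δ)) (by fun_prop)
    have h3 := h2.tendsto 0
    have h4 : D 0 = stretch E y s := by simp [D]
    rw [h4] at h3
    exact ((continuousAt_pinching hs1).tendsto.comp h3).mono_left nhdsWithin_le_nhds
  have hev := hcont.eventually_lt_const (hs2.trans_lt hsε)
  obtain ⟨δ, hδ, hδ0⟩ := (hev.and self_mem_nhdsWithin).exists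
  exact ⟨D δ, hD δ hδ0, hδ⟩

theorem bddBelow_pinchingValues (C : Set (V →L[ℝ] V →L[ℝ] V)) : BddBelow (pinchingValues C) :=
  ⟨0, by rintro _ ⟨ν, -, rfl⟩; exact pinching_nonneg ν⟩

theorem pinchingInf_nonneg (μ : V →L[ℝ] V →L[ℝ] V) : 0 ≤ pinchingInf μ :=
  Real.sInf_nonneg (by rintro _ ⟨ν, -, rfl⟩; exact pinching_nonneg ν)

/-- The intermediate value theorem is applied on the convex set `expandingOps X z`, between an
operator with small $F$ and the projection `projPerp X`, which gives hyperbolic space and the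
maximal value $n$. -/
theorem pinchingValues_realType (hn : 4 ≤ Module.finrank ℝ V) :
    pinchingValues (realType V) = Set.Ioc 0 (Module.finrank ℝ V : ℝ) := by
  refine subset_antisymm ?_ ?_
  · rintro _ ⟨μ, ⟨hμ, hf⟩, rfl⟩
    exact ⟨pinching_pos (scalarCurvature_ne_zero hμ.1 hf), pinching_le μ⟩
  · obtain ⟨X, z, hX, hz, hXz, hsmall⟩ := exists_pinching_lt hn
    have hmem := fun D (hD : D ∈ expandingOps X z) =>
      almostAbelian_mem_of_mem_expandingOps hX hXz hz hD
    have hs := fun D (hD : D ∈ expandingOps X z) =>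
      scalarCurvature_ne_zero_of_mem_realType (hmem D hD).1 (hmem D hD).2
    have hconn : IsPreconnected ((fun D => pinching (almostAbelian X D)) '' expandingOps X z) := by
      refine (convex_expandingOps X z).isPreconnected.image _ fun D hD => ?_
      have h2 : Continuous fun D => almostAbelian X D :=
        continuous_almostAbelian.comp (f := fun D => (X, D)) (by fun_prop)
      exact (ContinuousAt.comp (f := fun D => almostAbelian X D)
        (continuousAt_pinching (hs D hD)) h2.continuousAt).continuousWithinAt
    have hP : projPerp X ∈ expandingOps X z := by
      refine ⟨isTransverse_projPerp hX, 1, one_pos, ?_⟩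
      rw [projPerp_apply, hXz]
      simp
    rintro t ⟨ht0, htn⟩
    obtain ⟨D, hD, hDt⟩ := hsmall t ht0
    have h3 := hconn.ordConnected.out ⟨D, hD, rfl⟩ ⟨projPerp X, hP, rfl⟩
    have h4 : t ∈ Set.Icc (pinching (almostAbelian X D)) (pinching (almostAbelian X (projPerp X))) := by
      rw [pinching_almostAbelian_projPerp hX (by omega)]
      exact ⟨hDt.le, htn⟩
    obtain ⟨D', hD', rfl⟩ := h3 h4
    exact ⟨_, ⟨(hmem D' hD').1, not_mem_flatBrackets (hs D' hD')⟩, rfl⟩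

theorem isGLB_pinchingInf (hn : 4 ≤ Module.finrank ℝ V) :
    IsGLB {m : ℝ | ∃ μ ∈ realType V, μ ≠ 0 ∧ m = pinchingInf μ} 0 := by
  refine ⟨?_, fun m hm => le_of_forall_pos_lt_add fun ε hε => ?_⟩
  · rintro _ ⟨μ, -, -, rfl⟩
    exact pinchingInf_nonneg μ
  · obtain ⟨X, z, hX, hz, hXz, hsmall⟩ := exists_pinching_lt hn
    obtain ⟨D, hD, hDε⟩ := hsmall ε hε
    obtain ⟨h1, h2⟩ := almostAbelian_mem_of_mem_expandingOps hX hXz hz hD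
    have h3 : m ≤ pinchingInf (almostAbelian X D) := hm ⟨_, h1, h2, rfl⟩
    have h4 : pinchingInf (almostAbelian X D) ≤ pinching (almostAbelian X D) :=
      csInf_le (bddBelow_pinchingValues _) ⟨_, ⟨self_mem_glOrbit _, not_mem_flatBrackets
        (scalarCurvature_ne_zero_of_mem_realType h1 h2)⟩, rfl⟩
    linarith

end RicciPinching

/-! ### Degeneration to flat brackets outside real type -/

namespace RicciPinching

open Filter Topology

section

variable {V : Type*} [NormedAddCommGroup V] [InnerProductSpace ℝ V]

/-- The operator which fixes `X` and scales its orthogonal complement by `t`. -/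
noncomputable def perpOp (X : V) (t : ℝ) : V →L[ℝ] V :=
  (innerSL ℝ X).smulRight X + t • projPerp X

theorem perpOp_apply (X : V) (t : ℝ) (v : V) :
    perpOp X t v = (inner ℝ X v : ℝ) • X + t • projPerp X v := by
  simp [perpOp]

theorem perpOp_perpOp {X : V} (hX : ‖X‖ = 1) {a b : ℝ} (hab : a * b = 1) (v : V) :
    perpOp X a (perpOp X b v) = v := by
  have hXX : inner ℝ X X = (1 : ℝ) := by rw [real_inner_self_eq_norm_sq, hX, one_pow]
  have h1 : projPerp X (projPerp X v) = projPerp X v := by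
    rw [projPerp_apply X (projPerp X v), inner_projPerp hX, zero_smul, sub_zero]
  rw [perpOp_apply, perpOp_apply, inner_add_right, inner_smul_right, inner_smul_right, hXX,
    inner_projPerp hX, map_add, map_smul, map_smul, (isTransverse_projPerp hX).apply_eq_zero, h1,
    smul_zero, zero_add, smul_smul, hab, one_smul, projPerp_apply]
  module

/-- The invertible operator which fixes the unit vector `X` and scales its orthogonal complement. -/
noncomputable def perpEquiv {X : V} (hX : ‖X‖ = 1) {t : ℝ} (ht : t ≠ 0) : V ≃L[ℝ] V :=
  ContinuousLinearEquiv.equivOfInverse (perpOp X t⁻¹) (perpOp X t)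
    (perpOp_perpOp hX (mul_inv_cancel₀ ht)) (perpOp_perpOp hX (inv_mul_cancel₀ ht))

theorem closure_glOrbit_subset {μ ν : V →L[ℝ] V →L[ℝ] V} (hν : ν ∈ glOrbit μ) :
    closure (glOrbit ν) ⊆ closure (glOrbit μ) := by
  refine closure_mono ?_
  rintro _ ⟨h, rfl⟩
  exact glAct_mem_glOrbit h hν

end

variable {V : Type*} [NormedAddCommGroup V] [InnerProductSpace ℝ V] [FiniteDimensional ℝ V]

/-- The degeneration of a bracket to an almost abelian one. -/
theorem almostAbelian_mem_closure {ν : V →L[ℝ] V →L[ℝ] V} (hν : IsLieBracket ν) {X : V}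
    (hX : ‖X‖ = 1) :
    almostAbelian X ((projPerp X).comp (ν X)) ∈ closure (glOrbit ν) := by
  classical
  have hXX : inner ℝ X X = (1 : ℝ) := by rw [real_inner_self_eq_norm_sq, hX, one_pow]
  -- For `t ≠ 0`, `perpEquiv` multiplies $X^\perp$ by `t⁻¹`. As `t` tends to zero, the brackets
  -- within $X^\perp$ and the `X`-components die out; `hG` is a formula polynomial in `t` that also
  -- covers `t = 0`.
  let G : ℝ → V →L[ℝ] V →L[ℝ] V := fun t =>
    if ht : t ≠ 0 then glAct (perpEquiv hX ht) ν else almostAbelian X ((projPerp X).comp (ν X))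
  have hG : ∀ t v w, G t v w = perpOp X 0 (t • ((inner ℝ X v : ℝ) • ν X w - (inner ℝ X w : ℝ) • ν X v
      + t • ν (projPerp X v) (projPerp X w))) + projPerp X ((inner ℝ X v : ℝ) • ν X w
      - (inner ℝ X w : ℝ) • ν X v + t • ν (projPerp X v) (projPerp X w)) := by
    intro t v w
    by_cases ht : t ≠ 0
    · have h1 : ∀ v, (perpEquiv hX ht).symm v = (inner ℝ X v : ℝ) • X + t • projPerp X v :=
        fun v => perpOp_apply X t v
      have h2 : ∀ v, ν X (projPerp X v) = ν X v := fun v => by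
        rw [projPerp_apply, map_sub, map_smul, hν.self, smul_zero, sub_zero]
      have h3 : ν ((perpEquiv hX ht).symm v) ((perpEquiv hX ht).symm w) =
          t • ((inner ℝ X v : ℝ) • ν X w - (inner ℝ X w : ℝ) • ν X v
            + t • ν (projPerp X v) (projPerp X w)) := by
        rw [h1, h1]
        simp only [map_add, map_smul, add_apply, smul_apply, hν.self, h2,
          hν.skew (projPerp X v) X]
        module
      have h4 : ∀ z, perpEquiv hX ht z = (inner ℝ X z : ℝ) • X + t⁻¹ • projPerp X z :=
        fun z => perpOp_apply X t⁻¹ z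
      simp only [G, dif_pos ht]
      rw [glAct_apply, h3, h4, perpOp_apply, zero_smul, add_zero, map_smul (projPerp X), smul_smul,
        inv_mul_cancel₀ ht, one_smul]
    · rw [not_not] at ht
      subst ht
      simp [G, almostAbelian_apply]
  have hcont : Continuous G := by
    refine continuous_bracket_iff.2 fun v w => ?_
    simp only [hG]
    fun_prop
  have h0 : G 0 = almostAbelian X ((projPerp X).comp (ν X)) := by simp [G]
  rw [← h0]
  refine mem_closure_of_tendsto ((hcont.tendsto 0).mono_left (nhdsWithin_le_nhds (s := {0}ᶜ))) ?_
  filter_upwards [self_mem_nhdsWithin] with t ht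
  have ht : t ≠ 0 := ht
  simp only [G, dif_pos ht]
  exact ⟨_, rfl⟩

/-- If `ad x` has imaginary spectrum, then the orbit closure contains almost abelian brackets which
are almost skew-symmetric. -/
theorem exists_almostSkew_mem_closure {μ : V →L[ℝ] V →L[ℝ] V} (hμ : IsLieBracket μ) {x : V}
    (hx : complexSpectrum (μ x) ⊆ {z : ℂ | z.re = 0}) (hx0 : x ≠ 0) {ε : ℝ} (hε : 0 < ε) :
    ∃ (X : V) (D : V →L[ℝ] V), ‖X‖ = 1 ∧ IsTransverse X D ∧ traceSq D = traceSq (μ x) ∧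
      (∀ v, |inner ℝ (D v) v| ≤ ε * ‖v‖ ^ 2) ∧ almostAbelian X D ∈ closure (glOrbit μ) := by
  obtain ⟨h, hh⟩ := exists_conj_abs_inner_le hx hε
  have hhx : ‖h x‖ ≠ 0 := by simpa using hx0
  set c : ℝ := ‖h x‖⁻¹ with hc
  have hc0 : c ≠ 0 := inv_ne_zero hhx
  -- The homothety makes the image of `x` a unit vector `X` without changing the operator by which
  -- it acts, so almost-skewness is kept.
  let g : V ≃L[ℝ] V := h.trans (homothety hc0)
  have hg : ∀ v, g v = c • h v := fun v => rfl
  set X := g x with hX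
  have hX1 : ‖X‖ = 1 := by
    rw [hX, hg, norm_smul, hc, norm_inv, norm_norm, inv_mul_cancel₀ hhx]
  set ν := glAct g μ with hν
  have hνL : IsLieBracket ν := hμ.glAct g
  have hνX : ∀ v, ν X v = h (μ x (h.symm v)) := by
    intro v
    have h1 : g.symm v = c⁻¹ • h.symm v := by
      rw [ContinuousLinearEquiv.symm_apply_eq, hg, map_smul, smul_smul, mul_inv_cancel₀ hc0,
        one_smul, h.apply_symm_apply]
    rw [hν, hX, glAct_apply, g.symm_apply_apply, h1, hg, map_smul, map_smul, smul_smul,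
      mul_inv_cancel₀ hc0, one_smul]
  have hP : ∀ v, ν X (projPerp X v) = ν X v := fun v => by
    rw [projPerp_apply, map_sub, map_smul, hνL.self, smul_zero, sub_zero]
  refine ⟨X, (projPerp X).comp (ν X), hX1, ⟨?_, fun v => inner_projPerp hX1 _⟩, ?_, fun v => ?_,
    closure_glOrbit_subset ⟨g, rfl⟩ (almostAbelian_mem_closure hνL hX1)⟩
  · rw [ContinuousLinearMap.comp_apply, hνL.self, map_zero]
  · have h1 : traceSq (ν X) = traceSq (μ x) := by
      have := trace_glAct_mul g μ X X
      rw [hX, g.symm_apply_apply] at this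
      exact this
    rw [← h1, traceSq, traceSq]
    have h2 : (((projPerp X).comp (ν X) : V →L[ℝ] V) : V →ₗ[ℝ] V) *
        (((projPerp X).comp (ν X) : V →L[ℝ] V) : V →ₗ[ℝ] V) =
        (projPerp X : V →ₗ[ℝ] V) * ((ν X : V →ₗ[ℝ] V) * (ν X : V →ₗ[ℝ] V)) := by
      ext v
      change projPerp X (ν X (projPerp X (ν X v))) = projPerp X (ν X (ν X v))
      rw [hP]
    have h3 : ((ν X : V →ₗ[ℝ] V) * (ν X : V →ₗ[ℝ] V)) * (projPerp X : V →ₗ[ℝ] V) =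
        (ν X : V →ₗ[ℝ] V) * (ν X : V →ₗ[ℝ] V) := by
      ext v
      change ν X (ν X (projPerp X v)) = ν X (ν X v)
      rw [hP]
    rw [h2, LinearMap.trace_mul_comm, h3]
  · have h1 : inner ℝ ((projPerp X).comp (ν X) v) v =
        inner ℝ (h (μ x (h.symm (projPerp X v)))) (projPerp X v) := by
      rw [← hνX, hP, ContinuousLinearMap.comp_apply, projPerp_apply, projPerp_apply,
        inner_sub_left, inner_sub_right, real_inner_smul_left, real_inner_smul_right,
        real_inner_comm X (ν X v)]
      ring
    have h2 : ‖projPerp X v‖ ^ 2 ≤ ‖v‖ ^ 2 := by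
      rw [← real_inner_self_eq_norm_sq, projPerp_apply, inner_sub_left, inner_sub_right,
        inner_sub_right, real_inner_smul_left, real_inner_smul_left, real_inner_smul_right,
        real_inner_smul_right, real_inner_self_eq_norm_sq, real_inner_self_eq_norm_sq, hX1,
        real_inner_comm X v]
      nlinarith [sq_nonneg (inner ℝ X v)]
    rw [h1]
    exact (hh _).trans (by gcongr)

/-- An almost skew-symmetric operator is bounded in terms of the trace of its square. -/
theorem norm_le_of_almostSkew {D : V →L[ℝ] V} (h : ∀ v, |inner ℝ (D v) v| ≤ ‖v‖ ^ 2) :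
    ‖D‖ ≤ Module.finrank ℝ V * √(18 * (Module.finrank ℝ V) ^ 2 - traceSq D) := by
  set n := Module.finrank ℝ V
  set b := stdOrthonormalBasis ℝ V
  -- By polarization, an entry of $D+D^t$ is at most $4+1+1=6$ in absolute value.
  have h1 : ∀ i j, (inner ℝ (D (b i)) (b j) + inner ℝ (D (b j)) (b i)) ^ 2 ≤ 36 := by
    intro i j
    have e : inner ℝ (D (b i)) (b j) + inner ℝ (D (b j)) (b i) =
        inner ℝ (D (b i + b j)) (b i + b j) - inner ℝ (D (b i)) (b i) - inner ℝ (D (b j)) (b j) := by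
      rw [map_add, inner_add_left, inner_add_right, inner_add_right]
      ring
    have e1 := abs_le.1 (h (b i))
    have e2 := abs_le.1 (h (b j))
    have e3 := abs_le.1 (h (b i + b j))
    have e4 : ‖b i + b j‖ ^ 2 ≤ 4 := by
      have := norm_add_le (b i) (b j)
      rw [b.norm_eq_one, b.norm_eq_one] at this
      nlinarith [norm_nonneg (b i + b j)]
    rw [b.norm_eq_one, one_pow] at e1 e2
    have : |inner ℝ (D (b i)) (b j) + inner ℝ (D (b j)) (b i)| ≤ 6 := by
      rw [e, abs_le]
      constructor <;> linarith
    calc _ = |inner ℝ (D (b i)) (b j) + inner ℝ (D (b j)) (b i)| ^ 2 := (sq_abs _).symm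
      _ ≤ 6 ^ 2 := by gcongr
      _ = 36 := by norm_num
  -- This is $|D|^2=\frac12\sum_{i,j}(D_{ij}+D_{ji})^2-\mathrm{tr}\,D^2$, with each square at most
  -- $36$.
  have h2 : ∑ i, ‖D (b i)‖ ^ 2 ≤ 18 * (n : ℝ) ^ 2 - traceSq D := by
    have e1 : ∑ i, ‖D (b i)‖ ^ 2 = ∑ i, ∑ j, ((1 / 2) *
        (inner ℝ (D (b i)) (b j) + inner ℝ (D (b j)) (b i)) ^ 2 -
        inner ℝ (D (b i)) (b j) * inner ℝ (D (b j)) (b i)) := by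
      simp only [← sum_inner_sq b (D _)]
      refine sum_sum_eq_of_symm fun i j => ?_
      ring
    have e2 : traceSq D = ∑ i, ∑ j, inner ℝ (D (b i)) (b j) * inner ℝ (D (b j)) (b i) :=
      trace_mul_self_eq_sum b (D : V →ₗ[ℝ] V)
    rw [e1]
    simp only [Finset.sum_sub_distrib]
    rw [← e2]
    gcongr
    calc _ ≤ ∑ i : Fin n, ∑ j : Fin n, (1 / 2 : ℝ) * 36 := by
          refine Finset.sum_le_sum fun i _ => Finset.sum_le_sum fun j _ => ?_
          have := h1 i j
          linarith
      _ = 18 * (n : ℝ) ^ 2 := by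
          simp
          ring
  refine D.opNorm_le_bound (by positivity) fun v => ?_
  have h3 : ∀ i, ‖D (b i)‖ ≤ √(18 * (n : ℝ) ^ 2 - traceSq D) := by
    intro i
    refine Real.le_sqrt_of_sq_le (le_trans ?_ h2)
    exact Finset.single_le_sum (f := fun i => ‖D (b i)‖ ^ 2) (fun i _ => sq_nonneg _)
      (Finset.mem_univ i)
  have h4 : ∀ i, ‖(inner ℝ (b i) v : ℝ) • D (b i)‖ ≤ ‖v‖ * √(18 * (n : ℝ) ^ 2 - traceSq D) := by
    intro i
    rw [norm_smul]
    have := norm_inner_le_norm (𝕜 := ℝ) (b i) v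
    rw [b.norm_eq_one, one_mul] at this
    exact mul_le_mul this (h3 i) (norm_nonneg _) (norm_nonneg _)
  have h5 : D v = ∑ i, (inner ℝ (b i) v : ℝ) • D (b i) := by
    nth_rewrite 1 [← b.sum_repr' v]
    simp
  rw [h5]
  refine (norm_sum_le_of_le _ fun i _ => h4 i).trans (le_of_eq ?_)
  simp [n]
  ring

/-- The orbit closure of a bracket which is not of real type contains a nonabelian
almost abelian flat bracket. -/
theorem exists_skew_mem_closure {μ : V →L[ℝ] V →L[ℝ] V} (hμ : IsLieBracket μ) {x : V}
    (hx : complexSpectrum (μ x) ⊆ {z : ℂ | z.re = 0}) (hn : ¬ IsNilpotent (μ x)) :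
    ∃ (X : V) (E : V →L[ℝ] V), ‖X‖ = 1 ∧ E X = 0 ∧ E ≠ 0 ∧
      (∀ v w, inner ℝ (E v) w = - inner ℝ (E w) v) ∧ almostAbelian X E ∈ closure (glOrbit μ) := by
  have hx0 : x ≠ 0 := by
    rintro rfl
    rw [map_zero] at hn
    exact hn IsNilpotent.zero
  have key : ∀ k : ℕ, ∃ p : V × (V →L[ℝ] V), ‖p.1‖ = 1 ∧ IsTransverse p.1 p.2 ∧
      traceSq p.2 = traceSq (μ x) ∧ (∀ v, |inner ℝ (p.2 v) v| ≤ (1 / ((k : ℝ) + 1)) * ‖v‖ ^ 2) ∧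
      almostAbelian p.1 p.2 ∈ closure (glOrbit μ) := by
    intro k
    obtain ⟨X, D, h⟩ := exists_almostSkew_mem_closure hμ hx hx0 (Nat.one_div_pos_of_nat (n := k))
    exact ⟨(X, D), h⟩
  choose p h1 h2 h3 h4 h5 using key
  have : ProperSpace (V →L[ℝ] V) := FiniteDimensional.proper ℝ (V →L[ℝ] V)
  have : ProperSpace V := FiniteDimensional.proper ℝ V
  -- The trace of the square is the same for all `k`, so the almost skew operators stay in a fixed
  -- ball and have a convergent subsequence.
  set R : ℝ := Module.finrank ℝ V * √(18 * (Module.finrank ℝ V) ^ 2 - traceSq (μ x))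
  have hbd : ∀ k, p k ∈ Metric.closedBall (0 : V) 1 ×ˢ Metric.closedBall (0 : V →L[ℝ] V) R := by
    intro k
    refine ⟨by rw [mem_closedBall_zero_iff, h1], ?_⟩
    rw [mem_closedBall_zero_iff]
    refine (norm_le_of_almostSkew fun v => (h4 k v).trans ?_).trans (by rw [h3])
    refine mul_le_of_le_one_left (sq_nonneg _) ?_
    rw [div_le_one (by positivity)]
    linarith [(Nat.cast_nonneg k : (0 : ℝ) ≤ k)]
  obtain ⟨⟨X, E⟩, -, φ, hφ, hlim⟩ := ((isCompact_closedBall (0 : V) 1).prod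
    (isCompact_closedBall (0 : V →L[ℝ] V) R)).tendsto_subseq hbd
  have hlim1 : Tendsto (fun k => (p (φ k)).1) atTop (𝓝 X) := (continuous_fst.tendsto _).comp hlim
  have hlim2 : Tendsto (fun k => (p (φ k)).2) atTop (𝓝 E) := (continuous_snd.tendsto _).comp hlim
  have hquad : ∀ v, inner ℝ (E v) v = 0 := by
    intro v
    have e1 : Tendsto (fun k => |inner ℝ ((p (φ k)).2 v) v|) atTop (𝓝 |inner ℝ (E v) v|) :=
      ((((ContinuousLinearMap.apply ℝ V v).continuous.tendsto E).comp hlim2).inner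
        tendsto_const_nhds).abs
    have e2 : Tendsto (fun k => (1 / (((φ k : ℕ) : ℝ) + 1)) * ‖v‖ ^ 2) atTop (𝓝 0) := by
      have := (tendsto_one_div_add_atTop_nhds_zero_nat.comp hφ.tendsto_atTop).mul_const (‖v‖ ^ 2)
      simpa using this
    exact abs_nonpos_iff.1 (le_of_tendsto_of_tendsto' e1 e2 fun k => h4 (φ k) v)
  refine ⟨X, E, ?_, ?_, ?_, fun v w => ?_, ?_⟩
  · exact tendsto_nhds_unique hlim1.norm (by simp only [h1]; exact tendsto_const_nhds)
  · refine tendsto_nhds_unique ((isBoundedBilinearMap_apply.continuous.tendsto (E, X)).comp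
      (hlim2.prodMk_nhds hlim1)) ?_
    simp only [Function.comp_def, (h2 _).apply_eq_zero]
    exact tendsto_const_nhds
  -- The trace of the square passes to the limit, where it is still that of $\mathrm{ad}\,x$. This
  -- is negative, since $\mathrm{ad}\,x$ has imaginary spectrum and is not nilpotent.
  · rintro rfl
    have e1 := (continuous_traceSq.tendsto _).comp hlim2
    have e2 : traceSq (0 : V →L[ℝ] V) = traceSq (μ x) := by
      refine tendsto_nhds_unique e1 ?_
      simp only [Function.comp_def, h3]
      exact tendsto_const_nhds
    have e3 := traceSq_neg hx hn
    rw [← e2] at e3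
    simp [traceSq] at e3
  · have e1 := hquad (v + w)
    rw [map_add, inner_add_left, inner_add_right, inner_add_right, hquad, hquad] at e1
    linarith
  · exact isClosed_closure.mem_of_tendsto ((continuous_almostAbelian.tendsto (X, E)).comp hlim)
      (Eventually.of_forall fun k => h5 (φ k))

theorem exists_mem_pinchingValues_lt {μ ν : V →L[ℝ] V →L[ℝ] V} (hν : ν ∈ closure (glOrbit μ))
    (hs : scalarCurvature ν ≠ 0) {ε : ℝ} (hε : pinching ν < ε) :
    ∃ t ∈ pinchingValues (glOrbit μ), t < ε := by
  have h1 : ∀ᶠ ν' in 𝓝 ν, scalarCurvature ν' ≠ 0 :=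
    continuous_scalarCurvature.continuousAt.eventually_ne hs
  have h2 : ∀ᶠ ν' in 𝓝 ν, pinching ν' < ε := (continuousAt_pinching hs).eventually_lt_const hε
  obtain ⟨ν', hν', h3, h4⟩ := ((mem_closure_iff_frequently.1 hν).and_eventually (h1.and h2)).exists
  exact ⟨_, ⟨ν', ⟨hν', not_mem_flatBrackets h3⟩, rfl⟩, h4⟩

/-- The flat limit bracket with skew `E` is stretched along a unit `y` orthogonal to `X` with `E y ≠
0`. The result stays in the orbit closure, has nonzero scalar curvature and arbitrarily small $F$;
by continuity nearby points of the orbit have both properties. -/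
theorem pinchingInf_eq_zero_of_not_mem_realType {μ : V →L[ℝ] V →L[ℝ] V}
    (hμ : μ ∈ solvableBrackets V) (hr : μ ∉ realType V) :
    (pinchingValues (glOrbit μ)).Nonempty ∧ pinchingInf μ = 0 := by
  obtain ⟨x, hx⟩ : ∃ x, ¬ (IsNilpotent (μ x) ∨ ¬ complexSpectrum (μ x) ⊆ {z : ℂ | z.re = 0}) := by
    by_contra h
    push Not at h
    exact hr ⟨hμ, h⟩
  rw [not_or, not_not] at hx
  obtain ⟨hL, -⟩ := id hμ
  obtain ⟨X, E, hX, hEX, hE0, hE, hcl⟩ := exists_skew_mem_closure hL hx.2 hx.1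
  obtain ⟨v, hv⟩ : ∃ v, E v ≠ 0 := by
    by_contra h
    push Not at h
    exact hE0 (ContinuousLinearMap.ext h)
  have hEw : E (projPerp X v) = E v := by
    rw [projPerp_apply, map_sub, map_smul, hEX, smul_zero, sub_zero]
  have hw : projPerp X v ≠ 0 := fun h => hv (by rw [← hEw, h, map_zero])
  obtain ⟨c, hc, hy⟩ := exists_smul_mem_sphere hw
  rw [mem_sphere_zero_iff_norm] at hy
  set y := c • projPerp X v with hyd
  have hXy : inner ℝ X y = 0 := by rw [hyd, inner_smul_right, inner_projPerp hX, mul_zero]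
  have hEy : E y ≠ 0 := by
    rw [hyd, map_smul, hEw]
    exact smul_ne_zero hc hv
  have hsmall : ∀ ε : ℝ, 0 < ε → ∃ t ∈ pinchingValues (glOrbit μ), t < ε := by
    intro ε hε
    obtain ⟨s, hs, hsε⟩ := exists_stretch_factor hε
    obtain ⟨h1, h2⟩ := pinching_stretch hE hX hEX hy hXy hs hEy
    have hs0 : s ≠ 0 := by positivity
    have h3 := glAct_mem_closure_glOrbit (scaling hy hs0) hcl
    rw [glAct_scaling_almostAbelian hE hy hXy hs0] at h3
    exact exists_mem_pinchingValues_lt h3 h1 (h2.trans_lt hsε)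
  refine ⟨?_, le_antisymm (le_of_forall_pos_lt_add fun ε hε => ?_) (pinchingInf_nonneg μ)⟩
  · obtain ⟨t, ht, -⟩ := hsmall 1 one_pos
    exact ⟨t, ht⟩
  · obtain ⟨t, ht, htε⟩ := hsmall ε hε
    rw [zero_add]
    exact (csInf_le (bddBelow_pinchingValues _) ht).trans_lt htε

end RicciPinching

theorem mainTheorem4 {V : Type*} [NormedAddCommGroup V] [InnerProductSpace ℝ V]
    [FiniteDimensional ℝ V] :
    (∀ μ ∈ realType V, μ ≠ 0 →
      0 < pinchingInf μ ∧
      pinchingValues (closure (glOrbit μ)) = Set.Icc (pinchingInf μ) (pinchingSup μ)) ∧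
    (4 ≤ Module.finrank ℝ V →
      IsGLB {m : ℝ | ∃ μ ∈ realType V, μ ≠ 0 ∧ m = pinchingInf μ} 0 ∧
      pinchingValues (realType V) = Set.Ioc 0 (Module.finrank ℝ V : ℝ)) ∧
    (∀ μ ∈ solvableBrackets V, μ ∉ realType V →
      (pinchingValues (glOrbit μ)).Nonempty ∧ pinchingInf μ = 0) := by
  exact ⟨fun μ hμ h0 => pinchingInf_pos_and_pinchingValues_closure_eq hμ h0,
    fun hn => ⟨isGLB_pinchingInf hn, pinchingValues_realType hn⟩,
    fun μ hμ hr => pinchingInf_eq_zero_of_not_mem_realType hμ hr⟩
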